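/- Let $\mathcal{C}$ be a category and $\mathcal{M}$ a subcategory of $\mathcal{C}$. Let $\mathcal{C}^{\square}$ be the category whose objects are the arrows $f:Y\to X$ of $\mathcal{M}$, written $(X,Y)$, and whose morphisms are the commutative squares in $\mathcal{C}$. For composable arrows $f:Z\to Y$ and $g:Y\to X$ of $\mathcal{M}$ let $\boxtimes:(Y,Z)\to(X,Z)$, $\boxplus:(X,Z)\to(X,Y)$ and $\partial=\boxplus\boxtimes:(Y,Z)\to(X,Y)$ be the morphisms of $\mathcal{C}^{\square}$ given by the pairs of arrows $(\mathrm{id}_Z,g)$, $(f,\mathrm{id}_X)$ and $(f,g)$. The *homology theory* $\mathbb{T}$ is the following regular theory. It has a sort $h_n(X,Y)$ for each $n\in\mathbb{Z}$ and each object $(X,Y)$ of $\mathcal{C}^{\square}$; function symbols $+,-,0$ on each sort, $\square_n:h_n(X,Y)\to h_n(X',Y')$ for each morphism $\square:(X,Y)\to(X',Y')$ of $\mathcal{C}^{\square}$, and $\partial_n:h_n(X,Y)\to h_{n-1}(Y,Z)$ for each pair of composable arrows $Z\to Y\to X$ of $\mathcal{M}$; and no relation symbols other than equality. Its axioms are the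 regular sequents expressing: 1. each $h_n(X,Y)$ is an abelian group; 2. all $\square_n$ and $\partial_n$ are group homomorphisms; 3. $\square'_n(\square_n(x))=(\square'\square)_n(x)$, $(\mathrm{id})_n(x)=x$, and $\Diamond_{n-1}(\partial_n(x))=\partial'_n(\square_n(x))$ for all $\Diamond:(Y,Z)\to(Y',Z')$ and $\square:(X,Y)\to(X',Y')$ such that $\square\,\partial=\partial'\,\Diamond$ in $\mathcal{C}^{\square}$; 4. for all $Z\to Y\to X$ in $\mathcal{M}$ and all $n$, the sequence $h_n(Y,Z)\xrightarrow{\boxtimes_n}h_n(X,Z)\xrightarrow{\boxplus_n}h_n(X,Y)\xrightarrow{\partial_n}h_{n-1}(Y,Z)\xrightarrow{\boxtimes_{n-1}}h_{n-1}(X,Z)$ is a complex and is exact at its three inner terms. Let $\mathcal{C}_{\mathbb{T}}^{\mathrm{reg}}$ be the regular syntactic category of $\mathbb{T}$: its objects are the regular formulas in context (up to renaming of variables), and its morphisms are the classes, up to $\mathbb{T}$-provable equivalence, of $\mathbb{T}$-provably functional regular formulas. Let $\mathcal{A}[\mathbb{T}]$ be the full subcategory of the category of sheaves on $\mathcal{C}_{\mathbb{T}}^{\mathrm{reg}}$,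 for the topology in which the coverings are given by the regular epimorphisms, on the coequalizers of equivalence relations in $\mathcal{C}_{\mathbb{T}}^{\mathrm{reg}}$. A category is *Barr exact* if it is regular and each of its equivalence relations is a kernel pair. A *regular* functor is one that preserves finite limits and regular epimorphisms; between Barr exact categories regular functors are called *exact*, and $\mathsf{Ex}(\mathcal{A},\mathcal{E})$ denotes the category of exact functors $\mathcal{A}\to\mathcal{E}$. For a regular category $\mathcal{E}$, $\mathbb{T}\text{-}\mathsf{Mod}(\mathcal{E})$ denotes the category of models of $\mathbb{T}$ in $\mathcal{E}$. Then: (a) $\mathcal{C}_{\mathbb{T}}^{\mathrm{reg}}$ is regular and $\mathcal{A}[\mathbb{T}]$, with the canonical functor $\mathcal{C}_{\mathbb{T}}^{\mathrm{reg}}\to\mathcal{A}[\mathbb{T}]$, is its Barr exact completion: $\mathcal{A}[\mathbb{T}]$ is Barr exact, the canonical functor is regular, and for each Barr exact category $\mathcal{E}$ restriction along it is an equivalence from $\mathsf{Ex}(\mathcal{A}[\mathbb{T}],\mathcal{E})$ to the category of regular functors $\mathcal{C}_{\mathbb{T}}^{\mathrm{reg}}\to\mathcal{E}$. (b) $\mathcal{A}[\mathbb{T}]$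 is an abelian category. (c) There is a model $H^{\mathbb{T}}$ of $\mathbb{T}$ in $\mathcal{A}[\mathbb{T}]$ such that for each Barr exact (in particular, each abelian) category $\mathcal{E}$ the assignment $F\mapsto F(H^{\mathbb{T}})$ is an equivalence $$\mathsf{Ex}(\mathcal{A}[\mathbb{T}],\mathcal{E})\;\cong\;\mathbb{T}\text{-}\mathsf{Mod}(\mathcal{E}).$$ -/

import Mathlib

open CategoryTheory Limits

universe u v u' v' w

namespace RegLogic

/-! ### Many-sorted regular logic

Formulas are formulas-in-context with de Bruijn variables, so that `α`-equivalent formulas are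
equal.  A context is the list of the sorts of its variables; in `s :: Γ` the variable of sort `s`
is the variable number `0`. -/

/-- A many-sorted signature without relation symbols other than equality. -/
structure Signature where
  /-- sorts -/
  Srt : Type w
  /-- function symbols -/
  Fn : Type w
  /-- the list of the sorts of the arguments of a function symbol -/
  dom : Fn → List Srt
  /-- the sort of the value of a function symbol -/
  cod : Fn → Srt

/-- `Var Γ s` is the type of the variables of sort `s` in the context `Γ`. -/
inductive Var {A : Type w} : List A → A → Type w
  | zero {Γ : List A} {s : A} : Var (s :: Γ) s
  | succ {Γ : List A} {s t : A} : Var Γ s → Var (t :: Γ) s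

namespace Var

variable {A : Type w}

/-- The variables of `Δ`, as variables of the concatenation `Δ ++ Γ`. -/
def inl {Γ : List A} : ∀ {Δ : List A} {s : A}, Var Δ s → Var (Δ ++ Γ) s
  | _, _, zero => zero
  | _, _, succ x => succ (inl x)

/-- The variables of `Γ`, as variables of the concatenation `Δ ++ Γ`. -/
def inr {Γ : List A} : ∀ (Δ : List A) {s : A}, Var Γ s → Var (Δ ++ Γ) s
  | [], _, x => x
  | _ :: Δ, _, x => succ (inr Δ x)

end Var

/-- Terms in context. -/
inductive Term (S : Signature.{w}) (Γ : List S.Srt) : S.Srt → Type w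
  | var {s : S.Srt} : Var Γ s → Term S Γ s
  | app (f : S.Fn) (args : ∀ s, Var (S.dom f) s → Term S Γ s) : Term S Γ (S.cod f)

/-- Regular formulas in context: built from `⊤`, `=`, `∧` and `∃`. -/
inductive Formula (S : Signature.{w}) : List S.Srt → Type w
  | top {Γ : List S.Srt} : Formula S Γ
  | eq {Γ : List S.Srt} {s : S.Srt} (t t' : Term S Γ s) : Formula S Γ
  | and {Γ : List S.Srt} (φ ψ : Formula S Γ) : Formula S Γ
  | ex {Γ : List S.Srt} (s : S.Srt) (φ : Formula S (s :: Γ)) : Formula S Γ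

/-- A simultaneous substitution: a term in context `Δ` for each variable of `Γ`. -/
abbrev Sub (S : Signature.{w}) (Γ Δ : List S.Srt) : Type w := ∀ s, Var Γ s → Term S Δ s

variable {S : Signature.{w}}

/-- Substitution in a term. -/
def Term.sub {Γ Δ : List S.Srt} (σ : Sub S Γ Δ) : ∀ {s : S.Srt}, Term S Γ s → Term S Δ s
  | _, .var x => σ _ x
  | _, .app f args => .app f (fun s x => (args s x).sub σ)

namespace Sub

variable {Γ Δ Ξ Θ : List S.Srt}

/-- The empty substitution. -/
def nil : Sub S [] Γ := fun _ x => nomatch x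

/-- Extend a substitution by a term for one more variable. -/
def cons {s : S.Srt} (t : Term S Δ s) (σ : Sub S Γ Δ) : Sub S (s :: Γ) Δ
  | _, .zero => t
  | _, .succ x => σ _ x

/-- Forget the term for the first variable. -/
def tail {s : S.Srt} (σ : Sub S (s :: Γ) Δ) : Sub S Γ Δ := fun _ x => σ _ x.succ

/-- The identity substitution. -/
def id (Γ : List S.Srt) : Sub S Γ Γ := fun _ x => .var x

/-- Weakening by one variable. -/
def wk (s : S.Srt) : Sub S Γ (s :: Γ) := fun _ x => .var x.succ

/-- Composition of substitutions. -/
def comp (σ : Sub S Γ Δ) (τ : Sub S Δ Ξ) : Sub S Γ Ξ := fun s x => (σ s x).sub τ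

/-- The extension of a substitution under a binder. -/
def lift (σ : Sub S Γ Δ) (s : S.Srt) : Sub S (s :: Γ) (s :: Δ) := cons (.var .zero) (σ.comp (wk s))

/-- The two substitutions on `Δ` and `Γ` together, on the concatenated context. -/
def append : ∀ {Δ : List S.Srt}, Sub S Δ Ξ → Sub S Γ Ξ → Sub S (Δ ++ Γ) Ξ
  | [], _, σ => σ
  | _ :: _, τ, σ => cons (τ _ .zero) (append (tail τ) σ)

/-- The variables of `Δ` in the context `Δ ++ Γ`. -/
def left (Δ Γ : List S.Srt) : Sub S Δ (Δ ++ Γ) := fun _ x => .var x.inl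

/-- The variables of `Γ` in the context `Δ ++ Γ`. -/
def right (Δ Γ : List S.Srt) : Sub S Γ (Δ ++ Γ) := fun _ x => .var (x.inr Δ)

end Sub

/-- (Capture-avoiding) substitution in a formula. -/
def Formula.sub : ∀ {Γ Δ : List S.Srt}, Sub S Γ Δ → Formula S Γ → Formula S Δ
  | _, _, _, .top => .top
  | _, _, σ, .eq t t' => .eq (t.sub σ) (t'.sub σ)
  | _, _, σ, .and φ ψ => .and (φ.sub σ) (ψ.sub σ)
  | _, _, σ, .ex s φ => .ex s (φ.sub (σ.lift s))

/-- Existential quantification over a block of variables. -/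
def Formula.exs {Γ : List S.Srt} : ∀ (Δ : List S.Srt), Formula S (Δ ++ Γ) → Formula S Γ
  | [], φ => φ
  | s :: Δ, φ => Formula.exs Δ (.ex s φ)

/-- The conjunction of the equations between two lists of terms. -/
def Formula.eqs {Ξ : List S.Srt} : ∀ {Δ : List S.Srt}, Sub S Δ Ξ → Sub S Δ Ξ → Formula S Ξ
  | [], _, _ => .top
  | _ :: _, τ, τ' =>
    .and (.eq (τ _ .zero) (τ' _ .zero)) (Formula.eqs (Sub.tail τ) (Sub.tail τ'))

variable (S) in
/-- A regular theory: a collection of sequents `φ ⊢ ψ` of regular formulas in context. -/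
def Theory : Type w := ∀ Γ : List S.Srt, Formula S Γ → Formula S Γ → Prop

/-- Provability of the sequent `φ ⊢_Γ ψ` from `T` in the sequent calculus of regular logic. -/
inductive Prov (T : Theory S) : ∀ {Γ : List S.Srt}, Formula S Γ → Formula S Γ → Prop
  | ax {Γ : List S.Srt} {φ ψ : Formula S Γ} : T Γ φ ψ → Prov T φ ψ
  | refl {Γ : List S.Srt} (φ : Formula S Γ) : Prov T φ φ
  | cut {Γ : List S.Srt} {φ ψ χ : Formula S Γ} : Prov T φ ψ → Prov T ψ χ → Prov T φ χ
  | subst {Γ Δ : List S.Srt} {φ ψ : Formula S Γ} (σ : Sub S Γ Δ) :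
      Prov T φ ψ → Prov T (φ.sub σ) (ψ.sub σ)
  | eq_refl {Γ : List S.Srt} {s : S.Srt} (t : Term S Γ s) : Prov T .top (.eq t t)
  | eq_subst {Γ : List S.Srt} {s : S.Srt} (t t' : Term S Γ s) (φ : Formula S (s :: Γ)) :
      Prov T (.and (.eq t t') (φ.sub ((Sub.id Γ).cons t))) (φ.sub ((Sub.id Γ).cons t'))
  | top_intro {Γ : List S.Srt} (φ : Formula S Γ) : Prov T φ .top
  | and_left {Γ : List S.Srt} (φ ψ : Formula S Γ) : Prov T (.and φ ψ) φ
  | and_right {Γ : List S.Srt} (φ ψ : Formula S Γ) : Prov T (.and φ ψ) ψ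
  | and_intro {Γ : List S.Srt} {φ ψ χ : Formula S Γ} :
      Prov T χ φ → Prov T χ ψ → Prov T χ (.and φ ψ)
  | ex_elim {Γ : List S.Srt} {s : S.Srt} {φ : Formula S (s :: Γ)} {ψ : Formula S Γ} :
      Prov T φ (ψ.sub (Sub.wk s)) → Prov T (.ex s φ) ψ
  | ex_intro {Γ : List S.Srt} {s : S.Srt} {φ : Formula S (s :: Γ)} {ψ : Formula S Γ} :
      Prov T (.ex s φ) ψ → Prov T φ (ψ.sub (Sub.wk s))
  | frobenius {Γ : List S.Srt} {s : S.Srt} (φ : Formula S Γ) (ψ : Formula S (s :: Γ)) :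
      Prov T (.and φ (.ex s ψ)) (.ex s (.and (φ.sub (Sub.wk s)) ψ))

/-! ### Elementary facts about substitution and provability -/

section Substitution

variable {Γ Δ Ξ Θ : List S.Srt}

theorem Term.sub_id {s : S.Srt} (t : Term S Γ s) : t.sub (Sub.id Γ) = t := by
  induction t with
  | var x => rfl
  | app f args ih => simp only [Term.sub]; congr 1; funext s x; exact ih s x

theorem Term.sub_sub (σ : Sub S Γ Δ) (τ : Sub S Δ Ξ) {s : S.Srt} (t : Term S Γ s) :
    (t.sub σ).sub τ = t.sub (σ.comp τ) := by
  induction t with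
  | var x => rfl
  | app f args ih => simp only [Term.sub]; congr 1; funext s x; exact ih s x

theorem Sub.comp_assoc (σ : Sub S Γ Δ) (τ : Sub S Δ Ξ) (ρ : Sub S Ξ Θ) :
    (σ.comp τ).comp ρ = σ.comp (τ.comp ρ) := by
  funext s x; exact Term.sub_sub _ _ _

theorem Sub.comp_id (σ : Sub S Γ Δ) : σ.comp (Sub.id Δ) = σ := by
  funext s x; exact Term.sub_id _

theorem Sub.id_comp (σ : Sub S Γ Δ) : (Sub.id Γ).comp σ = σ := rfl

theorem Sub.wk_cons {s : S.Srt} (t : Term S Δ s) (σ : Sub S Γ Δ) :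
    (Sub.wk s).comp (Sub.cons t σ) = σ := rfl

theorem Sub.cons_comp {s : S.Srt} (t : Term S Δ s) (σ : Sub S Γ Δ) (τ : Sub S Δ Ξ) :
    (Sub.cons t σ).comp τ = Sub.cons (t.sub τ) (σ.comp τ) := by
  funext s x; cases x <;> rfl

theorem Sub.lift_comp_cons {s : S.Srt} (σ : Sub S Γ Δ) (t : Term S Ξ s) (τ : Sub S Δ Ξ) :
    (σ.lift s).comp (Sub.cons t τ) = Sub.cons t (σ.comp τ) := by
  rw [Sub.lift, Sub.cons_comp, Sub.comp_assoc, Sub.wk_cons]; rfl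

theorem Sub.lift_comp (σ : Sub S Γ Δ) (τ : Sub S Δ Ξ) (s : S.Srt) :
    (σ.lift s).comp (τ.lift s) = (σ.comp τ).lift s := by
  rw [Sub.lift, Sub.lift, Sub.lift, Sub.cons_comp, Sub.comp_assoc, Sub.wk_cons, Sub.comp_assoc]; rfl

theorem Sub.lift_id (s : S.Srt) : (Sub.id Γ).lift s = Sub.id (s :: Γ) := by
  funext s x; cases x <;> rfl

theorem Formula.sub_id (φ : Formula S Γ) : φ.sub (Sub.id Γ) = φ := by
  induction φ with
  | top => rfl
  | eq t t' => simp only [Formula.sub, Term.sub_id]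
  | and φ ψ h h' => simp only [Formula.sub, h, h']
  | ex s φ h => simp only [Formula.sub, Sub.lift_id, h]

theorem Formula.sub_sub (φ : Formula S Γ) :
    ∀ {Δ Ξ : List S.Srt} (σ : Sub S Γ Δ) (τ : Sub S Δ Ξ),
      (φ.sub σ).sub τ = φ.sub (σ.comp τ) := by
  induction φ with
  | top => intros; rfl
  | eq t t' => intros; simp only [Formula.sub, Term.sub_sub]
  | and φ ψ h h' => intros; simp only [Formula.sub, h, h']
  | ex s φ h => intros; simp only [Formula.sub, h, Sub.lift_comp]

theorem Sub.append_comp (τ : Sub S Δ Ξ) (σ : Sub S Γ Ξ) (ρ : Sub S Ξ Θ) :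
    (Sub.append τ σ).comp ρ = Sub.append (τ.comp ρ) (σ.comp ρ) := by
  induction Δ with
  | nil => rfl
  | cons s Δ ih =>
    rw [Sub.append, Sub.cons_comp, ih]; rfl

theorem Sub.left_append (τ : Sub S Δ Ξ) (σ : Sub S Γ Ξ) :
    (Sub.left Δ Γ).comp (Sub.append τ σ) = τ := by
  funext s x
  induction x with
  | zero => rfl
  | succ x ih => exact ih (Sub.tail τ)

theorem Sub.right_append (τ : Sub S Δ Ξ) (σ : Sub S Γ Ξ) :
    (Sub.right Δ Γ).comp (Sub.append τ σ) = σ := by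
  induction Δ with
  | nil => rfl
  | cons s Δ ih => exact ih (Sub.tail τ)

theorem Sub.append_left_right (Δ Γ : List S.Srt) :
    Sub.append (Sub.left Δ Γ) (Sub.right Δ Γ) = Sub.id (Δ ++ Γ) := by
  induction Δ with
  | nil => rfl
  | cons t Δ ih =>
    have h := congrArg (fun ρ => Sub.comp ρ (Sub.wk t)) ih
    simp only [Sub.append_comp] at h
    funext s x
    cases x with
    | zero => rfl
    | succ x => exact congrFun (congrFun h s) x

theorem Sub.append_eta (ρ : Sub S (Δ ++ Γ) Ξ) :
    Sub.append ((Sub.left Δ Γ).comp ρ) ((Sub.right Δ Γ).comp ρ) = ρ := by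
  rw [← Sub.append_comp, Sub.append_left_right, Sub.id_comp]

theorem Formula.sub_eqs (τ τ' : Sub S Δ Ξ) (ρ : Sub S Ξ Θ) :
    (Formula.eqs τ τ').sub ρ = Formula.eqs (τ.comp ρ) (τ'.comp ρ) := by
  induction Δ with
  | nil => rfl
  | cons s Δ ih =>
    rw [Formula.eqs, Formula.sub, ih]; rfl

theorem Formula.sub_exs (σ : Sub S Γ Ξ) (φ : Formula S (Δ ++ Γ)) :
    (Formula.exs Δ φ).sub σ =
      Formula.exs Δ (φ.sub (Sub.append (Sub.left Δ Ξ) (σ.comp (Sub.right Δ Ξ)))) := by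
  induction Δ with
  | nil => exact congrArg (fun ρ => Formula.sub ρ φ) (Sub.comp_id σ).symm
  | cons s Δ ih =>
    refine (ih (.ex s φ)).trans ?_
    have e : (Sub.append (Sub.left Δ Ξ) (σ.comp (Sub.right Δ Ξ))).lift s =
        Sub.append (Sub.left (s :: Δ) Ξ) (σ.comp (Sub.right (s :: Δ) Ξ)) := by
      rw [Sub.lift, Sub.append_comp, Sub.comp_assoc]; rfl
    simp only [Formula.sub, e]; rfl

end Substitution

namespace Prov

variable {T : Theory S} {Γ Δ Ξ : List S.Srt}

theorem and_fst {χ φ ψ : Formula S Γ} (h : Prov T χ (.and φ ψ)) : Prov T χ φ :=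
  h.cut (and_left _ _)

theorem and_snd {χ φ ψ : Formula S Γ} (h : Prov T χ (.and φ ψ)) : Prov T χ ψ :=
  h.cut (and_right _ _)

theorem ex_of {s : S.Srt} {χ : Formula S Γ} (φ : Formula S (s :: Γ)) (t : Term S Γ s)
    (h : Prov T χ (φ.sub ((Sub.id Γ).cons t))) : Prov T χ (.ex s φ) := by
  refine h.cut ?_
  have h' := (ex_intro (refl (T := T) (.ex s φ))).subst ((Sub.id Γ).cons t)
  rwa [Formula.sub_sub, Sub.wk_cons, Formula.sub_id] at h'

theorem eq_of {s : S.Srt} {χ : Formula S Γ} {t t' : Term S Γ s} (φ : Formula S (s :: Γ))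
    (h : Prov T χ (.eq t t')) (h' : Prov T χ (φ.sub ((Sub.id Γ).cons t))) :
    Prov T χ (φ.sub ((Sub.id Γ).cons t')) :=
  (and_intro h h').cut (eq_subst t t' φ)

theorem exs_of {χ : Formula S Ξ} {φ : Formula S (Δ ++ Γ)} (τ : Sub S Δ Ξ) (σ : Sub S Γ Ξ)
    (h : Prov T χ (φ.sub (Sub.append τ σ))) : Prov T χ ((Formula.exs Δ φ).sub σ) := by
  induction Δ with
  | nil => exact h
  | cons s Δ ih =>
    refine ih (φ := .ex s φ) (Sub.tail τ) ?_
    refine ex_of _ (τ _ .zero) ?_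
    rw [Formula.sub_sub, Sub.lift_comp_cons, Sub.comp_id]
    exact h

theorem exs_elim {φ : Formula S (Δ ++ Γ)} {ψ : Formula S Γ}
    (h : Prov T φ (ψ.sub (Sub.right Δ Γ))) : Prov T (Formula.exs Δ φ) ψ := by
  induction Δ with
  | nil => exact h.cut (by rw [show Sub.right [] Γ = Sub.id Γ from rfl, Formula.sub_id]; exact refl _)
  | cons s Δ ih =>
    refine ih (φ := .ex s φ) (ex_elim ?_)
    rw [Formula.sub_sub]
    exact h

theorem exs_frobenius (χ : Formula S Γ) (φ : Formula S (Δ ++ Γ)) :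
    Prov T (.and χ (Formula.exs Δ φ)) (Formula.exs Δ (.and (χ.sub (Sub.right Δ Γ)) φ)) := by
  induction Δ with
  | nil =>
    rw [show Sub.right [] Γ = Sub.id Γ from rfl, Formula.sub_id]; exact refl _
  | cons s Δ ih =>
    refine (ih (.ex s φ)).cut (exs_elim ?_)
    have h := exs_of (T := T) (φ := .ex s (.and (χ.sub (Sub.right (s :: Δ) Γ)) φ))
      (Sub.left Δ Γ) (Sub.right Δ Γ) (refl _)
    refine Prov.cut ?_ h
    rw [Sub.append_left_right, Formula.sub_id]
    refine (frobenius _ _).cut ?_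
    rw [Formula.sub_sub]
    exact refl _

/-- Elimination of a block of existential quantifiers, in the style of forcing. -/
theorem exs_force {χ ψ : Formula S Ξ} {φ : Formula S (Δ ++ Γ)} {σ : Sub S Γ Ξ}
    (h : Prov T χ ((Formula.exs Δ φ).sub σ))
    (H : ∀ {Θ : List S.Srt} (ρ : Sub S Ξ Θ) (τ : Sub S Δ Θ) (ω : Formula S Θ),
      Prov T ω (χ.sub ρ) → Prov T ω (φ.sub (Sub.append τ (σ.comp ρ))) → Prov T ω (ψ.sub ρ)) :
    Prov T χ ψ := by
  rw [Formula.sub_exs] at h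
  refine ((and_intro (refl χ) h).cut (exs_frobenius _ _)).cut (exs_elim ?_)
  refine H (Sub.right Δ Ξ) (Sub.left Δ Ξ) _ (and_left _ _) (and_right _ _)

theorem force {φ ψ : Formula S Γ} (h : Prov T φ ψ) {Ξ : List S.Srt} {ω : Formula S Ξ}
    {σ : Sub S Γ Ξ} (h' : Prov T ω (φ.sub σ)) : Prov T ω (ψ.sub σ) :=
  h'.cut (h.subst σ)

theorem eqs_refl {χ : Formula S Ξ} (τ : Sub S Δ Ξ) : Prov T χ (Formula.eqs τ τ) := by
  induction Δ with
  | nil => exact top_intro _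
  | cons s Δ ih => exact and_intro ((top_intro _).cut (eq_refl _)) (ih _)

/-- Replacement of equals by equals. -/
theorem eqs_force {χ : Formula S Ξ} {τ τ' : Sub S Δ Ξ} (φ : Formula S (Δ ++ Γ)) (σ : Sub S Γ Ξ)
    (h : Prov T χ (Formula.eqs τ τ')) (h' : Prov T χ (φ.sub (Sub.append τ σ))) :
    Prov T χ (φ.sub (Sub.append τ' σ)) := by
  induction Δ generalizing Γ with
  | nil => exact h'
  | cons s Δ ih =>
    have h₁ := eq_of (φ.sub (Sub.cons (.var .zero) ((Sub.append (Sub.tail τ) σ).comp (Sub.wk s))))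
      h.and_fst (by
        rw [Formula.sub_sub, Sub.cons_comp, Sub.comp_assoc, Sub.wk_cons, Sub.comp_id]; exact h')
    rw [Formula.sub_sub, Sub.cons_comp, Sub.comp_assoc, Sub.wk_cons, Sub.comp_id] at h₁
    have e : ∀ ρ : Sub S Δ Ξ, (φ.sub (Sub.cons ((τ' _ .zero).sub (Sub.right Δ Ξ))
          (Sub.append (Sub.left Δ Ξ) (σ.comp (Sub.right Δ Ξ))))).sub (Sub.append ρ (Sub.id Ξ)) =
        φ.sub (Sub.cons (τ' _ .zero) (Sub.append ρ σ)) := fun ρ => by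
      rw [Formula.sub_sub, Sub.cons_comp, Sub.append_comp, Sub.left_append, Sub.comp_assoc,
        Sub.right_append, Sub.comp_id, Term.sub_sub, Sub.right_append, Term.sub_id]
    have h₂ := ih _ (Sub.id Ξ) h.and_snd (by rw [e]; exact h₁)
    rw [e] at h₂
    exact h₂

theorem eqs_force_right {χ : Formula S Ξ} {σ σ' : Sub S Γ Ξ} (φ : Formula S (Δ ++ Γ))
    (τ : Sub S Δ Ξ) (h : Prov T χ (Formula.eqs σ σ'))
    (h' : Prov T χ (φ.sub (Sub.append τ σ))) : Prov T χ (φ.sub (Sub.append τ σ')) := by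
  have e : ∀ ρ : Sub S Γ Ξ, (φ.sub (Sub.append (τ.comp (Sub.right Γ Ξ)) (Sub.left Γ Ξ))).sub
      (Sub.append ρ (Sub.id Ξ)) = φ.sub (Sub.append τ ρ) := fun ρ => by
    rw [Formula.sub_sub, Sub.append_comp, Sub.left_append, Sub.comp_assoc, Sub.right_append,
      Sub.comp_id]
  have h₁ := eqs_force _ (Sub.id Ξ) h (by rw [e]; exact h')
  rwa [e] at h₁

theorem eqs_symm {χ : Formula S Ξ} {τ τ' : Sub S Δ Ξ} (h : Prov T χ (Formula.eqs τ τ')) :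
    Prov T χ (Formula.eqs τ' τ) := by
  have e : ∀ ρ : Sub S Δ Ξ, (Formula.eqs (Sub.left Δ Ξ) (τ.comp (Sub.right Δ Ξ))).sub
      (Sub.append ρ (Sub.id Ξ)) = Formula.eqs ρ τ := fun ρ => by
    rw [Formula.sub_eqs, Sub.left_append, Sub.comp_assoc, Sub.right_append, Sub.comp_id]
  have h₁ := eqs_force _ (Sub.id Ξ) h (by rw [e]; exact eqs_refl τ)
  rwa [e] at h₁

theorem eqs_trans {χ : Formula S Ξ} {τ τ' τ'' : Sub S Δ Ξ} (h : Prov T χ (Formula.eqs τ τ'))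
    (h' : Prov T χ (Formula.eqs τ' τ'')) : Prov T χ (Formula.eqs τ τ'') := by
  have e : ∀ ρ : Sub S Δ Ξ, (Formula.eqs (τ.comp (Sub.right Δ Ξ)) (Sub.left Δ Ξ)).sub
      (Sub.append ρ (Sub.id Ξ)) = Formula.eqs τ ρ := fun ρ => by
    rw [Formula.sub_eqs, Sub.left_append, Sub.comp_assoc, Sub.right_append, Sub.comp_id]
  have h₁ := eqs_force _ (Sub.id Ξ) h' (by rw [e]; exact h)
  rwa [e] at h₁

end Prov

/-! ### The regular syntactic category -/

/-- The objects of the regular syntactic category: regular formulas in context `{x. φ}`. -/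
structure SynCat (T : Theory S) where
  /-- the context -/
  ctx : List S.Srt
  /-- the formula -/
  fml : Formula S ctx

namespace SynCat

variable {T : Theory S}

/-- `θ(x, y)` is a `T`-provably functional relation from `{x. φ}` to `{y. ψ}`.  In the context
`Y.ctx ++ X.ctx` the variables `y` are `Sub.left` and the variables `x` are `Sub.right`. -/
structure IsFunctional (X Y : SynCat T) (θ : Formula S (Y.ctx ++ X.ctx)) : Prop where
  /-- `θ(x, y) ⊢ φ(x) ∧ ψ(y)` -/
  typed : Prov T θ (.and (X.fml.sub (Sub.right Y.ctx X.ctx)) (Y.fml.sub (Sub.left Y.ctx X.ctx)))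
  /-- `φ(x) ⊢ ∃ y, θ(x, y)` -/
  total : Prov T X.fml (Formula.exs Y.ctx θ)
  /-- `θ(x, y) ∧ θ(x, y') ⊢ y = y'` -/
  unique : Prov T
    (.and (θ.sub (Sub.right Y.ctx (Y.ctx ++ X.ctx)))
      (θ.sub (Sub.append (Sub.left Y.ctx (Y.ctx ++ X.ctx))
        ((Sub.right Y.ctx X.ctx).comp (Sub.right Y.ctx (Y.ctx ++ X.ctx))))))
    (Formula.eqs ((Sub.left Y.ctx X.ctx).comp (Sub.right Y.ctx (Y.ctx ++ X.ctx)))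
      (Sub.left Y.ctx (Y.ctx ++ X.ctx)))

variable {X Y Z W : SynCat T} {Ξ : List S.Srt} {ω : Formula S Ξ}

namespace IsFunctional

variable {θ : Formula S (Y.ctx ++ X.ctx)}

theorem source (h : IsFunctional X Y θ) {τ : Sub S Y.ctx Ξ} {σ : Sub S X.ctx Ξ}
    (h' : Prov T ω (θ.sub (Sub.append τ σ))) : Prov T ω (X.fml.sub σ) := by
  have := (Prov.force h.typed h').and_fst
  rwa [Formula.sub_sub, Sub.right_append] at this

theorem target (h : IsFunctional X Y θ) {τ : Sub S Y.ctx Ξ} {σ : Sub S X.ctx Ξ}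
    (h' : Prov T ω (θ.sub (Sub.append τ σ))) : Prov T ω (Y.fml.sub τ) := by
  have := (Prov.force h.typed h').and_snd
  rwa [Formula.sub_sub, Sub.left_append] at this

theorem eqs (h : IsFunctional X Y θ) {τ τ' : Sub S Y.ctx Ξ} {σ : Sub S X.ctx Ξ}
    (h₁ : Prov T ω (θ.sub (Sub.append τ σ))) (h₂ : Prov T ω (θ.sub (Sub.append τ' σ))) :
    Prov T ω (Formula.eqs τ τ') := by
  have := Prov.force (ω := ω) (σ := Sub.append τ' (Sub.append τ σ)) h.unique (by
    refine Prov.and_intro ?_ ?_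
    · rw [Formula.sub_sub, Sub.right_append]; exact h₁
    · rw [Formula.sub_sub, Sub.append_comp, Sub.left_append, Sub.comp_assoc, Sub.right_append,
        Sub.right_append]
      exact h₂)
  rwa [Formula.sub_eqs, Sub.comp_assoc, Sub.right_append, Sub.left_append, Sub.left_append] at this

end IsFunctional

theorem prov_of_force {Γ Δ : List S.Srt} {θ η : Formula S (Δ ++ Γ)}
    (H : ∀ {Ξ : List S.Srt} (ω : Formula S Ξ) (τ : Sub S Δ Ξ) (σ : Sub S Γ Ξ),
      Prov T ω (θ.sub (Sub.append τ σ)) → Prov T ω (η.sub (Sub.append τ σ))) : Prov T θ η := by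
  have := H θ (Sub.left Δ Γ) (Sub.right Δ Γ) (by
    rw [Sub.append_left_right, Formula.sub_id]; exact Prov.refl _)
  rwa [Sub.append_left_right, Formula.sub_id] at this

theorem isFunctional_of_force {θ : Formula S (Y.ctx ++ X.ctx)}
    (h₁ : ∀ {Ξ : List S.Srt} (ω : Formula S Ξ) (τ : Sub S Y.ctx Ξ) (σ : Sub S X.ctx Ξ),
      Prov T ω (θ.sub (Sub.append τ σ)) → Prov T ω (X.fml.sub σ) ∧ Prov T ω (Y.fml.sub τ))
    (h₂ : ∀ {Ξ : List S.Srt} (ω : Formula S Ξ) (σ : Sub S X.ctx Ξ),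
      Prov T ω (X.fml.sub σ) → Prov T ω ((Formula.exs Y.ctx θ).sub σ))
    (h₃ : ∀ {Ξ : List S.Srt} (ω : Formula S Ξ) (τ τ' : Sub S Y.ctx Ξ) (σ : Sub S X.ctx Ξ),
      Prov T ω (θ.sub (Sub.append τ σ)) → Prov T ω (θ.sub (Sub.append τ' σ)) →
        Prov T ω (Formula.eqs τ τ')) : IsFunctional X Y θ where
  typed := by
    have h : Prov T θ (θ.sub (Sub.append (Sub.left Y.ctx X.ctx) (Sub.right Y.ctx X.ctx))) := by
      rw [Sub.append_left_right, Formula.sub_id]; exact Prov.refl _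
    exact Prov.and_intro (h₁ _ _ _ h).1 (h₁ _ _ _ h).2
  total := by
    have := h₂ X.fml (Sub.id _) (by rw [Formula.sub_id]; exact Prov.refl _)
    rwa [Formula.sub_id] at this
  unique := by
    refine h₃ _ _ _ ((Sub.right Y.ctx X.ctx).comp (Sub.right Y.ctx (Y.ctx ++ X.ctx))) ?_
      (Prov.and_right _ _)
    rw [← Sub.append_comp, Sub.append_left_right, Sub.id_comp]
    exact Prov.and_left _ _

/-- The formula `∃ y, θ(x, y) ∧ η(y, z)`. -/
def compFml {Γ Δ Θ : List S.Srt} (θ : Formula S (Δ ++ Γ)) (η : Formula S (Θ ++ Δ)) :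
    Formula S (Θ ++ Γ) :=
  Formula.exs Δ (.and
    (θ.sub (Sub.append (Sub.left Δ (Θ ++ Γ)) ((Sub.right Θ Γ).comp (Sub.right Δ (Θ ++ Γ)))))
    (η.sub (Sub.append ((Sub.left Θ Γ).comp (Sub.right Δ (Θ ++ Γ))) (Sub.left Δ (Θ ++ Γ)))))

theorem compFml_of {Γ Δ Θ : List S.Srt} {θ : Formula S (Δ ++ Γ)} {η : Formula S (Θ ++ Δ)}
    {σ : Sub S Γ Ξ} {τ : Sub S Δ Ξ} {ρ : Sub S Θ Ξ} (h₁ : Prov T ω (θ.sub (Sub.append τ σ)))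
    (h₂ : Prov T ω (η.sub (Sub.append ρ τ))) : Prov T ω ((compFml θ η).sub (Sub.append ρ σ)) := by
  refine Prov.exs_of τ _ (Prov.and_intro ?_ ?_)
  · rw [Formula.sub_sub, Sub.append_comp, Sub.left_append, Sub.comp_assoc, Sub.right_append,
      Sub.right_append]
    exact h₁
  · rw [Formula.sub_sub, Sub.append_comp, Sub.left_append, Sub.comp_assoc, Sub.right_append,
      Sub.left_append]
    exact h₂

theorem compFml_force {Γ Δ Θ : List S.Srt} {θ : Formula S (Δ ++ Γ)} {η : Formula S (Θ ++ Δ)}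
    {σ : Sub S Γ Ξ} {ρ : Sub S Θ Ξ} {ψ : Formula S Ξ}
    (h : Prov T ω ((compFml θ η).sub (Sub.append ρ σ)))
    (H : ∀ {Λ : List S.Srt} (ε : Sub S Ξ Λ) (τ : Sub S Δ Λ) (ω' : Formula S Λ),
      Prov T ω' (ω.sub ε) → Prov T ω' (θ.sub (Sub.append τ (σ.comp ε))) →
      Prov T ω' (η.sub (Sub.append (ρ.comp ε) τ)) → Prov T ω' (ψ.sub ε)) : Prov T ω ψ := by
  refine Prov.exs_force h (fun ε τ ω' h₁ h₂ => H ε τ ω' h₁ ?_ ?_)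
  · have := h₂.and_fst
    rwa [Formula.sub_sub, Sub.append_comp, Sub.left_append, Sub.comp_assoc, Sub.right_append,
      ← Sub.comp_assoc, Sub.right_append] at this
  · have := h₂.and_snd
    rwa [Formula.sub_sub, Sub.append_comp, Sub.left_append, Sub.comp_assoc, Sub.right_append,
      ← Sub.comp_assoc, Sub.left_append] at this

theorem isFunctional_comp {θ : Formula S (Y.ctx ++ X.ctx)} {η : Formula S (Z.ctx ++ Y.ctx)}
    (hθ : IsFunctional X Y θ) (hη : IsFunctional Y Z η) : IsFunctional X Z (compFml θ η) := by
  refine isFunctional_of_force (fun ω ρ σ h => ⟨?_, ?_⟩) (fun ω σ h => ?_)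
    (fun ω ρ ρ' σ h h' => ?_)
  · refine compFml_force h (fun ε τ ω' _ h₁ _ => ?_)
    rw [Formula.sub_sub]; exact hθ.source h₁
  · refine compFml_force h (fun ε τ ω' _ _ h₂ => ?_)
    rw [Formula.sub_sub]; exact hη.target h₂
  · refine Prov.exs_force (Prov.force hθ.total h) (fun ε τ ω' _ h₁ => ?_)
    refine Prov.exs_force (Prov.force hη.total (hθ.target h₁)) (fun ε' ρ ω'' h₂ h₃ => ?_)
    have h₄ := h₂.cut (h₁.subst ε')
    rw [Formula.sub_sub, Sub.append_comp] at h₄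
    rw [Formula.sub_sub, Formula.sub_sub]
    refine Prov.exs_of ρ _ ?_
    rw [← Sub.comp_assoc]
    exact compFml_of h₄ h₃
  · refine compFml_force h (fun ε τ ω' h₀ h₁ h₂ => ?_)
    have h'' := h₀.cut (h'.subst ε)
    rw [Formula.sub_sub, Sub.append_comp] at h''
    refine compFml_force h'' (fun ε' τ' ω'' h₃ h₄ h₅ => ?_)
    have h₆ := h₃.cut (h₁.subst ε')
    have h₇ := h₃.cut (h₂.subst ε')
    rw [Formula.sub_sub, Sub.append_comp] at h₆ h₇
    have h₈ := hθ.eqs h₆ h₄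
    rw [Formula.sub_eqs, Formula.sub_eqs]
    exact hη.eqs (Prov.eqs_force_right η _ h₈ h₇) h₅

/-- The formula `φ(x) ∧ x = x'`, in the context `X.ctx ++ X.ctx`. -/
def idFml (X : SynCat T) : Formula S (X.ctx ++ X.ctx) :=
  .and (X.fml.sub (Sub.right X.ctx X.ctx))
    (Formula.eqs (Sub.right X.ctx X.ctx) (Sub.left X.ctx X.ctx))

theorem idFml_iff {σ τ : Sub S X.ctx Ξ} : Prov T ω ((idFml X).sub (Sub.append τ σ)) ↔
    Prov T ω (X.fml.sub σ) ∧ Prov T ω (Formula.eqs σ τ) := by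
  rw [idFml, Formula.sub, Formula.sub_sub, Sub.right_append, Formula.sub_eqs, Sub.right_append,
    Sub.left_append]
  exact ⟨fun h => ⟨h.and_fst, h.and_snd⟩, fun h => Prov.and_intro h.1 h.2⟩

theorem fml_eqs {σ τ : Sub S X.ctx Ξ} (h : Prov T ω (Formula.eqs σ τ))
    (h' : Prov T ω (X.fml.sub σ)) : Prov T ω (X.fml.sub τ) := by
  have e : ∀ ρ : Sub S X.ctx Ξ, (X.fml.sub (Sub.left X.ctx Ξ)).sub (Sub.append ρ (Sub.id Ξ)) =
      X.fml.sub ρ := fun ρ => by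
    rw [Formula.sub_sub, Sub.left_append]
  have h₁ := Prov.eqs_force _ (Sub.id Ξ) h (by rw [e]; exact h')
  rwa [e] at h₁

theorem isFunctional_id (X : SynCat T) : IsFunctional X X (idFml X) := by
  refine isFunctional_of_force (fun ω τ σ h => ?_) (fun ω σ h => ?_) (fun ω τ τ' σ h h' => ?_)
  · have h' := idFml_iff.1 h
    exact ⟨h'.1, fml_eqs h'.2 h'.1⟩
  · exact Prov.exs_of σ σ (idFml_iff.2 ⟨h, Prov.eqs_refl σ⟩)
  · exact Prov.eqs_trans (Prov.eqs_symm (idFml_iff.1 h).2) (idFml_iff.1 h').2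

/-- `T`-provable equivalence of `T`-provably functional formulas. -/
def homSetoid (X Y : SynCat T) :
    Setoid {θ : Formula S (Y.ctx ++ X.ctx) // IsFunctional X Y θ} where
  r θ η := Prov T θ.1 η.1 ∧ Prov T η.1 θ.1
  iseqv :=
    { refl := fun _ => ⟨Prov.refl _, Prov.refl _⟩
      symm := fun h => ⟨h.2, h.1⟩
      trans := fun h h' => ⟨h.1.cut h'.1, h'.2.cut h.2⟩ }

theorem compFml_mono {Γ Δ Θ : List S.Srt} {θ θ' : Formula S (Δ ++ Γ)} {η η' : Formula S (Θ ++ Δ)}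
    (h : Prov T θ θ') (h' : Prov T η η') : Prov T (compFml θ η) (compFml θ' η') := by
  refine prov_of_force (fun ω ρ σ h₀ => compFml_force h₀ (fun ε τ ω' _ h₁ h₂ => ?_))
  rw [Formula.sub_sub, Sub.append_comp]
  exact compFml_of (Prov.force h h₁) (Prov.force h' h₂)

theorem compFml_id_left {θ : Formula S (Y.ctx ++ X.ctx)} (hθ : IsFunctional X Y θ) :
    Prov T (compFml (idFml X) θ) θ ∧ Prov T θ (compFml (idFml X) θ) := by
  refine ⟨prov_of_force (fun ω ρ σ h₀ => compFml_force h₀ (fun ε τ ω' _ h₁ h₂ => ?_)),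
    prov_of_force (fun ω ρ σ h => ?_)⟩
  · rw [Formula.sub_sub, Sub.append_comp]
    exact Prov.eqs_force_right θ _ (Prov.eqs_symm (idFml_iff.1 h₁).2) h₂
  · exact compFml_of (idFml_iff.2 ⟨hθ.source h, Prov.eqs_refl _⟩) h

theorem compFml_id_right {θ : Formula S (Y.ctx ++ X.ctx)} (hθ : IsFunctional X Y θ) :
    Prov T (compFml θ (idFml Y)) θ ∧ Prov T θ (compFml θ (idFml Y)) := by
  refine ⟨prov_of_force (fun ω ρ σ h₀ => compFml_force h₀ (fun ε τ ω' _ h₁ h₂ => ?_)),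
    prov_of_force (fun ω ρ σ h => ?_)⟩
  · rw [Formula.sub_sub, Sub.append_comp]
    exact Prov.eqs_force θ _ (idFml_iff.1 h₂).2 h₁
  · exact compFml_of h (idFml_iff.2 ⟨hθ.target h, Prov.eqs_refl _⟩)

theorem compFml_assoc {Γ Δ Θ Λ : List S.Srt} (θ : Formula S (Δ ++ Γ)) (η : Formula S (Θ ++ Δ))
    (κ : Formula S (Λ ++ Θ)) :
    Prov T (compFml (compFml θ η) κ) (compFml θ (compFml η κ)) ∧
      Prov T (compFml θ (compFml η κ)) (compFml (compFml θ η) κ) := by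
  refine ⟨prov_of_force (fun ω ρ σ h₀ => compFml_force h₀ (fun ε τ ω' _ h₁ h₂ => ?_)),
    prov_of_force (fun ω ρ σ h₀ => compFml_force h₀ (fun ε τ ω' _ h₁ h₂ => ?_))⟩
  · refine compFml_force h₁ (fun ε' υ ω'' h₃ h₄ h₅ => ?_)
    have h₆ := h₃.cut (h₂.subst ε')
    rw [Formula.sub_sub, Sub.append_comp] at h₆
    rw [Formula.sub_sub, Formula.sub_sub, Sub.append_comp, ← Sub.comp_assoc, ← Sub.comp_assoc]
    exact compFml_of h₄ (compFml_of h₅ h₆)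
  · refine compFml_force h₂ (fun ε' υ ω'' h₃ h₄ h₅ => ?_)
    have h₆ := h₃.cut (h₁.subst ε')
    rw [Formula.sub_sub, Sub.append_comp] at h₆
    rw [Formula.sub_sub, Formula.sub_sub, Sub.append_comp, ← Sub.comp_assoc, ← Sub.comp_assoc]
    exact compFml_of (compFml_of h₆ h₄) h₅

/-- The regular syntactic category: the morphisms from `{x. φ}` to `{y. ψ}` are the classes of
`T`-provably functional formulas `θ(x, y)` up to `T`-provable equivalence. -/
instance : Category.{w} (SynCat T) where
  Hom X Y := Quotient (homSetoid X Y)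
  id X := Quotient.mk _ ⟨idFml X, isFunctional_id X⟩
  comp {X Y Z} f g :=
    Quotient.map₂ (sa := homSetoid X Y) (sb := homSetoid Y Z) (sc := homSetoid X Z)
      (fun θ η => ⟨compFml θ.1 η.1, isFunctional_comp θ.2 η.2⟩)
      (fun _ _ h _ _ h' => ⟨compFml_mono h.1 h'.1, compFml_mono h.2 h'.2⟩) f g
  id_comp {X Y} f := by
    induction f using Quotient.inductionOn with
    | h θ => exact Quotient.sound (s := homSetoid X Y) (compFml_id_left θ.2)
  comp_id {X Y} f := by
    induction f using Quotient.inductionOn with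
    | h θ => exact Quotient.sound (s := homSetoid X Y) (compFml_id_right θ.2)
  assoc {X Y Z W} f g h := by
    induction f using Quotient.inductionOn with
    | h θ => induction g using Quotient.inductionOn with
      | h η => induction h using Quotient.inductionOn with
        | h κ => exact Quotient.sound (s := homSetoid X W) (compFml_assoc θ.1 η.1 κ.1)

end SynCat

/-! ### Structures and models in regular categories -/

section Semantics

variable {E : Type u'} [Category.{v'} E] [HasFiniteLimits E]

/-- The interpretation of a context: the product of the interpretations of its sorts. -/
noncomputable def ctxObj (M : S.Srt → E) : List S.Srt → E
  | [] => ⊤_ E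
  | s :: Γ => M s ⨯ ctxObj M Γ

/-- The interpretation of a variable: a projection. -/
noncomputable def ctxProj (M : S.Srt → E) :
    ∀ {Γ : List S.Srt} {s : S.Srt}, Var Γ s → (ctxObj M Γ ⟶ M s)
  | _, _, .zero => prod.fst
  | _, _, .succ x => prod.snd ≫ ctxProj M x

/-- The morphism into the interpretation of a context with given components. -/
noncomputable def ctxLift (M : S.Srt → E) {A : E} :
    ∀ {Γ : List S.Srt}, (∀ s, Var Γ s → (A ⟶ M s)) → (A ⟶ ctxObj M Γ)
  | [], _ => terminal.from A
  | _ :: _, m => prod.lift (m _ .zero) (ctxLift M (fun s x => m s x.succ))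

/-- Functoriality of the interpretation of a context. -/
noncomputable def ctxMap {M N : S.Srt → E} (h : ∀ s, M s ⟶ N s) :
    ∀ Γ : List S.Srt, ctxObj M Γ ⟶ ctxObj N Γ
  | [] => 𝟙 _
  | s :: Γ => prod.map (h s) (ctxMap h Γ)

theorem ctxMap_id (M : S.Srt → E) (Γ : List S.Srt) :
    ctxMap (fun s => 𝟙 (M s)) Γ = 𝟙 (ctxObj M Γ) := by
  induction Γ with
  | nil => rfl
  | cons s Γ ih => rw [ctxMap, ih]; exact prod.map_id_id

theorem ctxMap_comp {M N P : S.Srt → E} (h : ∀ s, M s ⟶ N s) (k : ∀ s, N s ⟶ P s)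
    (Γ : List S.Srt) : ctxMap (fun s => h s ≫ k s) Γ = ctxMap h Γ ≫ ctxMap k Γ := by
  induction Γ with
  | nil => exact (Category.comp_id _).symm
  | cons s Γ ih => rw [ctxMap, ih]; exact (prod.map_map _ _ _ _).symm

variable (S E) in
/-- `S`-structures in a category with finite limits. -/
structure Str where
  /-- the interpretation of the sorts -/
  obj : S.Srt → E
  /-- the interpretation of the function symbols -/
  op : ∀ f : S.Fn, ctxObj obj (S.dom f) ⟶ obj (S.cod f)

/-- A homomorphism of `S`-structures. -/
@[ext]
structure StrHom (M N : Str S E) where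
  /-- the component at a sort -/
  app : ∀ s, M.obj s ⟶ N.obj s
  /-- compatibility with the function symbols -/
  comm : ∀ f : S.Fn, M.op f ≫ app (S.cod f) = ctxMap app (S.dom f) ≫ N.op f

/-- The category of `S`-structures. -/
noncomputable instance : Category (Str S E) where
  Hom := StrHom
  id M := ⟨fun s => 𝟙 (M.obj s), fun f => by
    rw [Category.comp_id, ctxMap_id, Category.id_comp]⟩
  comp h k := ⟨fun s => h.app s ≫ k.app s, fun f => by
    rw [← Category.assoc, h.comm, Category.assoc, k.comm, ctxMap_comp, Category.assoc]⟩
  id_comp h := StrHom.ext (funext fun s => Category.id_comp _)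
  comp_id h := StrHom.ext (funext fun s => Category.comp_id _)
  assoc h k l := StrHom.ext (funext fun s => Category.assoc _ _ _)

/-- The interpretation of a term in a structure. -/
noncomputable def Term.interp (M : Str S E) {Γ : List S.Srt} :
    ∀ {s : S.Srt}, Term S Γ s → (ctxObj M.obj Γ ⟶ M.obj s)
  | _, .var x => ctxProj M.obj x
  | _, .app f args => ctxLift M.obj (fun s x => (args s x).interp M) ≫ M.op f

end Semantics

/-! ### Barr exact categories and exact functors -/

/-- A Barr exact category: a regular category in which every equivalence relation is effective,
i.e. is a kernel pair. -/
class BarrExact (E : Type u') [Category.{v'} E] : Prop extends Regular E where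
  exists_isKernelPair {R X : E} (p₁ p₂ : R ⟶ X) [IsEquivalenceRelation p₁ p₂] :
    ∃ (Y : E) (q : X ⟶ Y), IsKernelPair q p₁ p₂

/-- Abelian categories are Barr exact. -/
theorem BarrExact.of_abelian (E : Type u') [Category.{v'} E] [Abelian E] : BarrExact E where
  hasCoequalizer_of_isKernelPair _ := inferInstance
  regularEpiIsStableUnderBaseChange := by
    refine ⟨fun {X Y Y' S f g f' g'} h hg => ?_⟩
    have h₁ : IsRegularEpi g := hg
    have : Epi g := inferInstance
    have : Epi g' := Abelian.epi_fst_of_isLimit _ _ h.flip.isLimit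
    exact IsRegularEpiCategory.regularEpiOfEpi g'
  exists_isKernelPair {R X} p₁ p₂ h := by
    obtain ⟨⟨e⟩⟩ := h
    refine ⟨cokernel (p₁ - p₂), cokernel.π _, ⟨⟨?_⟩, ⟨?_⟩⟩⟩
    · rw [← sub_eq_zero, ← Preadditive.sub_comp, cokernel.condition]
    have hm : Mono (kernel.ι p₂ ≫ p₁) := ⟨fun a b hab => by
      rw [← cancel_mono (kernel.ι p₂)]
      exact e.right_cancellation _ _ (by simpa using hab) (by simp)⟩
    have hk : ∀ {W : E} (x : W ⟶ X), x ≫ cokernel.π (p₁ - p₂) = 0 →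
        ∃ u : W ⟶ R, u ≫ p₁ = x ∧ u ≫ p₂ = 0 := by
      intro W x hx
      have hd : p₁ - p₂ = kernel.lift p₂ (𝟙 R - p₂ ≫ e.r) (by simp) ≫ kernel.ι p₂ ≫ p₁ := by simp
      have hc : (p₁ - p₂) ≫ cokernel.π (kernel.ι p₂ ≫ p₁) = 0 := by
        rw [hd, Category.assoc, cokernel.condition, comp_zero]
      have hx' : x ≫ cokernel.π (kernel.ι p₂ ≫ p₁) = 0 := by
        rw [← cokernel.π_desc (p₁ - p₂) _ hc, ← Category.assoc, hx, zero_comp]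
      refine ⟨Abelian.monoLift (kernel.ι p₂ ≫ p₁) x hx' ≫ kernel.ι p₂, ?_, by simp⟩
      rw [Category.assoc]; exact Abelian.monoLift_comp _ _ _
    have hl : ∀ s : PullbackCone (cokernel.π (p₁ - p₂)) (cokernel.π (p₁ - p₂)),
        ∃ l : s.pt ⟶ R, l ≫ p₁ = s.fst ∧ l ≫ p₂ = s.snd := fun s => by
      obtain ⟨u, hu₁, hu₂⟩ := hk (s.fst - s.snd) (by
        rw [Preadditive.sub_comp, s.condition, sub_self])
      exact ⟨u + s.snd ≫ e.r, by simp [hu₁], by simp [hu₂]⟩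
    choose l hl₁ hl₂ using hl
    exact PullbackCone.IsLimit.mk _ l hl₁ hl₂ (fun s m h₁ h₂ => e.right_cancellation _ _
      (h₁.trans (hl₁ s).symm) (h₂.trans (hl₂ s).symm))

section Exact

variable (A : Type u) [Category.{v} A] (E : Type u') [Category.{v'} E]

/-- Regular functors: the functors that preserve finite limits and regular epimorphisms. -/
def isRegularFunctor : ObjectProperty (A ⥤ E) := fun F =>
  PreservesFiniteLimits F ∧
    ∀ {X Y : A} (f : X ⟶ Y), IsRegularEpi f → IsRegularEpi (F.map f)

/-- The category of regular functors.  Between Barr exact categories these are the exact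
functors. -/
abbrev Ex := (isRegularFunctor A E).FullSubcategory

end Exact

/-! ### The exact completion -/

section ExactCompletion

variable (D : Type w) [SmallCategory D]

/-- The topology generated by the coverings that consist of one regular epimorphism. -/
def regTopology : GrothendieckTopology D :=
  Precoverage.toGrothendieck
    ⟨fun X => {R | ∃ (Y : D) (f : Y ⟶ X), IsRegularEpi f ∧ R = Presieve.singleton f}⟩

/-- The functor from `D` to sheaves on `D`: the (sheafified) Yoneda embedding. -/
noncomputable def sheafYoneda : D ⥤ Sheaf (regTopology D) (Type w) :=
  yoneda ⋙ presheafToSheaf (regTopology D) (Type w)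

/-- The sheaves that are coequalizers of equivalence relations in `D`. -/
def isEquivQuotient : ObjectProperty (Sheaf (regTopology D) (Type w)) := fun F =>
  ∃ (R X : D) (p₁ p₂ : R ⟶ X) (_ : IsEquivalenceRelation p₁ p₂)
    (π : (sheafYoneda D).obj X ⟶ F)
    (h : (sheafYoneda D).map p₁ ≫ π = (sheafYoneda D).map p₂ ≫ π),
    Nonempty (IsColimit (Cofork.ofπ π h))

/-- The Barr exact completion of a small regular category `D`: the full subcategory of the
category of sheaves for the regular topology, on the coequalizers of equivalence relations
in `D`. -/
abbrev ExactCompletion := (isEquivQuotient D).FullSubcategory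

theorem isEquivQuotient_sheafYoneda (X : D) : isEquivQuotient D ((sheafYoneda D).obj X) := by
  have hk : IsKernelPair (𝟙 X) (𝟙 X) (𝟙 X) := IsKernelPair.id_of_mono (𝟙 X)
  have e : EquivalenceRelation (𝟙 X) (𝟙 X) := hk.equivalenceRelation _ _ _ hk.isLimit
  refine ⟨X, X, 𝟙 X, 𝟙 X, ⟨⟨e⟩⟩, 𝟙 _, rfl, ⟨?_⟩⟩
  exact Cofork.IsColimit.mk _ (fun s => s.π) (fun s => Category.id_comp _)
    (fun s m hm => (Category.id_comp m).symm.trans hm)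

/-- The canonical functor from `D` to its exact completion. -/
noncomputable def toExactCompletion : D ⥤ ExactCompletion D :=
  (isEquivQuotient D).lift (sheafYoneda D) (isEquivQuotient_sheafYoneda D)

end ExactCompletion

/-- The universal property of the Barr exact completion `ι : D ⥤ A` of a regular category `D`: the
functor `ι` is regular, and restriction along `ι` is an equivalence from the exact functors
`A ⥤ E` to the regular functors `D ⥤ E`, for all Barr exact categories `E`. -/
structure IsBarrExactCompletion {D : Type w} [Category.{w} D] {A : Type u} [Category.{v} A]
    (ι : D ⥤ A) : Prop where
  regular : Regular D
  exact : BarrExact A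
  isRegularFunctor : isRegularFunctor D A ι
  universal (E : Type u') [Category.{v'} E] [BarrExact E] :
    ∃ e : Ex A E ≌ Ex D E, Nonempty (e.functor ⋙ (RegLogic.isRegularFunctor D E).ι ≅
      (RegLogic.isRegularFunctor A E).ι ⋙ (Functor.whiskeringLeft D A E).obj ι)

section Models

variable {E : Type u'} [Category.{v'} E] [Regular E]
/-- The interpretation of a regular formula in a structure in a regular category: equality is
interpreted as an equalizer, and the existential quantifier as an image. -/
noncomputable def Formula.interp (M : Str S E) :
    ∀ {Γ : List S.Srt}, Formula S Γ → Subobject (ctxObj M.obj Γ)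
  | _, .top => ⊤
  | _, .eq t t' => equalizerSubobject (t.interp M) (t'.interp M)
  | _, .and φ ψ => φ.interp M ⊓ ψ.interp M
  | Γ, .ex s φ =>
    imageSubobject ((φ.interp M).arrow ≫ (prod.snd : M.obj s ⨯ ctxObj M.obj Γ ⟶ ctxObj M.obj Γ))

variable (E) in
/-- A structure is a model of `T` if all sequents in `T` hold in it. -/
def isModel (T : Theory S) : ObjectProperty (Str S E) := fun M =>
  ∀ (Γ : List S.Srt) (φ ψ : Formula S Γ), T Γ φ ψ → φ.interp M ≤ ψ.interp M

variable (E) in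
/-- The category of models of `T` in a regular category: a full subcategory of the category of
structures. -/
abbrev Mod (T : Theory S) := (isModel E T).FullSubcategory

end Models

/-! ### Transport of structures along exact functors -/

section Transport

variable {A : Type u} [Category.{v} A] [HasFiniteLimits A]
  {E : Type u'} [Category.{v'} E] [HasFiniteLimits E]

/-- A functor that preserves finite limits commutes with the interpretation of contexts. -/
noncomputable def ctxIso (F : A ⥤ E) [PreservesFiniteLimits F] (M : S.Srt → A) :
    ∀ Γ : List S.Srt, F.obj (ctxObj M Γ) ≅ ctxObj (fun s => F.obj (M s)) Γ
  | [] => PreservesTerminal.iso F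
  | s :: Γ => PreservesLimitPair.iso F (M s) (ctxObj M Γ) ≪≫
      prod.mapIso (Iso.refl _) (ctxIso F M Γ)

theorem ctxIso_naturality {F G : A ⥤ E} [PreservesFiniteLimits F] [PreservesFiniteLimits G]
    (α : F ⟶ G) (M : S.Srt → A) (Γ : List S.Srt) :
    α.app (ctxObj M Γ) ≫ (ctxIso G M Γ).hom =
      (ctxIso F M Γ).hom ≫ ctxMap (fun s => α.app (M s)) Γ := by
  induction Γ with
  | nil => exact Subsingleton.elim (α := _ ⟶ ⊤_ E) _ _
  | cons s Γ ih =>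
    simp only [ctxIso, ctxMap]
    refine Limits.prod.hom_ext ?_ ?_
    · simp [ctxObj]
    · simp [ctxObj, ← ih]

/-- The image of a structure under a functor that preserves finite limits. -/
noncomputable def Str.map (U : Str S A) (F : A ⥤ E) [PreservesFiniteLimits F] : Str S E where
  obj s := F.obj (U.obj s)
  op f := (ctxIso F U.obj (S.dom f)).inv ≫ F.map (U.op f)

/-- The functor `F ↦ F(U)` from regular functors to structures, for a structure `U`. -/
noncomputable def evalAt (U : Str S A) : Ex A E ⥤ Str S E where
  obj F :=
    haveI := F.property.1
    U.map F.obj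
  map {F G} α :=
    haveI := F.property.1
    haveI := G.property.1
    { app := fun s => α.hom.app (U.obj s)
      comm := fun f => by
        have h := ctxIso_naturality α.hom U.obj (S.dom f)
        rw [← Iso.inv_comp_eq, ← Category.assoc, ← Iso.eq_comp_inv] at h
        simp only [Str.map, Category.assoc, α.hom.naturality]
        rw [← Category.assoc, h, Category.assoc] }
  map_id F := StrHom.ext (funext fun s => rfl)
  map_comp α β := StrHom.ext (funext fun s => rfl)

end Transport

end RegLogic

namespace Homology

open RegLogic

/-! ### The homology theory of a category of pairs -/

/-- The morphisms of a subcategory of `C`, as a property of the morphisms of `C`. -/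
class IsSubcategory {C : Type u} [Category.{v} C] (M : MorphismProperty C) : Prop extends
    M.IsStableUnderComposition where
  id_source {X Y : C} (f : X ⟶ Y) : M f → M (𝟙 X)
  id_target {X Y : C} (f : X ⟶ Y) : M f → M (𝟙 Y)

variable {C : Type u} [Category.{v} C]

/-- The category of pairs: the objects are the arrows in `M`, the morphisms are the commutative
squares in `C`.  An arrow `f : Y ⟶ X` in `M` is the pair `(X, Y)`. -/
abbrev Pairs (M : MorphismProperty C) :=
  ObjectProperty.FullSubcategory (fun f : Arrow C => M f.hom)

variable {M : MorphismProperty C}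

/-- The pair `(X, Y)` given by `f : Y ⟶ X` in `M`. -/
def pair {Y X : C} (f : Y ⟶ X) (hf : M f) : Pairs M := ⟨Arrow.mk f, hf⟩

/-- The morphism of pairs given by a commutative square. -/
def square {Y X Y' X' : C} {f : Y ⟶ X} {f' : Y' ⟶ X'} {hf : M f} {hf' : M f'}
    (a : Y ⟶ Y') (b : X ⟶ X') (h : a ≫ f' = f ≫ b) : pair f hf ⟶ pair f' hf' :=
  ObjectProperty.homMk (Arrow.homMk' a b h)

section Boundary

variable {Z Y X : C} (f : Z ⟶ Y) (g : Y ⟶ X) (hf : M f) (hg : M g)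

/-- The morphism `∂ : (Y, Z) ⟶ (X, Y)`. -/
def del : pair f hf ⟶ pair g hg := square f g rfl

variable [IsSubcategory M]

/-- The morphism `⊠ : (Y, Z) ⟶ (X, Z)`. -/
def boxtimes : pair f hf ⟶ pair (f ≫ g) (M.comp_mem f g hf hg) :=
  square (𝟙 Z) g (Category.id_comp _)

/-- The morphism `⊞ : (X, Z) ⟶ (X, Y)`. -/
def boxplus : pair (f ≫ g) (M.comp_mem f g hf hg) ⟶ pair g hg :=
  square f (𝟙 X) (Category.comp_id _).symm

end Boundary

variable (M)

/-- The sorts `h_n(X, Y)`. -/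
abbrev HSrt := ℤ × Pairs M

/-- The function symbols: the group operations on each sort, `□_n` for each morphism `□` of pairs,
and `∂_n : h_n(X, Y) → h_{n-1}(Y, Z)` for each `Z ⟶ Y ⟶ X` in `M`. -/
inductive HFn : Type max u v
  | zero (s : HSrt M)
  | neg (s : HSrt M)
  | add (s : HSrt M)
  | map (n : ℤ) {P Q : Pairs M} (q : P ⟶ Q)
  | bd (n : ℤ) {Z Y X : C} (f : Z ⟶ Y) (g : Y ⟶ X) (hf : M f) (hg : M g)

/-- The signature of the homology theory. -/
def sig : Signature.{max u v} where
  Srt := HSrt M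
  Fn := HFn M
  dom
    | .zero _ => []
    | .neg s => [s]
    | .add s => [s, s]
    | .map n (P := P) _ => [(n, P)]
    | .bd n _ g _ hg => [(n, pair g hg)]
  cod
    | .zero s => s
    | .neg s => s
    | .add s => s
    | .map n (Q := Q) _ => (n, Q)
    | .bd n f _ hf _ => (n - 1, pair f hf)

variable {M} {Γ : List (HSrt M)}

/-- Terms of the homology theory. -/
abbrev Tm (Γ : List (HSrt M)) (s : HSrt M) := Term (sig M) Γ s

def tZero (s : HSrt M) : Tm Γ s := Term.app (S := sig M) (.zero s) Sub.nil

def tNeg {s : HSrt M} (t : Tm Γ s) : Tm Γ s :=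
  Term.app (S := sig M) (.neg s) (Sub.cons t Sub.nil)

def tAdd {s : HSrt M} (t t' : Tm Γ s) : Tm Γ s :=
  Term.app (S := sig M) (.add s) (Sub.cons t (Sub.cons t' Sub.nil))

def tMap {n : ℤ} {P Q : Pairs M} (q : P ⟶ Q) (t : Tm Γ (n, P)) : Tm Γ (n, Q) :=
  Term.app (S := sig M) (.map n q) (Sub.cons t Sub.nil)

def tBd {n : ℤ} {Z Y X : C} (f : Z ⟶ Y) (g : Y ⟶ X) (hf : M f) (hg : M g)
    (t : Tm Γ (n, pair g hg)) : Tm Γ (n - 1, pair f hf) :=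
  Term.app (S := sig M) (.bd n f g hf hg) (Sub.cons t Sub.nil)

/-- The variable `x` in a context `x, ...`. -/
def vx {s : HSrt M} : Tm (s :: Γ) s := Term.var (S := sig M) .zero

/-- The variable `y` in a context `x, y, ...`. -/
def vy {s r : HSrt M} : Tm (s :: r :: Γ) r := Term.var (S := sig M) (.succ .zero)

/-- The variable `z` in a context `x, y, z, ...`. -/
def vz {s r q : HSrt M} : Tm (s :: r :: q :: Γ) q := Term.var (S := sig M) (.succ (.succ .zero))

/-- Equations between terms of the homology theory. -/
abbrev eqn {s : HSrt M} (t t' : Tm Γ s) : Formula (sig M) Γ := Formula.eq (S := sig M) t t'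

variable (M) [IsSubcategory M]

/-- The homology theory of the category of pairs.  In the three exactness sequents the bound
variable `y` is the variable number `0`, that is `vx`, and the free variable `x` is `vy`. -/
inductive homologyTheory : Theory (sig M)
  -- each sort is an abelian group
  | add_assoc (s : HSrt M) : homologyTheory [s, s, s] .top
      (eqn (tAdd (tAdd vx vy) vz) (tAdd vx (tAdd vy vz)))
  | zero_add (s : HSrt M) : homologyTheory [s] .top
      (.and (eqn (tAdd (tZero s) vx) (tAdd vx (tZero s))) (eqn (tAdd vx (tZero s)) vx))
  | add_neg (s : HSrt M) : homologyTheory [s] .top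
      (.and (eqn (tAdd vx (tNeg vx)) (tZero s)) (eqn (tAdd (tNeg vx) vx) (tZero s)))
  | add_comm (s : HSrt M) : homologyTheory [s, s] .top
      (eqn (tAdd vx vy) (tAdd vy vx))
  -- `□_n` and `∂_n` are group homomorphisms
  | map_add (n : ℤ) {P Q : Pairs M} (q : P ⟶ Q) : homologyTheory [(n, P), (n, P)] .top
      (eqn (tMap q (tAdd vx vy)) (tAdd (tMap q vx) (tMap q vy)))
  | bd_add (n : ℤ) {Z Y X : C} (f : Z ⟶ Y) (g : Y ⟶ X) (hf : M f) (hg : M g) :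
      homologyTheory [(n, pair g hg), (n, pair g hg)] .top
      (eqn (tBd f g hf hg (tAdd vx vy)) (tAdd (tBd f g hf hg vx) (tBd f g hf hg vy)))
  -- functoriality, and naturality with respect to `∂`-cubes
  | map_comp (n : ℤ) {P Q R : Pairs M} (q : P ⟶ Q) (r : Q ⟶ R) : homologyTheory [(n, P)] .top
      (eqn (tMap r (tMap q vx)) (tMap (q ≫ r) vx))
  | map_id (n : ℤ) (P : Pairs M) : homologyTheory [(n, P)] .top (eqn (tMap (𝟙 P) vx) vx)
  | bd_natural (n : ℤ) {Z Y X Z' Y' X' : C} (f : Z ⟶ Y) (g : Y ⟶ X) (hf : M f) (hg : M g)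
      (f' : Z' ⟶ Y') (g' : Y' ⟶ X') (hf' : M f') (hg' : M g')
      (d : pair f hf ⟶ pair f' hf') (q : pair g hg ⟶ pair g' hg')
      (h : del f g hf hg ≫ q = d ≫ del f' g' hf' hg') :
      homologyTheory [(n, pair g hg)] .top
      (eqn (tMap d (tBd f g hf hg vx)) (tBd f' g' hf' hg' (tMap q vx)))
  -- the long sequence is a complex
  | boxplus_boxtimes (n : ℤ) {Z Y X : C} (f : Z ⟶ Y) (g : Y ⟶ X) (hf : M f) (hg : M g) :
      homologyTheory [(n, pair f hf)] .top
      (eqn (tMap (boxplus f g hf hg) (tMap (boxtimes f g hf hg) vx)) (tZero _))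
  | bd_boxplus (n : ℤ) {Z Y X : C} (f : Z ⟶ Y) (g : Y ⟶ X) (hf : M f) (hg : M g) :
      homologyTheory [(n, pair (f ≫ g) (M.comp_mem f g hf hg))] .top
      (eqn (tBd f g hf hg (tMap (boxplus f g hf hg) vx)) (tZero _))
  | boxtimes_bd (n : ℤ) {Z Y X : C} (f : Z ⟶ Y) (g : Y ⟶ X) (hf : M f) (hg : M g) :
      homologyTheory [(n, pair g hg)] .top
      (eqn (tMap (boxtimes f g hf hg) (tBd f g hf hg vx)) (tZero _))
  -- the long sequence is exact
  | exact_boxplus (n : ℤ) {Z Y X : C} (f : Z ⟶ Y) (g : Y ⟶ X) (hf : M f) (hg : M g) :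
      homologyTheory [(n, pair (f ≫ g) (M.comp_mem f g hf hg))]
      (eqn (tMap (boxplus f g hf hg) vx) (tZero _))
      (Formula.ex (S := sig M) (n, pair f hf) (eqn (tMap (boxtimes f g hf hg) vx) vy))
  | exact_bd (n : ℤ) {Z Y X : C} (f : Z ⟶ Y) (g : Y ⟶ X) (hf : M f) (hg : M g) :
      homologyTheory [(n, pair g hg)]
      (eqn (tBd f g hf hg vx) (tZero _))
      (Formula.ex (S := sig M) (n, pair (f ≫ g) (M.comp_mem f g hf hg))
        (eqn (tMap (boxplus f g hf hg) vx) vy))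
  | exact_boxtimes (n : ℤ) {Z Y X : C} (f : Z ⟶ Y) (g : Y ⟶ X) (hf : M f) (hg : M g) :
      homologyTheory [(n - 1, pair f hf)]
      (eqn (tMap (boxtimes f g hf hg) vx) (tZero _))
      (Formula.ex (S := sig M) (n, pair g hg) (eqn (tBd f g hf hg vx) vy))

/-- The category of constructible effective motives: the Barr exact completion of the regular
syntactic category of the homology theory. -/
abbrev Motives := ExactCompletion (SynCat (homologyTheory M))

end Homology

set_option linter.unusedSectionVars false

namespace RegLogic

/-! ### Calculus of regular epimorphisms in regular categories -/

section RegularCalculus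

variable {E : Type u'} [Category.{v'} E] [Regular E]

/-! The argument has three independent ingredients.

Completion. Let `ι : D ⥤ A` be fully faithful and regular, from a regular category to a Barr exact
one, such that every object `a` of `A` receives a regular epimorphism from some `ι X`. The kernel
pair of `ι X ⟶ a` is again covered by an object of `D`, and taking an image in `D` shows that it is
`ι R` for an equivalence relation `R` on `X`. So a regular functor `G` on `D` extends, uniquely up
to isomorphism, by sending `a` to the quotient of `G X` by `G R`; this is
`isEquivalence_restrictEx`. For the concrete completion, sheaves on `D` are Barr exact, the
sheafified Yoneda functor is regular, and every epimorphism of sheaves onto a representable is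
refined by a regular epimorphism of `D`. The last fact makes the quotients of equivalence relations
from `D` closed under finite limits, covered subobjects and effective quotients, hence Barr exact
(`barrExact_fullSubcategory`).

Logic. Replacing the source of a morphism of the syntactic category by its graph, an isomorphic
object, turns the morphism into a substitution. One can therefore reason with elements: a formula
`ω` in context is a stage, provability from `ω` is truth at that stage, and regular epimorphisms are
the locally surjective morphisms. In a regular category `E` the interpretation of formulas has the
same Kripke-Joyal description (`Forces`). Soundness makes a model into a regular functor
(`modelFunctor`). Conversely equality, conjunction and existence are an equalizer, a pullback and an
image already in the syntactic category, so a regular functor takes a formula to its interpretation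
in the image of the generic structure (`Realization.forces_iff`). Thus regular functors on the
syntactic category are the models (`evalGeneric`), and composing with the first ingredient gives the
universal model.

Abelianness. All function symbols of the homology theory denote additive maps, so the solutions of
any regular formula form a group and the syntactic category is preadditive. Sums of morphisms
descend along covers, so the completion is preadditive too. Finally, a preadditive Barr exact
category is abelian: a monomorphism `m : I ⟶ G` gives the equivalence relation of the pairs `(m i +
g, g)`, and its quotient is a cokernel of `m` whose kernel is `m`. -/

theorem isRegularEpi_of_strongEpi {X Y : E} (f : X ⟶ Y) [StrongEpi f] : IsRegularEpi f :=
  inferInstance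

theorem isRegularEpi_comp {X Y Z : E} {f : X ⟶ Y} {g : Y ⟶ Z} (hf : IsRegularEpi f)
    (hg : IsRegularEpi g) : IsRegularEpi (f ≫ g) :=
  have := strongEpi_comp f g
  isRegularEpi_of_strongEpi _

theorem isRegularEpi_of_comp {X Y Z : E} {f : X ⟶ Y} {g : Y ⟶ Z} (h : IsRegularEpi (f ≫ g)) :
    IsRegularEpi g :=
  have := strongEpi_of_strongEpi f g
  isRegularEpi_of_strongEpi _

theorem isRegularEpi_of_fac {X Y Z : E} {f : X ⟶ Y} {g : Y ⟶ Z} {k : X ⟶ Z}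
    (h : IsRegularEpi k) (e : f ≫ g = k) : IsRegularEpi g := by
  subst e; exact isRegularEpi_of_comp h

theorem isRegularEpi_of_isIso {X Y : E} (f : X ⟶ Y) [IsIso f] : IsRegularEpi f :=
  inferInstance

theorem isIso_of_isRegularEpi_of_mono {X Y : E} (f : X ⟶ Y) [hf : IsRegularEpi f] [Mono f] :
    IsIso f :=
  isIso_of_mono_of_strongEpi f

theorem isRegularEpi_of_isPullback {P X Y Z : E} {p : P ⟶ X} {q : P ⟶ Y} {f : X ⟶ Z}
    {g : Y ⟶ Z} (h : IsPullback p q f g) (hf : IsRegularEpi f) : IsRegularEpi q :=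
  Regular.regularEpiIsStableUnderBaseChange.of_isPullback h hf

/-- Locally, generalised elements lift along regular epimorphisms. -/
theorem exists_lift_of_isRegularEpi {X Y : E} (q : X ⟶ Y) [IsRegularEpi q] {A : E} (t : A ⟶ Y) :
    ∃ (B : E) (p : B ⟶ A) (x : B ⟶ X), IsRegularEpi p ∧ p ≫ t = x ≫ q :=
  ⟨pullback t q, pullback.fst t q, pullback.snd t q, inferInstance, pullback.condition⟩

theorem isRegularEpi_of_exists_lift {X Y : E} {q : X ⟶ Y} {B : E} {p : B ⟶ Y} {x : B ⟶ X}
    (hp : IsRegularEpi p) (e : x ≫ q = p) : IsRegularEpi q :=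
  isRegularEpi_of_fac hp e

/-- Every morphism is a regular epimorphism followed by a monomorphism. -/
theorem exists_image {X Y : E} (f : X ⟶ Y) :
    ∃ (I : E) (e : X ⟶ I) (m : I ⟶ Y), IsRegularEpi e ∧ Mono m ∧ e ≫ m = f :=
  ⟨_, (Regular.strongEpiMonoFactorisation f).e, (Regular.strongEpiMonoFactorisation f).m,
    inferInstance, inferInstance, (Regular.strongEpiMonoFactorisation f).fac⟩

/-- Descent of a morphism along a regular epimorphism. -/
theorem exists_desc {X Y Z : E} (q : X ⟶ Y) [IsRegularEpi q] (k : X ⟶ Z)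
    (H : ∀ {A : E} (a b : A ⟶ X), a ≫ q = b ≫ q → a ≫ k = b ≫ k) : ∃ d : Y ⟶ Z, q ≫ d = k :=
  ⟨EffectiveEpi.desc q k (fun a b h => H a b h), EffectiveEpi.fac q k _⟩

theorem exists_desc_of_isKernelPair {X Y Z R : E} {q : X ⟶ Y} [IsRegularEpi q] {a b : R ⟶ X}
    (hq : IsKernelPair q a b) (k : X ⟶ Z) (h : a ≫ k = b ≫ k) : ∃ d : Y ⟶ Z, q ≫ d = k :=
  exists_desc q k (fun s t e => by
    rw [← hq.lift_fst s t e, Category.assoc, h, ← Category.assoc, hq.lift_snd])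

theorem isKernelPair_of_comp_mono {X Y Z R : E} {q : X ⟶ Y} {m : Y ⟶ Z} [Mono m] {a b : R ⟶ X}
    (h : IsKernelPair (q ≫ m) a b) : IsKernelPair q a b :=
  IsKernelPair.cancel_right_of_mono h

/-- Effectiveness only supplies some morphism with the given kernel pair. Its regular epi part has
the same kernel pair, because the other factor is monic. -/
theorem exists_quotient {E : Type u'} [Category.{v'} E] [BarrExact E] {R X : E} (p₁ p₂ : R ⟶ X)
    [IsEquivalenceRelation p₁ p₂] :
    ∃ (Y : E) (q : X ⟶ Y), IsRegularEpi q ∧ IsKernelPair q p₁ p₂ := by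
  obtain ⟨Y, q, h⟩ := BarrExact.exists_isKernelPair p₁ p₂
  obtain ⟨I, e, m, he, hm, rfl⟩ := exists_image q
  exact ⟨I, e, he, isKernelPair_of_comp_mono h⟩

/-- A regular epimorphism is a coequalizer of its kernel pair. -/
theorem nonempty_isColimit_of_isKernelPair {X Y R : E} {q : X ⟶ Y} [IsRegularEpi q]
    {a b : R ⟶ X} (h : IsKernelPair q a b) : Nonempty (IsColimit (Cofork.ofπ q h.w)) :=
  ⟨h.toCoequalizer'⟩

theorem map_prod_hom_ext {D : Type u} [Category.{v} D] [HasFiniteLimits D]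
    {A : Type u'} [Category.{v'} A] (F : D ⥤ A) [PreservesFiniteLimits F] {X Y : D} {T : A}
    {x y : T ⟶ F.obj (X ⨯ Y)} (h₁ : x ≫ F.map prod.fst = y ≫ F.map prod.fst)
    (h₂ : x ≫ F.map prod.snd = y ≫ F.map prod.snd) : x = y :=
  BinaryFan.IsLimit.hom_ext (isLimitOfHasBinaryProductOfPreservesLimit F X Y) h₁ h₂

/-- Reflexivity, symmetry and transitivity are witnessed by morphisms, so they survive a functor
that preserves pullbacks. Joint monicity says that `prod.lift p₁ p₂` is monic, which is preserved
together with binary products. -/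
theorem IsEquivalenceRelation.map {D : Type u} [Category.{v} D] [HasFiniteLimits D]
    {A : Type u'} [Category.{v'} A] (F : D ⥤ A) [PreservesFiniteLimits F] {R X : D}
    (p₁ p₂ : R ⟶ X) [h : IsEquivalenceRelation p₁ p₂] :
    IsEquivalenceRelation (F.map p₁) (F.map p₂) := by
  obtain ⟨⟨e⟩⟩ := h
  have hm : Mono (prod.lift p₁ p₂) := ⟨fun a b hab => e.right_cancellation a b
    (by simpa only [Category.assoc, prod.lift_fst] using congrArg (· ≫ prod.fst) hab)
    (by simpa only [Category.assoc, prod.lift_snd] using congrArg (· ≫ prod.snd) hab)⟩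
  have : JointlyMono₂ (F.map p₁) (F.map p₂) := ⟨fun T a b h₁ h₂ => by
    rw [← cancel_mono (F.map (prod.lift p₁ p₂))]
    refine map_prod_hom_ext F ?_ ?_
    · rw [Category.assoc, Category.assoc, ← F.map_comp, prod.lift_fst, h₁]
    · rw [Category.assoc, Category.assoc, ← F.map_comp, prod.lift_snd, h₂]⟩
  exact ⟨⟨{ e.toReflexiveRelation.map F, e.toSymmetricRelation.map F,
    e.toTransitiveRelation.map F with }⟩⟩

/-- Limits of a diagram are unique up to isomorphism, so one preserved square for each cospan is
enough. This lets explicit pullbacks be used instead of the chosen ones. -/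
theorem preservesFiniteLimits_of_isPullback {D : Type u} [Category.{v} D] [HasFiniteLimits D]
    {A : Type u'} [Category.{v'} A] [HasFiniteLimits A] (F : D ⥤ A) {t : D} (ht : IsTerminal t)
    (hF : Nonempty (IsTerminal (F.obj t)))
    (H : ∀ ⦃X Y Z : D⦄ (f : X ⟶ Z) (g : Y ⟶ Z), ∃ (P : D) (p : P ⟶ X) (q : P ⟶ Y),
      IsPullback p q f g ∧ IsPullback (F.map p) (F.map q) (F.map f) (F.map g)) :
    PreservesFiniteLimits F := by
  have := preservesLimitsOfShape_walkingCospan_of_forall_isPullback (F := F)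
    (fun X Y Z f g _ => H f g)
  have := preservesTerminal_of_iso F
    (F.mapIso (terminalIsTerminal.uniqueUpToIso ht) ≪≫ hF.some.uniqueUpToIso terminalIsTerminal)
  have := preservesLimitsOfShape_pempty_of_preservesTerminal F
  exact preservesFiniteLimits_of_preservesTerminal_and_pullbacks F

end RegularCalculus

/-! ### Full subcategories covered by a regular functor -/

section Covered

variable {D : Type u} [Category.{v} D] [Regular D] {A : Type u'} [Category.{v'} A] [Regular A]
  {ι : D ⥤ A}

/-- The monic part of the image factorization of `f` is sent to a monic regular epimorphism, hence
to an isomorphism, and `ι` reflects isomorphisms. -/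
theorem isRegularEpi_of_map [ι.Full] [ι.Faithful] (hι : isRegularFunctor D A ι) {X Y : D}
    (f : X ⟶ Y) (h : IsRegularEpi (ι.map f)) : IsRegularEpi f := by
  have := hι.1
  obtain ⟨I, e, m, he, hm, rfl⟩ := exists_image f
  rw [ι.map_comp] at h
  have := isRegularEpi_of_comp h
  have := isIso_of_isRegularEpi_of_mono (ι.map m)
  have := isIso_of_reflects_iso m ι
  exact isRegularEpi_comp he (isRegularEpi_of_isIso m)

variable (ι) in
/-- The objects that are covered by an object in the image of `ι`. -/
def IsCovered (a : A) : Prop := ∃ (X : D) (q : ι.obj X ⟶ a), IsRegularEpi q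

theorem IsCovered.of_isRegularEpi {a b : A} (h : IsCovered ι a) {q : a ⟶ b}
    (hq : IsRegularEpi q) : IsCovered ι b := by
  obtain ⟨X, p, hp⟩ := h
  exact ⟨X, p ≫ q, isRegularEpi_comp hp hq⟩

theorem IsCovered.of_isIso {a b : A} (h : IsCovered ι a) (q : a ⟶ b) [IsIso q] :
    IsCovered ι b :=
  h.of_isRegularEpi (isRegularEpi_of_isIso q)

theorem isCovered_obj (X : D) : IsCovered ι (ι.obj X) := ⟨X, 𝟙 _, inferInstance⟩

/-- If the kernel pair of `q : ι X ⟶ a` is covered then it is in the image of `ι`. -/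
theorem exists_isKernelPair_map [ι.Full] [ι.Faithful] (hι : isRegularFunctor D A ι) {X : D} {a : A}
    (q : ι.obj X ⟶ a) (h : IsCovered ι (pullback q q)) :
    ∃ (R : D) (r₁ r₂ : R ⟶ X), IsKernelPair q (ι.map r₁) (ι.map r₂) := by
  have := hι.1
  obtain ⟨W, k, hk⟩ := h
  obtain ⟨w₁, hw₁⟩ := ι.map_surjective (k ≫ pullback.fst q q)
  obtain ⟨w₂, hw₂⟩ := ι.map_surjective (k ≫ pullback.snd q q)
  -- The image `R` of `W ⟶ X ⨯ X` is formed in `D`. Then `ι R` and the kernel pair of `q` are both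
  -- quotients of `ι W` with jointly monic maps to `ι X`, so they coincide.
  obtain ⟨R, e, m, he, hm, hem⟩ := exists_image (prod.lift w₁ w₂)
  have he' := hι.2 e he
  have h₁ : ι.map e ≫ ι.map (m ≫ prod.fst) = k ≫ pullback.fst q q := by
    rw [← ι.map_comp, ← hw₁, reassoc_of% hem, prod.lift_fst]
  have h₂ : ι.map e ≫ ι.map (m ≫ prod.snd) = k ≫ pullback.snd q q := by
    rw [← ι.map_comp, ← hw₂, reassoc_of% hem, prod.lift_snd]
  have hj : ∀ {T : A} (x y : T ⟶ ι.obj R), x ≫ ι.map (m ≫ prod.fst) = y ≫ ι.map (m ≫ prod.fst) →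
      x ≫ ι.map (m ≫ prod.snd) = y ≫ ι.map (m ≫ prod.snd) → x = y := fun x y h₁ h₂ => by
    rw [← cancel_mono (ι.map m)]
    refine map_prod_hom_ext ι ?_ ?_
    · rw [Category.assoc, Category.assoc, ← ι.map_comp, h₁]
    · rw [Category.assoc, Category.assoc, ← ι.map_comp, h₂]
  have hw : ι.map (m ≫ prod.fst) ≫ q = ι.map (m ≫ prod.snd) ≫ q := by
    rw [← cancel_epi (ι.map e), reassoc_of% h₁, reassoc_of% h₂, pullback.condition]
  refine ⟨R, m ≫ prod.fst, m ≫ prod.snd, ⟨⟨hw⟩, ⟨?_⟩⟩⟩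
  have hl : ∀ s : PullbackCone q q, ∃ l : s.pt ⟶ ι.obj R,
      l ≫ ι.map (m ≫ prod.fst) = s.fst ∧ l ≫ ι.map (m ≫ prod.snd) = s.snd := fun s => by
    obtain ⟨d, hd⟩ := exists_desc k (ι.map e) (fun a b hab => hj _ _
      (by simp only [Category.assoc, h₁]; rw [reassoc_of% hab])
      (by simp only [Category.assoc, h₂]; rw [reassoc_of% hab]))
    have hd₁ : d ≫ ι.map (m ≫ prod.fst) = pullback.fst q q := by
      rw [← cancel_epi k, reassoc_of% hd, h₁]
    have hd₂ : d ≫ ι.map (m ≫ prod.snd) = pullback.snd q q := by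
      rw [← cancel_epi k, reassoc_of% hd, h₂]
    exact ⟨pullback.lift s.fst s.snd s.condition ≫ d, by simp only [Category.assoc, hd₁, pullback.lift_fst],
      by simp only [Category.assoc, hd₂, pullback.lift_snd]⟩
  choose l hl₁ hl₂ using hl
  exact PullbackCone.IsLimit.mk _ l hl₁ hl₂ (fun s x h₁ h₂ => hj _ _
    (h₁.trans (hl₁ s).symm) (h₂.trans (hl₂ s).symm))

/-- By full faithfulness the universal property of the kernel pair, tested on objects of `D`, is a
lifting property inside `D` (`key`). Each axiom of an equivalence relation is one instance of it. -/
theorem isEquivalenceRelation_of_isKernelPair_map [ι.Full] [ι.Faithful]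
    {X R : D} {a : A} {q : ι.obj X ⟶ a} {r₁ r₂ : R ⟶ X}
    (h : IsKernelPair q (ι.map r₁) (ι.map r₂)) : IsEquivalenceRelation r₁ r₂ := by
  have key : ∀ {W : D} (w₁ w₂ : W ⟶ X), ι.map w₁ ≫ q = ι.map w₂ ≫ q →
      ∃ l : W ⟶ R, l ≫ r₁ = w₁ ∧ l ≫ r₂ = w₂ := fun w₁ w₂ hw => by
    obtain ⟨l, hl⟩ := ι.map_surjective (h.lift _ _ hw)
    exact ⟨l, ι.map_injective (by rw [ι.map_comp, hl, h.lift_fst]),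
      ι.map_injective (by rw [ι.map_comp, hl, h.lift_snd])⟩
  obtain ⟨r, hr₁, hr₂⟩ := key (𝟙 X) (𝟙 X) rfl
  obtain ⟨s, hs₁, hs₂⟩ := key r₂ r₁ h.w.symm
  obtain ⟨t, ht₁, ht₂⟩ := key (pullback.fst r₂ r₁ ≫ r₁) (pullback.snd r₂ r₁ ≫ r₂) (by
    rw [ι.map_comp, Category.assoc, h.w, ← Category.assoc, ← ι.map_comp, pullback.condition,
      ι.map_comp, ι.map_comp, Category.assoc, Category.assoc, h.w])
  exact ⟨⟨{
    right_cancellation := fun T x y hx hy => ι.map_injective (h.hom_ext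
      (by rw [← ι.map_comp, ← ι.map_comp, hx]) (by rw [← ι.map_comp, ← ι.map_comp, hy]))
    r := r, reflexivity₁ := hr₁, reflexivity₂ := hr₂
    s := s, symmetry₁ := hs₁, symmetry₂ := hs₂
    c := pullback.cone r₂ r₁, isLimit := pullback.isLimit r₂ r₁
    t := t, transitivity₁ := ht₁, transitivity₂ := ht₂ }⟩⟩

end Covered

/-! ### Restriction of regular functors to a covering subcategory is fully faithful. -/

section Restriction

variable {D : Type u} [Category.{v} D] [Regular D]
  {A : Type*} [Category* A] [Regular A] {ι : D ⥤ A} [ι.Full] [ι.Faithful]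

/-- The pullback of two morphisms from the image of `ι` is covered by an object in the image. -/
theorem exists_cover_pullback (hc : ∀ a, IsCovered ι a) {X Y : D} {a : A} (p : ι.obj X ⟶ a)
    (q : ι.obj Y ⟶ a) : ∃ (W : D) (w₁ : W ⟶ X) (w₂ : W ⟶ Y) (k : ι.obj W ⟶ pullback p q),
      IsRegularEpi k ∧ k ≫ pullback.fst p q = ι.map w₁ ∧ k ≫ pullback.snd p q = ι.map w₂ ∧
      ι.map w₁ ≫ p = ι.map w₂ ≫ q := by
  obtain ⟨W, k, hk⟩ := hc (pullback p q)
  obtain ⟨w₁, hw₁⟩ := ι.map_surjective (k ≫ pullback.fst p q)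
  obtain ⟨w₂, hw₂⟩ := ι.map_surjective (k ≫ pullback.snd p q)
  exact ⟨W, w₁, w₂, k, hk, hw₁.symm, hw₂.symm, by
    rw [hw₁, hw₂, Category.assoc, Category.assoc, pullback.condition]⟩

variable {E : Type u'} [Category.{v'} E] [Regular E]

/-- This is the well-definedness of the extension of `α` to the quotient `a`. Two elements
identified by `F.map q` form an element of `F` at the kernel pair; locally it lifts to `F (ι W)`,
and there naturality of `α` applies. -/
theorem map_comp_eq_of_natTrans (hc : ∀ a, IsCovered ι a) {F G : A ⥤ E}
    (hF : isRegularFunctor A E F) (α : ι ⋙ F ⟶ ι ⋙ G) {X : D} {a : A} (q : ι.obj X ⟶ a)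
    {T : E} (x y : T ⟶ F.obj (ι.obj X)) (h : x ≫ F.map q = y ≫ F.map q) :
    x ≫ α.app X ≫ G.map q = y ≫ α.app X ≫ G.map q := by
  have := hF.1
  obtain ⟨W, w₁, w₂, k, hk, h₁, h₂, hw⟩ := exists_cover_pullback hc q q
  have hk' := hF.2 k hk
  have hp : IsPullback (F.map (pullback.fst q q)) (F.map (pullback.snd q q)) (F.map q) (F.map q) :=
    (IsPullback.of_hasPullback q q).map F
  obtain ⟨T', p, z, _, hz⟩ := exists_lift_of_isRegularEpi (F.map k) (hp.lift x y h)
  have e₁ : p ≫ x = z ≫ F.map (ι.map w₁) := by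
    rw [← h₁, F.map_comp, ← reassoc_of% hz, hp.lift_fst]
  have e₂ : p ≫ y = z ≫ F.map (ι.map w₂) := by
    rw [← h₂, F.map_comp, ← reassoc_of% hz, hp.lift_snd]
  have n₁ : F.map (ι.map w₁) ≫ α.app X = α.app W ≫ G.map (ι.map w₁) := α.naturality w₁
  have n₂ : F.map (ι.map w₂) ≫ α.app X = α.app W ≫ G.map (ι.map w₂) := α.naturality w₂
  rw [← cancel_epi p, reassoc_of% e₁, reassoc_of% e₂, reassoc_of% n₁, reassoc_of% n₂,
    ← G.map_comp, ← G.map_comp, hw]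

theorem natTrans_ext_of_isCovered (hc : ∀ a, IsCovered ι a) {F G : A ⥤ E}
    (hF : isRegularFunctor A E F) {α β : F ⟶ G}
    (h : ∀ X, α.app (ι.obj X) = β.app (ι.obj X)) : α = β := by
  ext a
  obtain ⟨X, q, hq⟩ := hc a
  have := hF.2 q hq
  rw [← cancel_epi (F.map q), α.naturality, β.naturality, h]

/-- A natural transformation between the restrictions of regular functors extends. -/
theorem exists_natTrans_extension (hc : ∀ a, IsCovered ι a)
    {F G : A ⥤ E} (hF : isRegularFunctor A E F) (α : ι ⋙ F ⟶ ι ⋙ G) :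
    ∃ β : F ⟶ G, ∀ X, β.app (ι.obj X) = α.app X := by
  have := hF.1
  choose X q hq using hc
  have hFq := fun a => hF.2 (q a) (hq a)
  choose b hb using fun a => exists_desc (F.map (q a)) (α.app (X a) ≫ G.map (q a))
    (fun x y h => map_comp_eq_of_natTrans (fun a => ⟨X a, q a, hq a⟩) hF α (q a) x y h)
  -- The component `b a` is defined by one chosen cover. Compatibility with arbitrary morphisms from
  -- the image of `ι` gives both naturality and the values on that image.
  have key : ∀ {Y : D} {a : A} (r : ι.obj Y ⟶ a), F.map r ≫ b a = α.app Y ≫ G.map r := by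
    intro Y a r
    obtain ⟨W, w₁, w₂, k, hk, h₁, h₂, hw⟩ :=
      exists_cover_pullback (fun a => ⟨X a, q a, hq a⟩) r (q a)
    have hw₁ : IsRegularEpi (ι.map w₁) := by
      rw [← h₁]; exact isRegularEpi_comp hk inferInstance
    have := hF.2 _ hw₁
    have n₁ : F.map (ι.map w₁) ≫ α.app Y = α.app W ≫ G.map (ι.map w₁) := α.naturality w₁
    have n₂ : F.map (ι.map w₂) ≫ α.app _ = α.app W ≫ G.map (ι.map w₂) := α.naturality w₂
    rw [← cancel_epi (F.map (ι.map w₁)), reassoc_of% n₁, ← G.map_comp, ← F.map_comp_assoc, hw,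
      F.map_comp_assoc, hb, reassoc_of% n₂, G.map_comp]
  refine ⟨{ app := b, naturality := fun a a' f => ?_ }, fun Y => ?_⟩
  · rw [← cancel_epi (F.map (q a)), reassoc_of% hb, ← F.map_comp_assoc, key, G.map_comp]
  · simpa using key (𝟙 (ι.obj Y))

end Restriction

/-! ### Extension of regular functors to an exact completion -/

section Extension

variable {D : Type u} [Category.{v} D] [Regular D]
  {A : Type*} [Category* A] [Regular A] {ι : D ⥤ A} [ι.Full] [ι.Faithful]
  {E : Type u'} [Category.{v'} E] [BarrExact E]

variable (ι) in
/-- A presentation of the objects of `A` as quotients of objects in the image of `ι`, and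
quotients in `E` of the images of the corresponding equivalence relations under `G`. -/
structure QuotientData (G : D ⥤ E) where
  X : A → D
  q (a : A) : ι.obj (X a) ⟶ a
  hq (a : A) : IsRegularEpi (q a)
  R : A → D
  r₁ (a : A) : R a ⟶ X a
  r₂ (a : A) : R a ⟶ X a
  hr (a : A) : IsKernelPair (q a) (ι.map (r₁ a)) (ι.map (r₂ a))
  Q : A → E
  π (a : A) : G.obj (X a) ⟶ Q a
  hπ (a : A) : IsRegularEpi (π a)
  hk (a : A) : IsKernelPair (π a) (G.map (r₁ a)) (G.map (r₂ a))

/-- The kernel pair of a cover comes from an equivalence relation in `D`. Its image under `G` is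
still an equivalence relation, and exactness of `E` provides the quotient. -/
theorem nonempty_quotientData (hι : isRegularFunctor D A ι) (hc : ∀ a, IsCovered ι a) {G : D ⥤ E}
    (hG : isRegularFunctor D E G) : Nonempty (QuotientData ι G) := by
  have := hG.1
  have hc' := hc
  choose X q hq using hc
  choose R r₁ r₂ hr using fun a => exists_isKernelPair_map hι (q a) (hc' _)
  have hE := fun a =>
    have := isEquivalenceRelation_of_isKernelPair_map (hr a)
    IsEquivalenceRelation.map G (r₁ a) (r₂ a)
  choose Q π hπ hk using fun a => exists_quotient (G.map (r₁ a)) (G.map (r₂ a))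
  exact ⟨⟨X, q, hq, R, r₁, r₂, hr, Q, π, hπ, hk⟩⟩

namespace QuotientData

variable {G : D ⥤ E} (S : QuotientData ι G)

theorem map_comp_π {V : D} {a : A} (x y : V ⟶ S.X a) (h : ι.map x ≫ S.q a = ι.map y ≫ S.q a) :
    G.map x ≫ S.π a = G.map y ≫ S.π a := by
  obtain ⟨l, hl⟩ := ι.map_surjective ((S.hr a).lift _ _ h)
  have h₁ : l ≫ S.r₁ a = x := ι.map_injective (by rw [ι.map_comp, hl, (S.hr a).lift_fst])
  have h₂ : l ≫ S.r₂ a = y := ι.map_injective (by rw [ι.map_comp, hl, (S.hr a).lift_snd])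
  rw [← h₁, ← h₂, G.map_comp, G.map_comp, Category.assoc, Category.assoc, (S.hk a).w]

variable (hι : isRegularFunctor D A ι) (hc : ∀ a, IsCovered ι a) (hG : isRegularFunctor D E G)

include hι hc hG

/-- A morphism `p` from `ι Y` need not lift through `S.q a`, but it does so on a cover `v₁` of `Y`
that lies in `D`. Two such lifts are related by `S.R a` on a common refinement, so the composite
with `S.π a` descends along `G.map v₁` and is independent of the choices. -/
theorem exists_ext {Y : D} {a : A} (p : ι.obj Y ⟶ a) : ∃ φ : G.obj Y ⟶ S.Q a,
    ∀ {W : D} (w₁ : W ⟶ Y) (w₂ : W ⟶ S.X a), ι.map w₁ ≫ p = ι.map w₂ ≫ S.q a →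
      G.map w₁ ≫ φ = G.map w₂ ≫ S.π a := by
  have := hι.1
  have := hG.1
  obtain ⟨V, v₁, v₂, k, hk, h₁, h₂, hv⟩ := exists_cover_pullback hc p (S.q a)
  have hv₁ : IsRegularEpi v₁ := isRegularEpi_of_map hι v₁ (by
    have := S.hq a
    rw [← h₁]; exact isRegularEpi_comp hk inferInstance)
  have hGv := hG.2 v₁ hv₁
  have main : ∀ {W : D} (w₁ : W ⟶ Y) (w₂ : W ⟶ S.X a), ι.map w₁ ≫ p = ι.map w₂ ≫ S.q a →
      G.map (pullback.fst w₁ v₁) ≫ G.map w₂ ≫ S.π a =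
        G.map (pullback.snd w₁ v₁) ≫ G.map v₂ ≫ S.π a := fun w₁ w₂ h => by
    rw [← G.map_comp_assoc, ← G.map_comp_assoc]
    refine S.map_comp_π _ _ ?_
    rw [ι.map_comp, ι.map_comp, Category.assoc, Category.assoc, ← h, ← hv, ← ι.map_comp_assoc,
      ← ι.map_comp_assoc, pullback.condition]
  obtain ⟨φ, hφ⟩ := exists_desc (G.map v₁) (G.map v₂ ≫ S.π a) (fun {T} x y hxy => by
    have hp : IsPullback (G.map (pullback.fst v₁ v₁)) (G.map (pullback.snd v₁ v₁)) (G.map v₁)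
      (G.map v₁) := (IsPullback.of_hasPullback v₁ v₁).map G
    rw [← hp.lift_fst x y hxy, Category.assoc, main v₁ v₂ hv, ← Category.assoc, hp.lift_snd])
  refine ⟨φ, fun {W} w₁ w₂ h => ?_⟩
  have := hG.2 (pullback.fst w₁ v₁) inferInstance
  rw [← cancel_epi (G.map (pullback.fst w₁ v₁)), main w₁ w₂ h, ← hφ, ← G.map_comp_assoc,
    ← G.map_comp_assoc, pullback.condition]

/-- The extension of `G` to morphisms from objects in the image of `ι`. -/
noncomputable def ext {Y : D} {a : A} (p : ι.obj Y ⟶ a) : G.obj Y ⟶ S.Q a :=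
  (S.exists_ext hι hc hG p).choose

theorem map_comp_ext {Y : D} {a : A} (p : ι.obj Y ⟶ a) {W : D} (w₁ : W ⟶ Y) (w₂ : W ⟶ S.X a)
    (h : ι.map w₁ ≫ p = ι.map w₂ ≫ S.q a) :
    G.map w₁ ≫ S.ext hι hc hG p = G.map w₂ ≫ S.π a :=
  (S.exists_ext hι hc hG p).choose_spec w₁ w₂ h

theorem exists_cover {Y : D} {a : A} (p : ι.obj Y ⟶ a) : ∃ (W : D) (w₁ : W ⟶ Y) (w₂ : W ⟶ S.X a),
    ι.map w₁ ≫ p = ι.map w₂ ≫ S.q a ∧ IsRegularEpi (G.map w₁) ∧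
      (IsRegularEpi p → IsRegularEpi (G.map w₂)) := by
  have := hι.1
  obtain ⟨V, v₁, v₂, k, hk, h₁, h₂, hv⟩ := exists_cover_pullback hc p (S.q a)
  refine ⟨V, v₁, v₂, hv, hG.2 _ (isRegularEpi_of_map hι v₁ ?_),
    fun _ => hG.2 _ (isRegularEpi_of_map hι v₂ ?_)⟩
  · have := S.hq a
    rw [← h₁]; exact isRegularEpi_comp hk inferInstance
  · rw [← h₂]; exact isRegularEpi_comp hk inferInstance

theorem ext_q (a : A) : S.ext hι hc hG (S.q a) = S.π a := by
  simpa using S.map_comp_ext hι hc hG (S.q a) (𝟙 _) (𝟙 _) rfl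

theorem ext_comp_left {Y Z : D} {a : A} (f : Y ⟶ Z) (p : ι.obj Z ⟶ a) :
    S.ext hι hc hG (ι.map f ≫ p) = G.map f ≫ S.ext hι hc hG p := by
  obtain ⟨W, w₁, w₂, hw, h₁, -⟩ := S.exists_cover hι hc hG (ι.map f ≫ p)
  rw [← cancel_epi (G.map w₁), S.map_comp_ext hι hc hG _ w₁ w₂ hw, ← G.map_comp_assoc,
    S.map_comp_ext hι hc hG p (w₁ ≫ f) w₂ (by rw [ι.map_comp, Category.assoc, hw])]

theorem isRegularEpi_ext {Y : D} {a : A} (p : ι.obj Y ⟶ a) [hp : IsRegularEpi p] :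
    IsRegularEpi (S.ext hι hc hG p) := by
  obtain ⟨W, w₁, w₂, hw, h₁, h₂⟩ := S.exists_cover hι hc hG p
  exact isRegularEpi_of_fac (isRegularEpi_comp (h₂ hp) (S.hπ a)) (S.map_comp_ext hι hc hG _ w₁ w₂ hw)

/-- The extension identifies no more than `A` does. Elements that become equal in `S.Q a` have,
locally, representatives in `G (S.X a)` related by `G (S.R a)`; such a relation is parametrized by
an object `W` of `D` over which `p` and `q` already agree. Exactness of the extended functor rests
on this. -/
theorem exists_of_ext_eq {Y Z : D} {a : A} (p : ι.obj Y ⟶ a) (q : ι.obj Z ⟶ a) {T : E}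
    (y : T ⟶ G.obj Y) (z : T ⟶ G.obj Z)
    (h : y ≫ S.ext hι hc hG p = z ≫ S.ext hι hc hG q) :
    ∃ (T' : E) (k : T' ⟶ T) (W : D) (w₁ : W ⟶ Y) (w₂ : W ⟶ Z) (l : T' ⟶ G.obj W),
      IsRegularEpi k ∧ ι.map w₁ ≫ p = ι.map w₂ ≫ q ∧ l ≫ G.map w₁ = k ≫ y ∧
        l ≫ G.map w₂ = k ≫ z := by
  have := hG.1
  obtain ⟨U, u₁, u₂, hu, hu₁, -⟩ := S.exists_cover hι hc hG p
  obtain ⟨V, v₁, v₂, hv, hv₁, -⟩ := S.exists_cover hι hc hG q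
  obtain ⟨T₁, k₁, y', hk₁, hy'⟩ := exists_lift_of_isRegularEpi (G.map u₁) y
  obtain ⟨T₂, k₂, z', hk₂, hz'⟩ := exists_lift_of_isRegularEpi (G.map v₁) (k₁ ≫ z)
  have e : (k₂ ≫ y' ≫ G.map u₂) ≫ S.π a = (z' ≫ G.map v₂) ≫ S.π a := by
    rw [Category.assoc, Category.assoc, Category.assoc, ← S.map_comp_ext hι hc hG p u₁ u₂ hu,
      ← S.map_comp_ext hι hc hG q v₁ v₂ hv, ← reassoc_of% hy', ← reassoc_of% hz', h]
  have p₁ : IsPullback (G.map (pullback.fst u₂ (S.r₁ a))) (G.map (pullback.snd u₂ (S.r₁ a)))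
    (G.map u₂) (G.map (S.r₁ a)) := (IsPullback.of_hasPullback _ _).map G
  have p₂ : IsPullback (G.map (pullback.fst (pullback.snd u₂ (S.r₁ a) ≫ S.r₂ a) v₂))
    (G.map (pullback.snd (pullback.snd u₂ (S.r₁ a) ≫ S.r₂ a) v₂))
    (G.map (pullback.snd u₂ (S.r₁ a) ≫ S.r₂ a)) (G.map v₂) :=
      (IsPullback.of_hasPullback _ _).map G
  -- The iterated pullback of `U`, `S.R a` and `V` over `S.X a` is formed in `D`, and `G` preserves
  -- it. The kernel pair property `S.hk` supplies the component in `G (S.R a)`.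
  let l₁ := p₁.lift (k₂ ≫ y') ((S.hk a).lift _ _ e) (by rw [(S.hk a).lift_fst, Category.assoc])
  let l₂ := p₂.lift l₁ z' (by
    rw [G.map_comp, p₁.lift_snd_assoc, (S.hk a).lift_snd])
  refine ⟨T₂, k₂ ≫ k₁, _, pullback.fst _ _ ≫ pullback.fst _ _ ≫ u₁, pullback.snd _ _ ≫ v₁, l₂,
    isRegularEpi_comp hk₂ hk₁, ?_, ?_, ?_⟩
  · rw [ι.map_comp, ι.map_comp, ι.map_comp, Category.assoc, Category.assoc, Category.assoc, hu, hv,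
      ← ι.map_comp_assoc (pullback.fst u₂ (S.r₁ a)), pullback.condition, ι.map_comp_assoc,
      (S.hr a).w, ← ι.map_comp_assoc (pullback.snd u₂ (S.r₁ a)), ← ι.map_comp_assoc,
      pullback.condition, ι.map_comp_assoc]
  · rw [G.map_comp, G.map_comp, p₂.lift_fst_assoc, p₁.lift_fst_assoc, Category.assoc,
      Category.assoc, hy']
  · rw [G.map_comp, p₂.lift_snd_assoc, Category.assoc, hz']

theorem exists_map {a b : A} (f : a ⟶ b) :
    ∃ g : S.Q a ⟶ S.Q b, S.π a ≫ g = S.ext hι hc hG (S.q a ≫ f) := by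
  have := S.hπ a
  refine exists_desc_of_isKernelPair (S.hk a) _ ?_
  rw [← ext_comp_left, ← ext_comp_left, ← Category.assoc, (S.hr a).w, Category.assoc]

/-- The extension of `G` to morphisms of `A`. -/
noncomputable def map {a b : A} (f : a ⟶ b) : S.Q a ⟶ S.Q b := (S.exists_map hι hc hG f).choose

theorem π_map {a b : A} (f : a ⟶ b) : S.π a ≫ S.map hι hc hG f = S.ext hι hc hG (S.q a ≫ f) :=
  (S.exists_map hι hc hG f).choose_spec

theorem ext_map {Y : D} {a b : A} (p : ι.obj Y ⟶ a) (f : a ⟶ b) :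
    S.ext hι hc hG p ≫ S.map hι hc hG f = S.ext hι hc hG (p ≫ f) := by
  obtain ⟨W, w₁, w₂, hw, h₁, -⟩ := S.exists_cover hι hc hG p
  rw [← cancel_epi (G.map w₁), ← Category.assoc, S.map_comp_ext hι hc hG p w₁ w₂ hw,
    Category.assoc, π_map, ← ext_comp_left, ← ext_comp_left, ← Category.assoc, ← hw, Category.assoc]

/-- The extension of `G` to a functor on `A`. -/
noncomputable def functor : A ⥤ E where
  obj := S.Q
  map f := S.map hι hc hG f
  map_id a := by
    have := S.hπ a
    rw [← cancel_epi (S.π a), π_map, Category.comp_id, ext_q, Category.comp_id]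
  map_comp {a b c} f g := by
    have := S.hπ a
    rw [← cancel_epi (S.π a), π_map, ← Category.assoc (S.π a), π_map, ext_map, Category.assoc]

/-- The functor `S.functor` extends `G`. -/
theorem isIso_ext_id (Y : D) : IsIso (S.ext hι hc hG (𝟙 (ι.obj Y))) := by
  have : Mono (S.ext hι hc hG (𝟙 (ι.obj Y))) := ⟨fun x y h => by
    obtain ⟨T', k, W, w₁, w₂, l, hk, hw, h₁, h₂⟩ := S.exists_of_ext_eq hι hc hG _ _ x y h
    have : w₁ = w₂ := ι.map_injective (by simpa using hw)
    rw [← cancel_epi k, ← h₁, ← h₂, this]⟩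
  have := S.isRegularEpi_ext hι hc hG (𝟙 (ι.obj Y))
  exact isIso_of_isRegularEpi_of_mono _

/-- The functor `S.functor` extends `G`. -/
noncomputable def functorIso : ι ⋙ S.functor hι hc hG ≅ G :=
  Iso.symm <| NatIso.ofComponents
    (fun Y => @asIso _ _ _ _ (S.ext hι hc hG (𝟙 (ι.obj Y))) (S.isIso_ext_id hι hc hG Y))
    (fun {Y Z} f => by
      refine (S.ext_comp_left hι hc hG f (𝟙 _)).symm.trans ?_
      refine Eq.trans ?_ (S.ext_map hι hc hG (𝟙 _) (ι.map f)).symm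
      rw [Category.comp_id, Category.id_comp])

/-- Jointly monic pairs stay jointly monic. Lift `x` and `y` to `S.X a`: equality after `f` and
after `g` is witnessed locally by objects `V` and `W` of `D` over `S.X a ⨯ S.X a`. On their pullback
the two maps to `a` agree after both `f` and `g`, hence are equal, so their images under `S.π a` are
equal. -/
theorem ext_mono {a b c : A} {f : a ⟶ b} {g : a ⟶ c}
    (hfg : ∀ {T : A} (x y : T ⟶ a), x ≫ f = y ≫ f → x ≫ g = y ≫ g → x = y) {T : E}
    (x y : T ⟶ S.Q a) (h₁ : x ≫ S.map hι hc hG f = y ≫ S.map hι hc hG f)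
    (h₂ : x ≫ S.map hι hc hG g = y ≫ S.map hι hc hG g) : x = y := by
  have := hι.1
  have := hG.1
  have := S.hπ a
  obtain ⟨T₁, k₁, x', _, hx⟩ := exists_lift_of_isRegularEpi (S.π a) x
  obtain ⟨T₂, k₂, y', _, hy⟩ := exists_lift_of_isRegularEpi (S.π a) (k₁ ≫ y)
  have e₁ : (k₂ ≫ x') ≫ S.ext hι hc hG (S.q a ≫ f) = y' ≫ S.ext hι hc hG (S.q a ≫ f) := by
    rw [← π_map, Category.assoc, ← reassoc_of% hx, ← reassoc_of% hy, h₁]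
  have e₂ : (k₂ ≫ x') ≫ S.ext hι hc hG (S.q a ≫ g) = y' ≫ S.ext hι hc hG (S.q a ≫ g) := by
    rw [← π_map, Category.assoc, ← reassoc_of% hx, ← reassoc_of% hy, h₂]
  obtain ⟨T₃, k₃, V, v₁, v₂, l, _, hv, hl₁, hl₂⟩ := S.exists_of_ext_eq hι hc hG _ _ _ _ e₁
  obtain ⟨T₄, k₄, W, w₁, w₂, m, _, hw, hm₁, hm₂⟩ := S.exists_of_ext_eq hι hc hG _ _
    (k₃ ≫ k₂ ≫ x') (k₃ ≫ y') (by simp only [Category.assoc] at e₂ ⊢; rw [e₂])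
  have hp : IsPullback (G.map (pullback.fst (prod.lift v₁ v₂) (prod.lift w₁ w₂)))
    (G.map (pullback.snd (prod.lift v₁ v₂) (prod.lift w₁ w₂))) (G.map (prod.lift v₁ v₂))
    (G.map (prod.lift w₁ w₂)) := (IsPullback.of_hasPullback _ _).map G
  have hlm : (k₄ ≫ l) ≫ G.map (prod.lift v₁ v₂) = m ≫ G.map (prod.lift w₁ w₂) := by
    refine map_prod_hom_ext G ?_ ?_
    · rw [Category.assoc, Category.assoc, Category.assoc, ← G.map_comp, ← G.map_comp,
        prod.lift_fst, prod.lift_fst, hl₁, hm₁]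
    · rw [Category.assoc, Category.assoc, Category.assoc, ← G.map_comp, ← G.map_comp,
        prod.lift_snd, prod.lift_snd, hl₂, hm₂]
  have c₁ := congrArg (· ≫ prod.fst) (pullback.condition (f := prod.lift v₁ v₂) (g := prod.lift w₁ w₂))
  have c₂ := congrArg (· ≫ prod.snd) (pullback.condition (f := prod.lift v₁ v₂) (g := prod.lift w₁ w₂))
  simp only [Category.assoc, prod.lift_fst, prod.lift_snd] at c₁ c₂
  have hq := S.map_comp_π (pullback.fst (prod.lift v₁ v₂) (prod.lift w₁ w₂) ≫ v₁)
    (pullback.fst (prod.lift v₁ v₂) (prod.lift w₁ w₂) ≫ v₂) (by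
      refine hfg _ _ ?_ ?_
      · rw [ι.map_comp, ι.map_comp]; simp only [Category.assoc]; rw [hv]
      · rw [c₁, c₂, ι.map_comp, ι.map_comp]; simp only [Category.assoc]; rw [hw])
  have hq' := congrArg (hp.lift _ _ hlm ≫ ·) hq
  simp only [G.map_comp, Category.assoc, hp.lift_fst_assoc, reassoc_of% hl₁, reassoc_of% hl₂,
    ← hx, ← hy] at hq'
  rw [← cancel_epi k₁, ← cancel_epi k₂, ← cancel_epi k₃, ← cancel_epi k₄, hq']

/-- The comparison with the pullback in `E` is monic by `ext_mono`. It is a regular epimorphism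
because, by `exists_of_ext_eq`, an element of that pullback comes locally from an object of `D` with
a cone over the cospan in `A`, and this cone factors through `d`. -/
theorem isPullback_map {a b c d : A} {f : d ⟶ a} {g : d ⟶ b} {h : a ⟶ c} {k : b ⟶ c}
    (H : IsPullback f g h k) : IsPullback (S.map hι hc hG f) (S.map hι hc hG g)
      (S.map hι hc hG h) (S.map hι hc hG k) := by
  have w : S.map hι hc hG f ≫ S.map hι hc hG h = S.map hι hc hG g ≫ S.map hι hc hG k := by
    have := (S.functor hι hc hG).congr_map H.w
    rwa [(S.functor hι hc hG).map_comp, (S.functor hι hc hG).map_comp] at this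
  have inj := fun {T : E} (x y : T ⟶ S.Q d) => S.ext_mono hι hc hG
    (fun x y h₁ h₂ => H.hom_ext h₁ h₂) x y
  have hm : Mono (pullback.lift _ _ w) := ⟨fun x y hxy => inj x y
    (by simpa only [Category.assoc, pullback.lift_fst] using congrArg (· ≫ pullback.fst _ _) hxy)
    (by simpa only [Category.assoc, pullback.lift_snd] using congrArg (· ≫ pullback.snd _ _) hxy)⟩
  have he : IsRegularEpi (pullback.lift _ _ w) := by
    have := S.hπ a
    have := S.hπ b
    obtain ⟨T₁, k₁, x, hk₁, hx⟩ := exists_lift_of_isRegularEpi (S.π a)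
      (pullback.fst (S.map hι hc hG h) (S.map hι hc hG k))
    obtain ⟨T₂, k₂, y, hk₂, hy⟩ := exists_lift_of_isRegularEpi (S.π b)
      (k₁ ≫ pullback.snd (S.map hι hc hG h) (S.map hι hc hG k))
    obtain ⟨T₃, k₃, W, w₁, w₂, l, hk₃, hw, h₁, h₂⟩ := S.exists_of_ext_eq hι hc hG
      (S.q a ≫ h) (S.q b ≫ k) (k₂ ≫ x) y (by
        rw [← π_map, ← π_map, Category.assoc, ← reassoc_of% hx, ← reassoc_of% hy,
          pullback.condition])
    simp only [← Category.assoc] at hw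
    refine isRegularEpi_of_exists_lift (p := k₃ ≫ k₂ ≫ k₁)
      (isRegularEpi_comp hk₃ (isRegularEpi_comp hk₂ hk₁))
      (x := l ≫ S.ext hι hc hG (H.lift _ _ hw)) ?_
    refine pullback.hom_ext ?_ ?_
    · rw [Category.assoc, Category.assoc, pullback.lift_fst, ext_map, H.lift_fst, ext_comp_left,
        reassoc_of% h₁, ext_q, Category.assoc, Category.assoc, hx]
    · rw [Category.assoc, Category.assoc, pullback.lift_snd, ext_map, H.lift_snd, ext_comp_left,
        reassoc_of% h₂, ext_q, Category.assoc, Category.assoc, hy]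
  have := isIso_of_isRegularEpi_of_mono (pullback.lift _ _ w)
  exact IsPullback.of_iso_pullback ⟨w⟩ (asIso (pullback.lift _ _ w))
    (pullback.lift_fst _ _ _) (pullback.lift_snd _ _ _)

theorem isRegularFunctor_functor : isRegularFunctor A E (S.functor hι hc hG) := by
  have := hι.1
  have := hG.1
  refine ⟨?_, fun {a b} f hf => ?_⟩
  · refine preservesFiniteLimits_of_isPullback _
      (terminalIsTerminal.isTerminalObj ι (⊤_ D)) ⟨?_⟩ (fun a b c f g =>
        ⟨_, _, _, .of_hasPullback f g, S.isPullback_map hι hc hG (.of_hasPullback f g)⟩)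
    -- The terminal object is taken in the image of `ι`, where the extension is isomorphic to `G`.
    exact (terminalIsTerminal.isTerminalObj G (⊤_ D)).ofIso ((S.functorIso hι hc hG).app _).symm
  · have := S.hq a
    have := S.isRegularEpi_ext hι hc hG (S.q a ≫ f) (hp := isRegularEpi_comp (S.hq a) hf)
    exact isRegularEpi_of_fac this (S.π_map hι hc hG f)

end QuotientData

end Extension

/-! ### The universal property for a fully faithful regular functor that covers its target. -/

section UniversalProperty

variable {D : Type u} [Category.{v} D] {A : Type*} [Category* A] {ι : D ⥤ A}

theorem isRegularFunctor.comp {E : Type u'} [Category.{v'} E] (hι : isRegularFunctor D A ι)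
    {F : A ⥤ E} (hF : isRegularFunctor A E F) : isRegularFunctor D E (ι ⋙ F) := by
  have := hι.1
  have := hF.1
  exact ⟨comp_preservesFiniteLimits ι F, fun f hf => hF.2 _ (hι.2 f hf)⟩

/-- Restriction of regular functors along a regular functor. -/
def restrictEx (hι : isRegularFunctor D A ι) (E : Type u') [Category.{v'} E] : Ex A E ⥤ Ex D E :=
  (isRegularFunctor D E).lift ((isRegularFunctor A E).ι ⋙ (Functor.whiskeringLeft D A E).obj ι)
    (fun F => hι.comp F.property)

/-- Natural transformations are determined on covers and descend along them, which gives full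
faithfulness; essential surjectivity is the extension by quotients. -/
theorem isEquivalence_restrictEx [Regular D] [Regular A] [ι.Full] [ι.Faithful]
    (hι : isRegularFunctor D A ι) (hc : ∀ a, IsCovered ι a) (E : Type u') [Category.{v'} E]
    [BarrExact E] : (restrictEx hι E).IsEquivalence where
  faithful := ⟨fun {F G} α β h => by
    ext1
    exact natTrans_ext_of_isCovered hc F.property
      (fun X => congrArg (fun (γ : (restrictEx hι E).obj F ⟶ (restrictEx hι E).obj G) =>
        γ.hom.app X) h)⟩
  full := ⟨fun {F G} α => by
    obtain ⟨β, hβ⟩ := exists_natTrans_extension hc F.property α.hom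
    refine ⟨ObjectProperty.homMk β, ?_⟩
    ext X
    exact hβ X⟩
  essSurj := ⟨fun G => by
    obtain ⟨S⟩ := nonempty_quotientData hι hc G.property
    exact ⟨⟨_, S.isRegularFunctor_functor hι hc G.property⟩,
      ⟨ObjectProperty.isoMk _ (S.functorIso hι hc G.property)⟩⟩⟩

theorem isBarrExactCompletion_of_isCovered {D : Type w} [Category.{w} D] {A : Type u}
    [Category.{v} A] {ι : D ⥤ A} (hD : Regular D) (hA : BarrExact A) [ι.Full] [ι.Faithful]
    (hι : isRegularFunctor D A ι) (hc : ∀ a, IsCovered ι a) :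
    IsBarrExactCompletion.{u, v, u', v', w} ι where
  regular := hD
  exact := hA
  isRegularFunctor := hι
  universal E _ _ :=
    have := isEquivalence_restrictEx hι hc E
    ⟨(restrictEx hι E).asEquivalence, ⟨Iso.refl _⟩⟩

end UniversalProperty

/-! ### Closure properties of quotients of equivalence relations. -/

section QuotientsAlong

variable {D : Type u} [Category.{v} D] [Regular D] {A : Type u'} [Category.{v'} A]

/-- The objects that are coequalizers of the images of equivalence relations under `ι`. -/
def isEquivQuotientAlong (ι : D ⥤ A) : ObjectProperty A := fun a =>
  ∃ (R X : D) (p₁ p₂ : R ⟶ X) (_ : IsEquivalenceRelation p₁ p₂) (π : ι.obj X ⟶ a)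
    (h : ι.map p₁ ≫ π = ι.map p₂ ≫ π), Nonempty (IsColimit (Cofork.ofπ π h))

variable [BarrExact A] {ι : D ⥤ A} [ι.Full] [ι.Faithful]

/-- Equivalence relations are effective in `A`, so the quotient of `ι X` by `ι R` has kernel pair `ι
R`. Conversely a covered kernel pair lies in the image of `ι`. The criterion mentions only covers,
which makes the closure properties accessible. -/
theorem isEquivQuotientAlong_iff (hι : isRegularFunctor D A ι) (a : A) :
    isEquivQuotientAlong ι a ↔
      ∃ (X : D) (q : ι.obj X ⟶ a), IsRegularEpi q ∧ IsCovered ι (pullback q q) := by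
  have := hι.1
  constructor
  · rintro ⟨R, X, p₁, p₂, _, π, h, ⟨hπ⟩⟩
    have := IsEquivalenceRelation.map ι p₁ p₂
    obtain ⟨b, q, hq, hk⟩ := exists_quotient (ι.map p₁) (ι.map p₂)
    obtain ⟨hc⟩ := nonempty_isColimit_of_isKernelPair hk
    let e : b ≅ a := hc.coconePointUniqueUpToIso hπ
    have he : q ≫ e.hom = π := hc.comp_coconePointUniqueUpToIso_hom hπ WalkingParallelPair.one
    have hπ' : IsRegularEpi π := he ▸ isRegularEpi_comp hq (isRegularEpi_of_isIso e.hom)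
    refine ⟨X, π, hπ', R, pullback.lift _ _ h, ?_⟩
    have hk' : IsKernelPair π (ι.map p₁) (ι.map p₂) := he ▸ IsKernelPair.comp_of_mono hk
    refine isRegularEpi_of_exists_lift (p := 𝟙 _) (x := hk'.lift _ _ pullback.condition)
      inferInstance ?_
    refine pullback.hom_ext ?_ ?_
    · rw [Category.assoc, pullback.lift_fst, hk'.lift_fst, Category.id_comp]
    · rw [Category.assoc, pullback.lift_snd, hk'.lift_snd, Category.id_comp]
  · rintro ⟨X, q, hq, hc⟩
    obtain ⟨R, r₁, r₂, h⟩ := exists_isKernelPair_map hι q hc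
    exact ⟨R, X, r₁, r₂, isEquivalenceRelation_of_isKernelPair_map h, q, h.w,
      nonempty_isColimit_of_isKernelPair h⟩

variable (ι) in
/-- Every regular epimorphism onto an object in the image of `ι` is refined by the image of a
regular epimorphism. -/
def HasRefinements : Prop := ∀ {X : D} {P : A} (e : P ⟶ ι.obj X), IsRegularEpi e →
  ∃ (Y : D) (f : Y ⟶ X) (l : ι.obj Y ⟶ P), IsRegularEpi f ∧ l ≫ e = ι.map f

namespace isEquivQuotientAlong

variable (hι : isRegularFunctor D A ι)

include hι

theorem isCovered {a : A} (ha : isEquivQuotientAlong ι a) : IsCovered ι a := by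
  obtain ⟨X, q, hq, -⟩ := (isEquivQuotientAlong_iff hι a).1 ha
  exact ⟨X, q, hq⟩

theorem obj (X : D) : isEquivQuotientAlong ι (ι.obj X) :=
  (isEquivQuotientAlong_iff hι _).2 ⟨X, 𝟙 _, inferInstance,
    (isCovered_obj X).of_isRegularEpi (q := pullback.lift (𝟙 _) (𝟙 _) rfl)
      (isRegularEpi_of_exists_lift (p := 𝟙 _) (x := pullback.fst _ _) inferInstance (by
        refine pullback.hom_ext ?_ ?_
        · rw [Category.assoc, pullback.lift_fst, Category.comp_id, Category.id_comp]
        · rw [Category.assoc, pullback.lift_snd, pullback.condition, Category.comp_id, Category.id_comp]))⟩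

theorem of_iso {a b : A} (e : a ≅ b) (ha : isEquivQuotientAlong ι a) :
    isEquivQuotientAlong ι b := by
  obtain ⟨X, q, hq, hc⟩ := (isEquivQuotientAlong_iff hι a).1 ha
  refine (isEquivQuotientAlong_iff hι b).2 ⟨X, q ≫ e.hom,
    isRegularEpi_comp hq (isRegularEpi_of_isIso _), ?_⟩
  exact hc.of_isIso (pullback.map q q (q ≫ e.hom) (q ≫ e.hom) (𝟙 _) (𝟙 _) e.hom (by simp) (by simp))

/-- Refinements allow `p` and `q` to be lifted through a cover `c : ι W ⟶ a` after passing to covers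
`X'` and `Y'` in `D`. The pullback is then covered by the iterated pullback of `X'`, `R` and `Y'`
over `W`, where `ι R` is the kernel pair of `c`. -/
theorem isCovered_pullback (hl : HasRefinements ι) {a : A} (ha : isEquivQuotientAlong ι a)
    {X Y : D} (p : ι.obj X ⟶ a) (q : ι.obj Y ⟶ a) : IsCovered ι (pullback p q) := by
  have := hι.1
  obtain ⟨W, c, hc, hk⟩ := (isEquivQuotientAlong_iff hι a).1 ha
  obtain ⟨R, r₁, r₂, hr⟩ := exists_isKernelPair_map hι c hk
  have key : ∀ {X : D} (p : ι.obj X ⟶ a), ∃ (X' : D) (f : X' ⟶ X) (x : X' ⟶ W),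
      IsRegularEpi (ι.map f) ∧ ι.map f ≫ p = ι.map x ≫ c := fun p => by
    obtain ⟨X', f, l, hf, hlf⟩ := hl (pullback.fst p c) inferInstance
    obtain ⟨x, hx⟩ := ι.map_surjective (l ≫ pullback.snd p c)
    exact ⟨X', f, x, hι.2 f hf, by
      rw [hx, ← hlf, Category.assoc, Category.assoc, pullback.condition]⟩
  obtain ⟨X', f, x, hf, hfx⟩ := key p
  obtain ⟨Y', g, y, hg, hgy⟩ := key q
  have p₁ : IsPullback (ι.map (pullback.fst x r₁)) (ι.map (pullback.snd x r₁))
    (ι.map x) (ι.map r₁) := (IsPullback.of_hasPullback _ _).map ι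
  have p₂ : IsPullback (ι.map (pullback.fst (pullback.snd x r₁ ≫ r₂) y))
    (ι.map (pullback.snd (pullback.snd x r₁ ≫ r₂) y))
    (ι.map (pullback.snd x r₁ ≫ r₂)) (ι.map y) := (IsPullback.of_hasPullback _ _).map ι
  obtain ⟨T₁, k₁, x', hk₁, hx'⟩ := exists_lift_of_isRegularEpi (ι.map f) (pullback.fst p q)
  obtain ⟨T₂, k₂, y', hk₂, hy'⟩ := exists_lift_of_isRegularEpi (ι.map g) (k₁ ≫ pullback.snd p q)
  have e : (k₂ ≫ x' ≫ ι.map x) ≫ c = (y' ≫ ι.map y) ≫ c := by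
    rw [Category.assoc, Category.assoc, Category.assoc, ← hfx, ← hgy, ← reassoc_of% hx',
      ← reassoc_of% hy', pullback.condition]
  let l₁ := p₁.lift (k₂ ≫ x') (hr.lift _ _ e) (by rw [hr.lift_fst, Category.assoc])
  let l₂ := p₂.lift l₁ y' (by rw [ι.map_comp, p₁.lift_snd_assoc, hr.lift_snd])
  refine ⟨_, pullback.lift
    (ι.map (pullback.fst (pullback.snd x r₁ ≫ r₂) y) ≫ ι.map (pullback.fst x r₁) ≫ ι.map f)
    (ι.map (pullback.snd (pullback.snd x r₁ ≫ r₂) y) ≫ ι.map g) ?_,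
    isRegularEpi_of_exists_lift (isRegularEpi_comp hk₂ hk₁) (x := l₂) ?_⟩
  · rw [Category.assoc, Category.assoc, Category.assoc, hfx, hgy, p₁.w_assoc, hr.w,
      ← p₂.w_assoc, ι.map_comp, Category.assoc]
  · refine pullback.hom_ext ?_ ?_
    · rw [Category.assoc, pullback.lift_fst, p₂.lift_fst_assoc, p₁.lift_fst_assoc, Category.assoc,
        Category.assoc, hx']
    · rw [Category.assoc, pullback.lift_snd, p₂.lift_snd_assoc, Category.assoc, hy']

/-- The pullback of covers of `a` and `b` covers the pullback of `f` and `g`, which gives a cover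
`h` by some `ι W`. The kernel pair of `h` is the intersection of the kernel pairs of its composites
to `a` and to `b`; both come from relations `R` and `S` on `W` in `D`, hence so does the
intersection. -/
theorem pullback (hl : HasRefinements ι) {a b c : A} (ha : isEquivQuotientAlong ι a)
    (hb : isEquivQuotientAlong ι b) (hc : isEquivQuotientAlong ι c) (f : a ⟶ c) (g : b ⟶ c) :
    isEquivQuotientAlong ι (pullback f g) := by
  have := hι.1
  obtain ⟨X, p, hp⟩ := isCovered hι ha
  obtain ⟨Y, q, hq⟩ := isCovered hι hb
  obtain ⟨W, k, hk⟩ := isCovered_pullback hι hl hc (p ≫ f) (q ≫ g)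
  let m : Limits.pullback (p ≫ f) (q ≫ g) ⟶ Limits.pullback f g :=
    pullback.map _ _ _ _ p q (𝟙 _) (by simp) (by simp)
  have hm : IsRegularEpi m := by
    obtain ⟨T₁, k₁, x, hk₁, hx⟩ := exists_lift_of_isRegularEpi p (pullback.fst f g)
    obtain ⟨T₂, k₂, y, hk₂, hy⟩ := exists_lift_of_isRegularEpi q (k₁ ≫ pullback.snd f g)
    refine isRegularEpi_of_exists_lift (isRegularEpi_comp hk₂ hk₁)
      (x := pullback.lift (k₂ ≫ x) y (by
        rw [Category.assoc, ← reassoc_of% hx, ← reassoc_of% hy, pullback.condition])) ?_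
    refine pullback.hom_ext ?_ ?_
    · rw [Category.assoc, pullback.lift_fst, pullback.lift_fst_assoc, Category.assoc,
        Category.assoc, hx]
    · rw [Category.assoc, pullback.lift_snd, pullback.lift_snd_assoc, Category.assoc, hy]
  have hh := isRegularEpi_comp hk hm
  generalize k ≫ m = h at hh
  refine (isEquivQuotientAlong_iff hι _).2 ⟨W, h, hh, ?_⟩
  obtain ⟨R, r₁, r₂, hr⟩ := exists_isKernelPair_map hι (h ≫ pullback.fst f g)
    (isCovered_pullback hι hl ha _ _)
  obtain ⟨S, s₁, s₂, hs⟩ := exists_isKernelPair_map hι (h ≫ pullback.snd f g)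
    (isCovered_pullback hι hl hb _ _)
  have hV : IsPullback (ι.map (pullback.fst (prod.lift r₁ r₂) (prod.lift s₁ s₂)))
    (ι.map (pullback.snd (prod.lift r₁ r₂) (prod.lift s₁ s₂))) (ι.map (prod.lift r₁ r₂))
    (ι.map (prod.lift s₁ s₂)) := (IsPullback.of_hasPullback _ _).map ι
  have c₁ := congrArg (· ≫ prod.fst) (pullback.condition (f := prod.lift r₁ r₂) (g := prod.lift s₁ s₂))
  have c₂ := congrArg (· ≫ prod.snd) (pullback.condition (f := prod.lift r₁ r₂) (g := prod.lift s₁ s₂))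
  simp only [Category.assoc, prod.lift_fst, prod.lift_snd] at c₁ c₂
  have cond := pullback.condition (f := h) (g := h)
  have w : ι.map (pullback.fst (prod.lift r₁ r₂) (prod.lift s₁ s₂) ≫ r₁) ≫ h =
      ι.map (pullback.fst (prod.lift r₁ r₂) (prod.lift s₁ s₂) ≫ r₂) ≫ h := by
    refine pullback.hom_ext ?_ ?_
    · rw [Category.assoc, Category.assoc, ι.map_comp, ι.map_comp, Category.assoc, Category.assoc,
        hr.w]
    · rw [c₁, c₂, Category.assoc, Category.assoc, ι.map_comp, ι.map_comp, Category.assoc,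
        Category.assoc, hs.w]
  obtain ⟨x, hx₁, hx₂⟩ : ∃ x : Limits.pullback h h ⟶ ι.obj R, x ≫ ι.map r₁ = pullback.fst h h ∧
      x ≫ ι.map r₂ = pullback.snd h h :=
    ⟨hr.lift _ _ (by rw [reassoc_of% cond]), hr.lift_fst _ _ _, hr.lift_snd _ _ _⟩
  obtain ⟨y, hy₁, hy₂⟩ : ∃ y : Limits.pullback h h ⟶ ι.obj S, y ≫ ι.map s₁ = pullback.fst h h ∧
      y ≫ ι.map s₂ = pullback.snd h h :=
    ⟨hs.lift _ _ (by rw [reassoc_of% cond]), hs.lift_fst _ _ _, hs.lift_snd _ _ _⟩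
  have hxy : x ≫ ι.map (prod.lift r₁ r₂) = y ≫ ι.map (prod.lift s₁ s₂) := by
    refine map_prod_hom_ext ι ?_ ?_
    · rw [Category.assoc, Category.assoc, ← ι.map_comp, ← ι.map_comp, prod.lift_fst,
        prod.lift_fst, hx₁, hy₁]
    · rw [Category.assoc, Category.assoc, ← ι.map_comp, ← ι.map_comp, prod.lift_snd,
        prod.lift_snd, hx₂, hy₂]
  refine ⟨_, pullback.lift _ _ w, isRegularEpi_of_exists_lift (p := 𝟙 _) (x := hV.lift x y hxy)
    inferInstance ?_⟩
  refine pullback.hom_ext ?_ ?_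
  · rw [Category.assoc, pullback.lift_fst, ι.map_comp _ r₁, hV.lift_fst_assoc, hx₁,
      Category.id_comp]
  · rw [Category.assoc, pullback.lift_snd, ι.map_comp _ r₂, hV.lift_fst_assoc, hx₂,
      Category.id_comp]

/-- A cover `q` of `a` has the same kernel pair as `q ≫ m`, and the latter is covered because `b` is
a quotient. -/
theorem of_mono (hl : HasRefinements ι) {a b : A} (ha : IsCovered ι a)
    (hb : isEquivQuotientAlong ι b) (m : a ⟶ b) [Mono m] : isEquivQuotientAlong ι a := by
  obtain ⟨X, q, hq⟩ := ha
  refine (isEquivQuotientAlong_iff hι _).2 ⟨X, q, hq, ?_⟩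
  refine (isCovered_pullback hι hl hb (q ≫ m) (q ≫ m)).of_isRegularEpi
    (q := pullback.lift (pullback.fst _ _) (pullback.snd _ _) (by
      rw [← cancel_mono m, Category.assoc, Category.assoc, pullback.condition])) ?_
  refine isRegularEpi_of_exists_lift (p := 𝟙 _) inferInstance
    (x := pullback.lift (pullback.fst _ _) (pullback.snd _ _) (by
      rw [pullback.condition_assoc])) ?_
  refine pullback.hom_ext ?_ ?_
  · rw [Category.assoc, pullback.lift_fst, pullback.lift_fst, Category.id_comp]
  · rw [Category.assoc, pullback.lift_snd, pullback.lift_snd, Category.id_comp]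

/-- For a cover `c` of `a`, the kernel pair of `c ≫ q` is the inverse image of the relation `r`
along `c` in both variables. It is built by two pullbacks, so it is covered by the closure under
pullbacks. -/
theorem of_isKernelPair (hl : HasRefinements ι) {a b r : A} {p₁ p₂ : r ⟶ a} {q : a ⟶ b}
    (ha : isEquivQuotientAlong ι a) (hr : isEquivQuotientAlong ι r) (hq : IsRegularEpi q)
    (hk : IsKernelPair q p₁ p₂) : isEquivQuotientAlong ι b := by
  obtain ⟨X, c, hc⟩ := isCovered hι ha
  refine (isEquivQuotientAlong_iff hι _).2 ⟨X, c ≫ q, isRegularEpi_comp hc hq, ?_⟩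
  obtain ⟨P, x, y, hP, hxy⟩ : ∃ (P : A) (x : P ⟶ ι.obj X) (y : P ⟶ r),
    isEquivQuotientAlong ι P ∧ IsPullback x y c p₁ :=
      ⟨_, _, _, pullback hι hl (obj hι X) hr ha c p₁, .of_hasPullback _ _⟩
  obtain ⟨Q, z, t, hQ, hzt⟩ : ∃ (Q : A) (z : Q ⟶ P) (t : Q ⟶ ι.obj X),
    isEquivQuotientAlong ι Q ∧ IsPullback z t (y ≫ p₂) c :=
      ⟨_, _, _, pullback hι hl hP (obj hι X) ha (y ≫ p₂) c, .of_hasPullback _ _⟩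
  have w : (z ≫ x) ≫ c ≫ q = t ≫ c ≫ q := by
    rw [← hzt.w_assoc, Category.assoc, Category.assoc, hxy.w_assoc, hk.w]
  have cond := pullback.condition (f := c ≫ q) (g := c ≫ q)
  simp only [← Category.assoc] at cond
  have e₁ : pullback.fst (c ≫ q) (c ≫ q) ≫ c = hk.lift _ _ cond ≫ p₁ := by rw [hk.lift_fst]
  have e₂ : hxy.lift _ _ e₁ ≫ y ≫ p₂ = pullback.snd (c ≫ q) (c ≫ q) ≫ c := by
    rw [hxy.lift_snd_assoc, hk.lift_snd]
  refine (isCovered hι hQ).of_isRegularEpi (q := pullback.lift _ _ w)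
    (isRegularEpi_of_exists_lift (p := 𝟙 _) (x := hzt.lift _ _ e₂) inferInstance ?_)
  refine pullback.hom_ext ?_ ?_
  · rw [Category.assoc, pullback.lift_fst, hzt.lift_fst_assoc, hxy.lift_fst, Category.id_comp]
  · rw [Category.assoc, pullback.lift_snd, hzt.lift_snd, Category.id_comp]

end isEquivQuotientAlong

end QuotientsAlong

/-! ### The exact completion as a full subcategory -/

section FullSubcategory

variable {D : Type u} [Category.{v} D] [Regular D] {A : Type u'} [Category.{v'} A]
  [BarrExact A] {ι : D ⥤ A} [ι.Full] [ι.Faithful]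

variable (hι : isRegularFunctor D A ι) (hl : HasRefinements ι)

include hι hl

theorem isClosedUnderLimitsOfShape_walkingCospan :
    (isEquivQuotientAlong ι).IsClosedUnderLimitsOfShape WalkingCospan where
  limitsOfShape_le := by
    rintro a ⟨h⟩
    refine isEquivQuotientAlong.of_iso hι ?_ (isEquivQuotientAlong.pullback hι hl
      (h.prop_diag_obj .left) (h.prop_diag_obj .right) (h.prop_diag_obj .one)
      (h.diag.map WalkingCospan.Hom.inl) (h.diag.map WalkingCospan.Hom.inr))
    exact (HasLimit.isoOfNatIso (diagramIsoCospan h.diag)).symm ≪≫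
      (limit.isLimit _).conePointUniqueUpToIso h.isLimit

theorem isClosedUnderLimitsOfShape_pempty :
    (isEquivQuotientAlong ι).IsClosedUnderLimitsOfShape (Discrete.{0} PEmpty) where
  limitsOfShape_le := by
    rintro a ⟨h⟩
    have := hι.1
    refine isEquivQuotientAlong.of_iso hι ?_ (isEquivQuotientAlong.obj hι (⊤_ D))
    exact (IsLimit.conePointsIsoOfNatIso h.isLimit (terminalIsTerminal.isTerminalObj ι _)
      (Functor.uniqueFromEmpty _)).symm

theorem hasFiniteLimits_fullSubcategory :
    HasFiniteLimits (isEquivQuotientAlong ι).FullSubcategory := by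
  have := isClosedUnderLimitsOfShape_walkingCospan hι hl
  have := isClosedUnderLimitsOfShape_pempty hι hl
  have : HasTerminal (isEquivQuotientAlong ι).FullSubcategory :=
    hasLimitsOfShape_of_closedUnderLimits _ _
  have : HasPullbacks (isEquivQuotientAlong ι).FullSubcategory :=
    hasLimitsOfShape_of_closedUnderLimits _ _
  exact hasFiniteLimits_of_hasTerminal_and_pullbacks

theorem preservesFiniteLimits_fullSubcategory_ι :
    PreservesFiniteLimits (isEquivQuotientAlong ι).ι := by
  have := isClosedUnderLimitsOfShape_walkingCospan hι hl
  have := isClosedUnderLimitsOfShape_pempty hι hl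
  have := hasFiniteLimits_fullSubcategory hι hl
  exact preservesFiniteLimits_of_preservesTerminal_and_pullbacks _

/-- The image formed in `A` is covered, being a quotient of `a`, and is a subobject of `b`, so it
stays in the subcategory. -/
theorem exists_image_fullSubcategory {a b : (isEquivQuotientAlong ι).FullSubcategory} (f : a ⟶ b) :
    ∃ (c : (isEquivQuotientAlong ι).FullSubcategory) (e : a ⟶ c) (m : c ⟶ b),
      IsRegularEpi e.hom ∧ Mono m ∧ e ≫ m = f := by
  obtain ⟨c, e, m, he, hm, h⟩ := exists_image f.hom
  have hc := isEquivQuotientAlong.of_mono hι hl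
    ((isEquivQuotientAlong.isCovered hι a.property).of_isRegularEpi he) b.property m
  let m' : (⟨c, hc⟩ : (isEquivQuotientAlong ι).FullSubcategory) ⟶ b := ObjectProperty.homMk m
  have : Mono ((isEquivQuotientAlong ι).ι.map m') := hm
  exact ⟨⟨c, hc⟩, ObjectProperty.homMk e, m', he, Functor.mono_of_mono_map _ this,
    ObjectProperty.hom_ext _ h⟩

/-- A regular epimorphism is extremal, so the monic part of its image factorization is invertible.
In the other direction the inclusion preserves kernel pairs, and descent in `A` is descent in the
full subcategory. -/
theorem isRegularEpi_fullSubcategory_iff {a b : (isEquivQuotientAlong ι).FullSubcategory}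
    (f : a ⟶ b) : IsRegularEpi f ↔ IsRegularEpi f.hom := by
  have := hasFiniteLimits_fullSubcategory hι hl
  have := preservesFiniteLimits_fullSubcategory_ι hι hl
  constructor
  · intro hf
    obtain ⟨c, e, m, he, hm, rfl⟩ := exists_image_fullSubcategory hι hl f
    have : IsIso m := ExtremalEpi.isIso (f := e ≫ m) e m rfl
    exact isRegularEpi_comp he (isRegularEpi_of_isIso m.hom)
  · intro hf
    have hk : IsKernelPair f.hom (pullback.fst f f).hom (pullback.snd f f).hom :=
      (IsPullback.of_hasPullback f f).map (isEquivQuotientAlong ι).ι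
    have : Epi f := (isEquivQuotientAlong ι).ι.epi_of_epi_map (inferInstanceAs (Epi f.hom))
    refine IsRegularEpi.of_epi_of_exists (fun c g hg => ?_)
    obtain ⟨d, hd⟩ := exists_desc_of_isKernelPair hk g.hom (congrArg (fun k => k.hom) hg)
    exact ⟨ObjectProperty.homMk d, ObjectProperty.hom_ext _ hd⟩

/-- Images, regular epimorphisms and pullbacks agree with those of `A`. The quotient in `A` of an
equivalence relation between objects of the subcategory stays in it by `of_isKernelPair`. -/
theorem barrExact_fullSubcategory : BarrExact (isEquivQuotientAlong ι).FullSubcategory := by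
  have := hasFiniteLimits_fullSubcategory hι hl
  have := preservesFiniteLimits_fullSubcategory_ι hι hl
  exact {
    hasCoequalizer_of_isKernelPair := fun {X Y Z f g₁ g₂} h => by
      obtain ⟨c, e, m, he, hm, rfl⟩ := exists_image_fullSubcategory hι hl f
      have := (isRegularEpi_fullSubcategory_iff hι hl e).2 he
      have hk : IsKernelPair e g₁ g₂ := IsKernelPair.cancel_right_of_mono h
      exact ⟨⟨_, hk.toCoequalizer'⟩⟩
    regularEpiIsStableUnderBaseChange := ⟨fun {X Y Y' S f g f' g'} h hg =>
      (isRegularEpi_fullSubcategory_iff hι hl _).2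
        (isRegularEpi_of_isPullback (h.map (isEquivQuotientAlong ι).ι)
          ((isRegularEpi_fullSubcategory_iff hι hl _).1 hg))⟩
    exists_isKernelPair := fun {R X} p₁ p₂ _ => by
      have := IsEquivalenceRelation.map (isEquivQuotientAlong ι).ι p₁ p₂
      obtain ⟨b, q, hq, hk⟩ := exists_quotient ((isEquivQuotientAlong ι).ι.map p₁)
        ((isEquivQuotientAlong ι).ι.map p₂)
      have hb := isEquivQuotientAlong.of_isKernelPair hι hl X.property R.property hq hk
      exact ⟨⟨b, hb⟩, ObjectProperty.homMk q, IsPullback.of_map_of_faithful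
        (isEquivQuotientAlong ι).ι hk⟩ }

theorem isRegularFunctor_lift (h : ∀ X, isEquivQuotientAlong ι (ι.obj X)) :
    isRegularFunctor D (isEquivQuotientAlong ι).FullSubcategory
      ((isEquivQuotientAlong ι).lift ι h) := by
  have := hι.1
  have : PreservesFiniteLimits ((isEquivQuotientAlong ι).lift ι h ⋙ (isEquivQuotientAlong ι).ι) :=
    this
  refine ⟨preservesFiniteLimits_of_reflects_of_preserves _ (isEquivQuotientAlong ι).ι,
    fun f hf => (isRegularEpi_fullSubcategory_iff hι hl _).2 (hι.2 f hf)⟩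

theorem isCovered_lift (h : ∀ X, isEquivQuotientAlong ι (ι.obj X))
    (a : (isEquivQuotientAlong ι).FullSubcategory) :
    IsCovered ((isEquivQuotientAlong ι).lift ι h) a := by
  obtain ⟨X, q, hq⟩ := isEquivQuotientAlong.isCovered hι a.property
  exact ⟨X, ObjectProperty.homMk q, (isRegularEpi_fullSubcategory_iff hι hl _).2 hq⟩

end FullSubcategory

/-! ### Sheaves of sets form a Barr exact category -/

section Sheaves

open Opposite

variable {D : Type w} [SmallCategory D] (J : GrothendieckTopology D)

theorem isRegularEpi_sheaf_iff {F G : Sheaf J (Type w)} (f : F ⟶ G) :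
    IsRegularEpi f ↔ Presheaf.IsLocallySurjective J f.hom := by
  refine ⟨fun h => (Sheaf.isLocallySurjective_iff_epi f).2 inferInstance, fun h => ?_⟩
  have : Epi f := (Sheaf.isLocallySurjective_iff_epi f).1 h
  exact IsRegularEpiCategory.regularEpiOfEpi f

/-- Pullbacks of sheaves are computed sectionwise, so a sieve on which the image of a section lifts
along `f` also lifts the section along `q`. -/
theorem isLocallySurjective_of_isPullback {P X Y Z : Sheaf J (Type w)} {p : P ⟶ X} {q : P ⟶ Y}
    {f : X ⟶ Z} {g : Y ⟶ Z} (h : IsPullback p q f g) (hf : Presheaf.IsLocallySurjective J f.hom) :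
    Presheaf.IsLocallySurjective J q.hom where
  imageSieve_mem {U} s := by
    refine J.superset_covering ?_ (hf.imageSieve_mem (g.hom.app (op U) s))
    rintro V i ⟨t, ht⟩
    have hV : IsPullback (p.hom.app (op V)) (q.hom.app (op V)) (f.hom.app (op V))
      (g.hom.app (op V)) := (h.map (sheafToPresheaf J (Type w))).app (op V)
    obtain ⟨x, -, hx⟩ := Types.exists_of_isPullback hV t (Y.obj.map i.op s)
      (ht.trans (ConcreteCategory.congr_hom (g.hom.naturality i.op) s).symm)
    exact ⟨x, hx⟩

/-- The presheaf quotient of a presheaf by a relation. -/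
def presheafQuotient {X R : Dᵒᵖ ⥤ Type w} (p₁ p₂ : R ⟶ X) : Dᵒᵖ ⥤ Type w where
  obj U := Quot (fun x y => ∃ r, p₁.app U r = x ∧ p₂.app U r = y)
  map {U V} i := ↾(Quot.map (X.map i) (by
    rintro x y ⟨r, rfl, rfl⟩
    exact ⟨R.map i r, ConcreteCategory.congr_hom (p₁.naturality i) r,
      ConcreteCategory.congr_hom (p₂.naturality i) r⟩))
  map_id U := by
    ext ⟨x⟩
    exact congrArg (Quot.mk _) (ConcreteCategory.congr_hom (X.map_id U) x)
  map_comp i j := by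
    ext ⟨x⟩
    exact congrArg (Quot.mk _) (ConcreteCategory.congr_hom (X.map_comp i j) x)

/-- The projection to the presheaf quotient. -/
def presheafQuotientπ {X R : Dᵒᵖ ⥤ Type w} (p₁ p₂ : R ⟶ X) : X ⟶ presheafQuotient p₁ p₂ where
  app U := ↾(Quot.mk _)

/-- The relation is already an equivalence relation, so `Quot` identifies exactly the related
elements; joint monicity makes the relating element unique. -/
theorem isKernelPair_type {X R Y : Type w} {p₁ p₂ : R ⟶ X} (h : IsEquivalenceRelation p₁ p₂)
    (q : X ⟶ Y) (hq : ∀ x y, q x = q y ↔ Quot.mk (fun x y => ∃ r, p₁ r = x ∧ p₂ r = y) x =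
      Quot.mk _ y) : IsKernelPair q p₁ p₂ := by
  obtain ⟨⟨e⟩⟩ := h
  have he := TypeCat.equivalence_of_equivalenceRelation e
  refine (Types.isPullback_iff _ _ _ _).2 ⟨?_, ?_, ?_⟩
  · ext r
    exact (hq _ _).2 (Quot.sound ⟨r, rfl, rfl⟩)
  · rintro r s ⟨h₁, h₂⟩
    have := e.right_cancellation (Y := PUnit.{w+1}) (↾(fun _ => r)) (↾(fun _ => s)) (by ext; exact h₁)
      (by ext; exact h₂)
    exact ConcreteCategory.congr_hom this PUnit.unit
  · intro x y hxy
    exact (he.eqvGen_iff).1 (Quot.eqvGen_exact ((hq x y).1 hxy))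

theorem isKernelPair_presheafQuotientπ {X R : Sheaf J (Type w)} (p₁ p₂ : R ⟶ X)
    [IsEquivalenceRelation p₁ p₂] :
    IsKernelPair (presheafQuotientπ p₁.hom p₂.hom) p₁.hom p₂.hom :=
  IsPullback.of_forall_isPullback_app fun U =>
    isKernelPair_type (IsEquivalenceRelation.map
      (sheafToPresheaf J (Type w) ⋙ (evaluation Dᵒᵖ (Type w)).obj U) p₁ p₂) _ (fun _ _ => Iff.rfl)

/-- A relation on a sheaf is the kernel pair of the projection to the presheaf quotient.
Sheafification preserves this pullback, and the counit transports it back to the given sheaves. -/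
theorem barrExact_sheaf : BarrExact (Sheaf J (Type w)) where
  hasCoequalizer_of_isKernelPair _ := inferInstance
  regularEpiIsStableUnderBaseChange := ⟨fun h hg => (isRegularEpi_sheaf_iff J _).2
    (isLocallySurjective_of_isPullback J h ((isRegularEpi_sheaf_iff J _).1 hg))⟩
  exists_isKernelPair {R X} p₁ p₂ _ := by
    have h := (isKernelPair_presheafQuotientπ J p₁ p₂).map (presheafToSheaf J (Type w))
    let e := asIso (sheafificationAdjunction J (Type w)).counit
    refine ⟨_, (e.app X).inv ≫ (presheafToSheaf J (Type w)).map
      (presheafQuotientπ p₁.hom p₂.hom), ?_⟩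
    refine IsPullback.of_iso h (e.app R) (e.app X) (e.app X) (Iso.refl _) ?_ ?_ ?_ ?_
    · exact e.hom.naturality p₁
    · exact e.hom.naturality p₂
    · simp
    · simp

end Sheaves

/-! ### The canonical functor to sheaves for the regular topology -/

section RegularTopology

open Opposite

variable {D : Type w} [SmallCategory D] [Regular D]

/-- Regular epimorphisms in a regular category are closed under pullback and composition, so
generating a topology from them adds only larger sieves. -/
theorem mem_regTopology_iff {X : D} {S : Sieve X} :
    S ∈ regTopology D X ↔ ∃ (Y : D) (f : Y ⟶ X), IsRegularEpi f ∧ S f := by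
  constructor
  · intro h
    induction h with
    | of X R hR =>
      obtain ⟨Y, f, hf, rfl⟩ := hR
      exact ⟨Y, f, hf, Sieve.le_generate _ _ _ (Presieve.singleton_self f)⟩
    | top X => exact ⟨X, 𝟙 X, inferInstance, trivial⟩
    | pullback X S _ Y g ih =>
      obtain ⟨Z, f, hf, hS⟩ := ih
      refine ⟨pullback f g, pullback.snd f g, inferInstance, ?_⟩
      change S (pullback.snd f g ≫ g)
      rw [← pullback.condition]
      exact S.downward_closed hS _
    | transitive X S R _ _ ih ih' =>
      obtain ⟨Y, f, hf, hS⟩ := ih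
      obtain ⟨Z, g, hg, hR⟩ := ih' hS
      exact ⟨Z, g ≫ f, isRegularEpi_comp hg hf, hR⟩
  · rintro ⟨Y, f, hf, hS⟩
    refine (regTopology D).superset_covering ?_ (Precoverage.generate_mem_toGrothendieck
      (R := Presieve.singleton f) ⟨Y, f, hf, rfl⟩)
    rw [Sieve.generate_le_iff]
    rintro _ _ ⟨⟩
    exact hS

variable (D) in
theorem regTopology_eq : regTopology D = regularTopology D := by
  ext X S
  rw [mem_regTopology_iff, regularTopology.mem_sieves_iff_hasEffectiveEpi]
  simp only [isRegularEpi_iff_effectiveEpi]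

instance subcanonical_regTopology : (regTopology D).Subcanonical := by
  rw [regTopology_eq]; infer_instance

variable (D) in
/-- For the regular topology sheafification is not needed in the definition of `sheafYoneda`. -/
noncomputable def sheafYonedaIso : (regTopology D).yoneda ≅ sheafYoneda D :=
  (Functor.isoWhiskerLeft (regTopology D).yoneda
    (asIso (sheafificationAdjunction (regTopology D) (Type w)).counit)).symm

instance : (sheafYoneda D).Full := .of_iso (sheafYonedaIso D)

instance : (sheafYoneda D).Faithful := .of_iso (sheafYonedaIso D)

variable (D) in
-- A section `s` of the representable sheaf of `Y` lifts along `f` after restriction to the pullback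
-- of `f` along `s`, whose projection to the source of `s` covers. Hence a regular epimorphism
-- becomes locally surjective.
theorem isRegularFunctor_sheafYoneda : isRegularFunctor D _ (sheafYoneda D) := by
  refine ⟨comp_preservesFiniteLimits _ _, fun {X Y} f hf => ?_⟩
  have : IsRegularEpi ((regTopology D).yoneda.map f) := by
    rw [isRegularEpi_sheaf_iff]
    refine ⟨fun {U} s => mem_regTopology_iff.2 ⟨pullback f s, pullback.snd f s, inferInstance,
      pullback.fst f s, pullback.condition⟩⟩
  have h := barrExact_sheaf (regTopology D)
  rw [← NatIso.naturality_1 (sheafYonedaIso D) f]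
  exact isRegularEpi_comp (isRegularEpi_of_isIso _)
    (isRegularEpi_comp this (isRegularEpi_of_isIso _))

variable (D) in
-- Apply local surjectivity of `e` to the generic section, the identity of `X`: a cover `f` on which
-- it lifts is the refinement, and the lifted section is the morphism `l` by Yoneda.
theorem hasRefinements_sheafYoneda : HasRefinements (sheafYoneda D) := by
  intro X P e he
  have := barrExact_sheaf (regTopology D)
  let i := (sheafYonedaIso D).app X
  have h := (isRegularEpi_sheaf_iff _ _).1 (isRegularEpi_comp he (isRegularEpi_of_isIso i.inv))
  obtain ⟨Y, f, hf, t, ht⟩ := mem_regTopology_iff.1 (h.imageSieve_mem (U := X) (𝟙 X))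
  refine ⟨Y, f, (sheafYonedaIso D).inv.app Y ≫ (regTopology D).yonedaEquiv.symm t, hf, ?_⟩
  have : (regTopology D).yonedaEquiv.symm t ≫ e ≫ i.inv = (regTopology D).yoneda.map f := by
    rw [GrothendieckTopology.yonedaEquiv_symm_naturality_right, ht,
      ← GrothendieckTopology.yonedaEquiv_symm_naturality_left, ← Category.comp_id
        ((regTopology D).yoneda.map f)]
    congr 1
    rw [Equiv.symm_apply_eq]
    rfl
  rw [← cancel_mono i.inv, Category.assoc, Category.assoc, this]
  exact ((sheafYonedaIso D).inv.naturality f).symm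

instance : (toExactCompletion D).Full :=
  inferInstanceAs ((isEquivQuotient D).lift (sheafYoneda D) _).Full

instance : (toExactCompletion D).Faithful :=
  inferInstanceAs ((isEquivQuotient D).lift (sheafYoneda D) _).Faithful

variable (D)

/-- By definition `isEquivQuotient D` is `isEquivQuotientAlong (sheafYoneda D)`, so the results on
full subcategories apply. -/
instance barrExact_exactCompletion : BarrExact (ExactCompletion D) :=
  have := barrExact_sheaf (regTopology D)
  barrExact_fullSubcategory (isRegularFunctor_sheafYoneda D) (hasRefinements_sheafYoneda D)

theorem isRegularFunctor_toExactCompletion :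
    isRegularFunctor D (ExactCompletion D) (toExactCompletion D) :=
  have := barrExact_sheaf (regTopology D)
  isRegularFunctor_lift (isRegularFunctor_sheafYoneda D) (hasRefinements_sheafYoneda D)
    (isEquivQuotient_sheafYoneda D)

theorem isCovered_toExactCompletion (a : ExactCompletion D) :
    IsCovered (toExactCompletion D) a :=
  have := barrExact_sheaf (regTopology D)
  isCovered_lift (isRegularFunctor_sheafYoneda D) (hasRefinements_sheafYoneda D)
    (isEquivQuotient_sheafYoneda D) a

theorem isBarrExactCompletion_toExactCompletion :
    IsBarrExactCompletion.{_, _, u', v'} (toExactCompletion D) :=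
  isBarrExactCompletion_of_isCovered inferInstance inferInstance
    (isRegularFunctor_toExactCompletion D) (isCovered_toExactCompletion D)

end RegularTopology

/-! ### Morphisms of the syntactic category given by substitutions -/

section SyntacticSubstitution

variable {S : Signature.{w}} {T : Theory S}

namespace Prov

variable {Γ Δ Ξ Θ : List S.Srt}

theorem sub_id {φ : Formula S Γ} : Prov T φ (φ.sub (Sub.id Γ)) := by
  rw [Formula.sub_id]; exact refl φ

/-- Restriction of a judgement along a substitution. -/
theorem restrict {ω ψ : Formula S Ξ} {ω' : Formula S Θ} {ε : Sub S Ξ Θ} (h : Prov T ω' (ω.sub ε))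
    (h' : Prov T ω ψ) : Prov T ω' (ψ.sub ε) :=
  h.cut (h'.subst ε)

theorem restrict_sub {ω : Formula S Ξ} {ω' : Formula S Θ} {ε : Sub S Ξ Θ} {φ : Formula S Γ}
    {σ : Sub S Γ Ξ} (h : Prov T ω' (ω.sub ε)) (h' : Prov T ω (φ.sub σ)) :
    Prov T ω' (φ.sub (σ.comp ε)) := by
  rw [← Formula.sub_sub]; exact h.restrict h'

theorem restrict_eqs {ω : Formula S Ξ} {ω' : Formula S Θ} {ε : Sub S Ξ Θ} {σ τ : Sub S Γ Ξ}
    (h : Prov T ω' (ω.sub ε)) (h' : Prov T ω (Formula.eqs σ τ)) :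
    Prov T ω' (Formula.eqs (σ.comp ε) (τ.comp ε)) := by
  rw [← Formula.sub_eqs]; exact h.restrict h'

theorem sub_eqs {ω : Formula S Ξ} {σ τ : Sub S Γ Ξ} (φ : Formula S Γ)
    (h : Prov T ω (Formula.eqs σ τ)) (h' : Prov T ω (φ.sub σ)) : Prov T ω (φ.sub τ) :=
  SynCat.fml_eqs (X := ⟨Γ, φ⟩) h h'

theorem eqs_comp {ω : Formula S Ξ} (σ : Sub S Γ Δ) {ρ ρ' : Sub S Δ Ξ}
    (h : Prov T ω (Formula.eqs ρ ρ')) : Prov T ω (Formula.eqs (σ.comp ρ) (σ.comp ρ')) := by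
  have h' := eqs_force (Formula.eqs ((σ.comp ρ).comp (Sub.right Δ Ξ)) (σ.comp (Sub.left Δ Ξ)))
    (Sub.id Ξ) h
  simp only [Formula.sub_eqs, Sub.comp_assoc, Sub.right_append, Sub.left_append,
    Sub.comp_id] at h'
  exact h' (eqs_refl _)

theorem eqs_append {ω : Formula S Ξ} {τ τ' : Sub S Δ Ξ} {σ σ' : Sub S Γ Ξ} :
    Prov T ω (Formula.eqs (Sub.append τ σ) (Sub.append τ' σ')) ↔
      Prov T ω (Formula.eqs τ τ') ∧ Prov T ω (Formula.eqs σ σ') := by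
  induction Δ with
  | nil => exact ⟨fun h => ⟨top_intro _, h⟩, fun h => h.2⟩
  | cons s Δ ih =>
    refine ⟨fun h => ?_, fun h => ?_⟩
    · have := ih.1 h.and_snd
      exact ⟨and_intro h.and_fst this.1, this.2⟩
    · exact and_intro h.1.and_fst (ih.2 ⟨h.1.and_snd, h.2⟩)

end Prov

namespace SynCat

variable {X Y Z W V : SynCat T}

/-- The morphism given by a functional formula. -/
def homMk (θ : Formula S (Y.ctx ++ X.ctx)) (h : IsFunctional X Y θ) : X ⟶ Y :=
  Quotient.mk (homSetoid X Y) ⟨θ, h⟩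

theorem exists_homMk (f : X ⟶ Y) : ∃ θ h, f = homMk θ h := by
  obtain ⟨⟨θ, h⟩, rfl⟩ := Quotient.exists_rep f
  exact ⟨θ, h, rfl⟩

theorem homMk_eq_iff {θ η : Formula S (Y.ctx ++ X.ctx)} {hθ : IsFunctional X Y θ}
    {hη : IsFunctional X Y η} : homMk θ hθ = homMk η hη ↔ Prov T θ η ∧ Prov T η θ :=
  ⟨fun h => Quotient.exact (s := homSetoid X Y) h, fun h => Quotient.sound (s := homSetoid X Y) h⟩

/-- One implication suffices: by totality of `θ` every argument has some `θ`-value, this is also an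
`η`-value, and `η` has only one value. -/
theorem homMk_eq_of_prov {θ η : Formula S (Y.ctx ++ X.ctx)} {hθ : IsFunctional X Y θ}
    {hη : IsFunctional X Y η} (h : Prov T θ η) : homMk θ hθ = homMk η hη := by
  refine homMk_eq_iff.2 ⟨h, prov_of_force fun ω τ σ h₀ => ?_⟩
  refine Prov.exs_force (Prov.force hθ.total (hη.source h₀)) (fun ε τ' ω' h₁ h₂ => ?_)
  have h₃ := h₁.restrict_sub h₀
  rw [Sub.append_comp] at h₃
  rw [Formula.sub_sub, Sub.append_comp]
  exact Prov.eqs_force θ _ (hη.eqs (Prov.force h h₂) h₃) h₂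

/-- The graph of a substitution. -/
def subFml (φ : Formula S X.ctx) (σ : Sub S Y.ctx X.ctx) : Formula S (Y.ctx ++ X.ctx) :=
  .and (φ.sub (Sub.right Y.ctx X.ctx))
    (Formula.eqs (σ.comp (Sub.right Y.ctx X.ctx)) (Sub.left Y.ctx X.ctx))

theorem subFml_iff {σ : Sub S Y.ctx X.ctx} {Ξ : List S.Srt} {ω : Formula S Ξ}
    {φ : Formula S X.ctx} {ρ : Sub S X.ctx Ξ} {τ : Sub S Y.ctx Ξ} :
    Prov T ω ((subFml (T := T) φ σ).sub (Sub.append τ ρ)) ↔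
      Prov T ω (φ.sub ρ) ∧ Prov T ω (Formula.eqs (σ.comp ρ) τ) := by
  rw [subFml, Formula.sub, Formula.sub_sub, Sub.right_append, Formula.sub_eqs, Sub.comp_assoc,
    Sub.right_append, Sub.left_append]
  exact ⟨fun h => ⟨h.and_fst, h.and_snd⟩, fun h => Prov.and_intro h.1 h.2⟩

theorem isFunctional_subFml {σ : Sub S Y.ctx X.ctx} (h : Prov T X.fml (Y.fml.sub σ)) :
    IsFunctional X Y (subFml (T := T) X.fml σ) := by
  refine isFunctional_of_force (fun ω τ ρ h₀ => ?_) (fun ω ρ h₀ => ?_)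
    (fun ω τ τ' ρ h₀ h₁ => ?_)
  · have h₁ := subFml_iff.1 h₀
    exact ⟨h₁.1, Prov.sub_eqs _ h₁.2 (h₁.1.restrict_sub h)⟩
  · exact Prov.exs_of (σ.comp ρ) _ (subFml_iff.2 ⟨h₀, Prov.eqs_refl _⟩)
  · exact Prov.eqs_trans (Prov.eqs_symm (subFml_iff.1 h₀).2) (subFml_iff.1 h₁).2

/-- The morphism given by a substitution. -/
def ofSub (σ : Sub S Y.ctx X.ctx) (h : Prov T X.fml (Y.fml.sub σ)) : X ⟶ Y :=
  homMk _ (isFunctional_subFml h)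

/-- Evaluation at the generic element of `W` turns the equation into a judgement about `θ`; the
converse holds because a functional relation has only one value. Through this dictionary,
computations with relations become computations with elements. -/
theorem ofSub_comp_homMk {σ : Sub S X.ctx W.ctx} {h : Prov T W.fml (X.fml.sub σ)}
    {θ : Formula S (Y.ctx ++ X.ctx)} {hθ : IsFunctional X Y θ} {τ : Sub S Y.ctx W.ctx}
    {h' : Prov T W.fml (Y.fml.sub τ)} :
    ofSub σ h ≫ homMk θ hθ = ofSub τ h' ↔ Prov T W.fml (θ.sub (Sub.append τ σ)) := by
  constructor
  · intro e
    have h₁ := (homMk_eq_iff (hθ := isFunctional_comp (isFunctional_subFml h) hθ).1 e).2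
    refine compFml_force (σ := Sub.id _) (ρ := τ) (Prov.force h₁
      (subFml_iff.2 ⟨Prov.sub_id, by rw [Sub.comp_id]; exact Prov.eqs_refl _⟩)) (fun ε υ ω' _ h₂ h₃ => ?_)
    rw [Formula.sub_sub, Sub.append_comp]
    exact Prov.eqs_force_right θ _ (Prov.eqs_symm (subFml_iff.1 h₂).2) h₃
  · intro h₀
    refine homMk_eq_of_prov (hθ := isFunctional_comp (isFunctional_subFml h) hθ)
      (prov_of_force fun ω ρ α h₁ => compFml_force h₁ (fun ε υ ω' _ h₂ h₃ => ?_))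
    rw [Formula.sub_sub, Sub.append_comp]
    have h₄ := subFml_iff.1 h₂
    have h₅ := h₄.1.restrict_sub h₀
    rw [Sub.append_comp] at h₅
    exact subFml_iff.2 ⟨h₄.1, hθ.eqs (Prov.eqs_force_right θ _ h₄.2 h₅) h₃⟩

theorem ofSub_comp_ofSub (σ : Sub S Y.ctx X.ctx) (h : Prov T X.fml (Y.fml.sub σ))
    (τ : Sub S Z.ctx Y.ctx) (h' : Prov T Y.fml (Z.fml.sub τ)) :
    ofSub σ h ≫ ofSub τ h' = ofSub (τ.comp σ) (h.restrict_sub h') :=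
  ofSub_comp_homMk.2 (subFml_iff.2 ⟨h, Prov.eqs_refl _⟩)

theorem ofSub_id (X : SynCat T) : ofSub (Sub.id X.ctx) Prov.sub_id = 𝟙 X := rfl

theorem ofSub_eq_iff {σ τ : Sub S Y.ctx X.ctx} {h : Prov T X.fml (Y.fml.sub σ)}
    {h' : Prov T X.fml (Y.fml.sub τ)} :
    ofSub σ h = ofSub τ h' ↔ Prov T X.fml (Formula.eqs σ τ) := by
  have := ofSub_comp_homMk (h := h) (hθ := isFunctional_id Y) (h' := h')
  rw [idFml_iff] at this
  refine Iff.trans ?_ (this.trans (and_iff_right h))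
  rw [show homMk (idFml Y) (isFunctional_id Y) = 𝟙 Y from rfl, Category.comp_id]

/-- Morphisms out of an object are total: locally on the source they are given by terms. -/
theorem total_force (f : X ⟶ Y) {Ξ : List S.Srt} {ω ψ : Formula S Ξ} {σ : Sub S X.ctx Ξ}
    (h : Prov T ω (X.fml.sub σ))
    (H : ∀ {Θ : List S.Srt} (ε : Sub S Ξ Θ) (ω' : Formula S Θ) (τ : Sub S Y.ctx Θ),
      Prov T ω' (ω.sub ε) → ∀ (h₁ : Prov T ω' (X.fml.sub (σ.comp ε)))
        (h₂ : Prov T ω' (Y.fml.sub τ)),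
        ofSub (X := ⟨Θ, ω'⟩) (σ.comp ε) h₁ ≫ f = ofSub τ h₂ → Prov T ω' (ψ.sub ε)) :
    Prov T ω ψ := by
  obtain ⟨θ, hθ, rfl⟩ := exists_homMk f
  refine Prov.exs_force (Prov.force hθ.total h) (fun ε τ ω' h₁ h₂ => ?_)
  exact H ε ω' τ h₁ (hθ.source h₂) (hθ.target h₂) (ofSub_comp_homMk.2 h₂)

/-- A morphism is surjective if locally every element of its target has a preimage. -/
def IsSurj (f : X ⟶ Y) : Prop :=
  ∀ ⦃Ξ : List S.Srt⦄ (ω ψ : Formula S Ξ) (τ : Sub S Y.ctx Ξ), Prov T ω (Y.fml.sub τ) →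
    (∀ {Θ : List S.Srt} (ε : Sub S Ξ Θ) (ω' : Formula S Θ) (σ : Sub S X.ctx Θ),
      Prov T ω' (ω.sub ε) → ∀ (h₁ : Prov T ω' (X.fml.sub σ))
        (h₂ : Prov T ω' (Y.fml.sub (τ.comp ε))),
        ofSub (X := ⟨Θ, ω'⟩) σ h₁ ≫ f = ofSub (τ.comp ε) h₂ → Prov T ω' (ψ.sub ε)) → Prov T ω ψ

theorem isSurj_of_isIso (f : X ⟶ Y) [IsIso f] : IsSurj f := fun _ ω ψ τ h H =>
  total_force (inv f) h fun ε ω' σ h₀ h₁ h₂ e => H ε ω' σ h₀ h₂ h₁ (by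
    rw [← e, Category.assoc, IsIso.inv_hom_id, Category.comp_id])

theorem IsSurj.comp {f : X ⟶ Y} {g : Y ⟶ Z} (hf : IsSurj f) (hg : IsSurj g) :
    IsSurj (f ≫ g) := fun _ ω ψ τ h H => hg ω ψ τ h fun ε ω' σ h₀ h₁ h₂ e =>
  hf ω' _ σ h₁ fun ε' ω'' ρ h₀' h₁' h₂' e' => by
    rw [Formula.sub_sub]
    have h₃ : Prov T ω'' (ω.sub (ε.comp ε')) := h₀'.restrict_sub h₀
    have h₄ : Prov T ω'' (Z.fml.sub (τ.comp (ε.comp ε'))) := h₃.restrict_sub h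
    refine H (ε.comp ε') ω'' ρ h₃ h₁' h₄ ?_
    have e'' := congrArg (fun k => ofSub (X := ⟨_, ω''⟩) (Y := ⟨_, ω'⟩) ε' h₀' ≫ k) e
    simp only [← Category.assoc, ofSub_comp_ofSub] at e''
    rw [← Category.assoc, e', e'']
    simp only [Sub.comp_assoc]

/-- The image of a substitution: `∃ x, φ(x) ∧ τ(x) = y`. -/
def imFml {Γ Δ : List S.Srt} (τ : Sub S Δ Γ) (φ : Formula S Γ) : Formula S Δ :=
  Formula.exs Γ (.and (φ.sub (Sub.left Γ Δ))
    (Formula.eqs (τ.comp (Sub.left Γ Δ)) (Sub.right Γ Δ)))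

theorem imFml_of {Γ Δ Ξ : List S.Srt} {τ : Sub S Δ Γ} {φ : Formula S Γ} {ω : Formula S Ξ}
    {ρ : Sub S Γ Ξ} {σ : Sub S Δ Ξ} (h : Prov T ω (φ.sub ρ))
    (h' : Prov T ω (Formula.eqs (τ.comp ρ) σ)) : Prov T ω ((imFml τ φ).sub σ) := by
  refine Prov.exs_of ρ _ (Prov.and_intro ?_ ?_)
  · rwa [Formula.sub_sub, Sub.left_append]
  · rwa [Formula.sub_eqs, Sub.comp_assoc, Sub.left_append, Sub.right_append]

theorem imFml_force {Γ Δ Ξ : List S.Srt} {τ : Sub S Δ Γ} {φ : Formula S Γ} {ω ψ : Formula S Ξ}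
    {σ : Sub S Δ Ξ} (h : Prov T ω ((imFml τ φ).sub σ))
    (H : ∀ {Θ : List S.Srt} (ε : Sub S Ξ Θ) (ω' : Formula S Θ) (ρ : Sub S Γ Θ),
      Prov T ω' (ω.sub ε) → Prov T ω' (φ.sub ρ) →
        Prov T ω' (Formula.eqs (τ.comp ρ) (σ.comp ε)) → Prov T ω' (ψ.sub ε)) : Prov T ω ψ := by
  refine Prov.exs_force h fun ε ρ ω' h₀ h₁ => H ε ω' ρ h₀ ?_ ?_
  · simpa only [Formula.sub_sub, Sub.left_append] using h₁.and_fst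
  · have := h₁.and_snd
    rwa [Formula.sub_eqs, Sub.comp_assoc, Sub.left_append, Sub.right_append] at this

/-- Surjectivity need only be tested at the generic element of `Y`, where it is the single sequent
stating that `Y` is contained in the image. -/
theorem isSurj_ofSub {τ : Sub S Y.ctx X.ctx} {h : Prov T X.fml (Y.fml.sub τ)} :
    IsSurj (ofSub τ h) ↔ Prov T Y.fml (imFml τ X.fml) := by
  refine ⟨fun H => H Y.fml _ (Sub.id _) Prov.sub_id fun ε ω' σ h₀ h₁ h₂ e => ?_,
    fun H Ξ ω ψ σ h₀ H' => imFml_force (h₀.cut (H.subst σ)) fun ε ω' ρ h₁ h₂ h₃ => ?_⟩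
  · rw [ofSub_comp_ofSub, ofSub_eq_iff] at e
    exact imFml_of h₁ e
  · exact H' ε ω' ρ h₁ h₂ (h₁.restrict_sub h₀) (by
      rw [ofSub_comp_ofSub, ofSub_eq_iff]; exact h₃)

/-- Descent along a surjective substitution. -/
theorem exists_desc_ofSub {τ : Sub S Y.ctx X.ctx} {h : Prov T X.fml (Y.fml.sub τ)}
    (hτ : IsSurj (ofSub τ h)) {κ : Sub S W.ctx X.ctx} {h' : Prov T X.fml (W.fml.sub κ)}
    (H : ∀ {V : SynCat T} (a b : V ⟶ X), a ≫ ofSub τ h = b ≫ ofSub τ h →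
      a ≫ ofSub κ h' = b ≫ ofSub κ h') : ∃ d : Y ⟶ W, ofSub τ h ≫ d = ofSub κ h' := by
  have key : ∀ {Ξ : List S.Srt} {ω : Formula S Ξ} {ρ ρ' : Sub S X.ctx Ξ},
      Prov T ω (X.fml.sub ρ) → Prov T ω (X.fml.sub ρ') →
      Prov T ω (Formula.eqs (τ.comp ρ) (τ.comp ρ')) →
      Prov T ω (Formula.eqs (κ.comp ρ) (κ.comp ρ')) := fun {Ξ ω ρ ρ'} h₁ h₂ h₃ => by
    have := H (V := ⟨Ξ, ω⟩) (ofSub ρ h₁) (ofSub ρ' h₂) (by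
      rw [ofSub_comp_ofSub, ofSub_comp_ofSub, ofSub_eq_iff]; exact h₃)
    rwa [ofSub_comp_ofSub, ofSub_comp_ofSub, ofSub_eq_iff] at this
  -- The descended morphism relates `y` to `w` when some `x` has `τ x = y` and `κ x = w`.
  -- Surjectivity of `τ` makes this total, and the compatibility `key` makes it single-valued.
  have hf : IsFunctional Y W (imFml (Sub.append κ τ) X.fml) := by
    refine isFunctional_of_force (fun ω σ ρ h₀ => ⟨?_, ?_⟩) (fun ω ρ h₀ => ?_)
      (fun ω σ σ' ρ h₀ h₁ => ?_)
    · refine imFml_force h₀ fun ε ω' α h₁ h₂ h₃ => ?_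
      rw [Sub.append_comp, Sub.append_comp, Prov.eqs_append] at h₃
      rw [Formula.sub_sub]
      exact Prov.sub_eqs _ h₃.2 (h₂.restrict_sub h)
    · refine imFml_force h₀ fun ε ω' α h₁ h₂ h₃ => ?_
      rw [Sub.append_comp, Sub.append_comp, Prov.eqs_append] at h₃
      rw [Formula.sub_sub]
      exact Prov.sub_eqs _ h₃.1 (h₂.restrict_sub h')
    · refine imFml_force (h₀.cut ((isSurj_ofSub.1 hτ).subst ρ)) fun ε ω' α h₁ h₂ h₃ => ?_
      rw [Formula.sub_sub]
      refine Prov.exs_of (κ.comp α) _ (imFml_of h₂ ?_)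
      rw [Sub.append_comp, Prov.eqs_append]
      exact ⟨Prov.eqs_refl _, h₃⟩
    · refine imFml_force h₀ fun ε ω' α h₂ h₃ h₄ => ?_
      refine imFml_force (h₂.restrict_sub h₁) fun ε' ω'' α' h₅ h₆ h₇ => ?_
      have h₈ := h₅.restrict_eqs h₄
      simp only [Sub.append_comp, Prov.eqs_append] at h₇ h₈
      rw [Formula.sub_eqs, Formula.sub_eqs]
      refine Prov.eqs_trans (Prov.eqs_symm h₈.1) (Prov.eqs_trans ?_ h₇.1)
      rw [Sub.comp_assoc]
      refine key (h₅.restrict_sub h₃) h₆ ?_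
      rw [← Sub.comp_assoc]
      exact Prov.eqs_trans h₈.2 (Prov.eqs_symm h₇.2)
  refine ⟨homMk _ hf, ofSub_comp_homMk.2 (imFml_of Prov.sub_id ?_)⟩
  rw [Sub.comp_id]
  exact Prov.eqs_refl _

end SynCat

end SyntacticSubstitution

/-! ### The syntactic category is regular -/

namespace SynCat

variable {S : Signature.{w}} {T : Theory S} {X Y Z W V : SynCat T}

/-- Two relations that agree after `f` are compared at an element of `Y`; locally it has a preimage,
where the equation can be used. -/
theorem IsSurj.epi {f : X ⟶ Y} (hf : IsSurj f) : Epi f where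
  left_cancellation {W} g k e := by
    obtain ⟨θ, hθ, rfl⟩ := exists_homMk g
    obtain ⟨η, hη, rfl⟩ := exists_homMk k
    refine homMk_eq_of_prov (prov_of_force fun {Ξ} ω τ σ h => ?_)
    refine hf ω _ σ (hθ.source h) fun ε ω' x h₀ h₁ h₂ e' => ?_
    have h₃ := h₀.restrict_sub h
    rw [Sub.append_comp] at h₃
    have h₄ := hθ.target h₃
    rw [Formula.sub_sub, Sub.append_comp, ← ofSub_comp_homMk (W := ⟨_, ω'⟩) (h := h₂) (hθ := hη)
      (h' := h₄), ← e', Category.assoc, ← e, ← Category.assoc, e', ofSub_comp_homMk]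
    exact h₃

/-- A substitution that is surjective and injective is an isomorphism. -/
theorem isIso_ofSub {τ : Sub S Y.ctx X.ctx} {h : Prov T X.fml (Y.fml.sub τ)}
    (hτ : Prov T Y.fml (imFml τ X.fml))
    (H : ∀ {Ξ : List S.Srt} (ω : Formula S Ξ) (ρ ρ' : Sub S X.ctx Ξ), Prov T ω (X.fml.sub ρ) →
      Prov T ω (X.fml.sub ρ') → Prov T ω (Formula.eqs (τ.comp ρ) (τ.comp ρ')) →
        Prov T ω (Formula.eqs ρ ρ')) : IsIso (ofSub τ h) := by
  have hs := isSurj_ofSub (h := h).2 hτ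
  have hm : ∀ {V : SynCat T} (a b : V ⟶ X), a ≫ ofSub τ h = b ≫ ofSub τ h → a = b := by
    intro V a b e
    obtain ⟨θ, hθ, rfl⟩ := exists_homMk a
    obtain ⟨η, hη, rfl⟩ := exists_homMk b
    refine homMk_eq_of_prov (prov_of_force fun {Ξ} ω ρ σ h₀ => ?_)
    refine total_force (homMk η hη) (hθ.source h₀) fun ε ω' ρ' h₁ h₂ h₃ e₁ => ?_
    have h₄ := h₁.restrict_sub h₀
    rw [Sub.append_comp] at h₄
    have e₂ := (ofSub_comp_homMk (W := ⟨_, ω'⟩) (h := h₂) (hθ := hθ) (h' := hθ.target h₄)).2 h₄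
    have e₃ := congrArg (fun k => ofSub (X := ⟨_, ω'⟩) _ h₂ ≫ k) e
    simp only [← Category.assoc, e₁, e₂, ofSub_comp_ofSub] at e₃
    have h₅ := (ofSub_eq_iff (X := ⟨_, ω'⟩) (h := hθ.target h₄) (h' := h₃)).2
      (H ω' _ _ (hθ.target h₄) h₃ (ofSub_eq_iff.1 e₃))
    rw [Formula.sub_sub, Sub.append_comp, ← ofSub_comp_homMk (W := ⟨_, ω'⟩) (h := h₂) (hθ := hη)
      (h' := hθ.target h₄), e₁, h₅]
  -- By injectivity `hm` the identity of `X` respects the identifications made by `τ`; its descent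
  -- is the inverse.
  obtain ⟨d, hd⟩ := exists_desc_ofSub hs (κ := Sub.id X.ctx) (W := X) (h' := Prov.sub_id)
    (fun a b e => by rw [hm a b e])
  rw [ofSub_id] at hd
  have := hs.epi
  exact ⟨d, hd, by rw [← cancel_epi (ofSub τ h), reassoc_of% hd, Category.comp_id]⟩

/-- The property of being given by a substitution. -/
def IsSub (f : X ⟶ Y) : Prop := ∃ σ h, f = ofSub σ h

theorem IsSub.comp {f : X ⟶ Y} {g : Y ⟶ Z} (hf : IsSub f) (hg : IsSub g) : IsSub (f ≫ g) := by
  obtain ⟨σ, h, rfl⟩ := hf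
  obtain ⟨τ, h', rfl⟩ := hg
  exact ⟨_, _, ofSub_comp_ofSub _ _ _ _⟩

/-- Up to isomorphism, every morphism is given by a substitution. -/
theorem exists_isIso_isSub (f : X ⟶ Y) :
    ∃ (Z : SynCat T) (p : Z ⟶ X), IsIso p ∧ IsSub p ∧ IsSub (p ≫ f) := by
  obtain ⟨θ, hθ, rfl⟩ := exists_homMk f
  have h₀ : Prov T θ (θ.sub (Sub.append (Sub.left Y.ctx X.ctx) (Sub.right Y.ctx X.ctx))) := by
    rw [Sub.append_left_right]; exact Prov.sub_id
  -- The graph `θ` is itself taken as the new source. Its projection to `X` is invertible since `θ`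
  -- is functional, and `f` becomes the projection to `Y`.
  refine ⟨⟨_, θ⟩, ofSub (Sub.right _ _) (hθ.source h₀), isIso_ofSub ?_ ?_, ⟨_, _, rfl⟩,
    Sub.left _ _, hθ.target h₀, ofSub_comp_homMk.2 h₀⟩
  · refine Prov.exs_force (hθ.total.cut Prov.sub_id) fun ε τ ω' h₁ h₂ => ?_
    refine imFml_of h₂ ?_
    rw [Sub.right_append]
    exact Prov.eqs_refl _
  · intro Ξ ω ρ ρ' h₁ h₂ h₃
    rw [← Sub.append_eta ρ] at h₁ ⊢
    rw [← Sub.append_eta ρ'] at h₂ ⊢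
    exact Prov.eqs_append.2 ⟨hθ.eqs (Prov.eqs_force_right θ _ h₃ h₁) h₂, h₃⟩

theorem exists_isIso_isSub₂ (f : X ⟶ Y) (g : X ⟶ Z) :
    ∃ (W : SynCat T) (p : W ⟶ X), IsIso p ∧ IsSub p ∧ IsSub (p ≫ f) ∧ IsSub (p ≫ g) := by
  obtain ⟨V, p, hp, hs, hf⟩ := exists_isIso_isSub f
  obtain ⟨W, q, hq, hs', hg⟩ := exists_isIso_isSub (p ≫ g)
  exact ⟨W, q ≫ p, inferInstance, hs'.comp hs, by rw [Category.assoc]; exact hs'.comp hf,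
    by rwa [Category.assoc]⟩

/-- The terminal object of the syntactic category. -/
def isTerminalTop : IsTerminal (⟨[], .top⟩ : SynCat T) :=
  .ofUniqueHom (fun X => ofSub Sub.nil (Prov.top_intro _)) fun X f => by
    obtain ⟨Z, p, _, ⟨σ, h, rfl⟩, ⟨τ, h', e⟩⟩ := exists_isIso_isSub f
    rw [← cancel_epi (ofSub σ h), e]
    exact (ofSub_eq_iff.2 (Prov.top_intro _)).trans
      (ofSub_comp_ofSub (Z := ⟨[], .top⟩) σ h Sub.nil (Prov.top_intro _)).symm

/-- The pullback of two substitutions. -/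
abbrev pb {X Y Z : SynCat T} (σ : Sub S Z.ctx X.ctx) (τ : Sub S Z.ctx Y.ctx) : SynCat T :=
  ⟨X.ctx ++ Y.ctx, .and (X.fml.sub (Sub.left X.ctx Y.ctx)) (.and
    (Y.fml.sub (Sub.right X.ctx Y.ctx))
    (Formula.eqs (σ.comp (Sub.left X.ctx Y.ctx)) (τ.comp (Sub.right X.ctx Y.ctx))))⟩

theorem pb_iff {σ : Sub S Z.ctx X.ctx} {τ : Sub S Z.ctx Y.ctx} {Ξ : List S.Srt}
    {ω : Formula S Ξ} {α : Sub S X.ctx Ξ} {β : Sub S Y.ctx Ξ} :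
    Prov T ω ((pb (T := T) σ τ).fml.sub (Sub.append α β)) ↔ Prov T ω (X.fml.sub α) ∧
      Prov T ω (Y.fml.sub β) ∧ Prov T ω (Formula.eqs (σ.comp α) (τ.comp β)) := by
  simp only [Formula.sub, Formula.sub_sub, Formula.sub_eqs, Sub.comp_assoc, Sub.left_append,
    Sub.right_append]
  exact ⟨fun h => ⟨h.and_fst, h.and_snd.and_fst, h.and_snd.and_snd⟩,
    fun h => Prov.and_intro h.1 (Prov.and_intro h.2.1 h.2.2)⟩

/-- Any two morphisms with a common source become substitutions on one isomorphic copy of it. There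
a cone is a pair of substitutions, concatenated by `Sub.append`, and uniqueness is componentwise
equality. -/
theorem isPullback_pb {σ : Sub S Z.ctx X.ctx} {τ : Sub S Z.ctx Y.ctx}
    (h : Prov T X.fml (Z.fml.sub σ)) (h' : Prov T Y.fml (Z.fml.sub τ)) :
    IsPullback (ofSub (X := pb σ τ) (Y := X) (Sub.left X.ctx Y.ctx) (Prov.and_left _ _))
      (ofSub (X := pb σ τ) (Y := Y) (Sub.right X.ctx Y.ctx)
        ((Prov.and_right _ _).cut (Prov.and_left _ _)))
      (ofSub σ h) (ofSub τ h') := by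
  refine ⟨⟨?_⟩, ⟨?_⟩⟩
  · rw [ofSub_comp_ofSub, ofSub_comp_ofSub, ofSub_eq_iff]
    exact (Prov.and_right _ _).and_snd
  have hl : ∀ s : PullbackCone (ofSub σ h) (ofSub τ h'), ∃ l : s.pt ⟶ pb σ τ,
      l ≫ ofSub (X := pb σ τ) (Y := X) (Sub.left X.ctx Y.ctx) (Prov.and_left _ _) = s.fst ∧
      l ≫ ofSub (X := pb σ τ) (Y := Y) (Sub.right X.ctx Y.ctx)
        ((Prov.and_right _ _).cut (Prov.and_left _ _)) = s.snd := fun s => by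
    obtain ⟨W, p, _, -, ⟨α, hα, eα⟩, ⟨β, hβ, eβ⟩⟩ := exists_isIso_isSub₂ s.fst s.snd
    have e := congrArg (p ≫ ·) s.condition
    simp only [← Category.assoc, eα, eβ, ofSub_comp_ofSub, ofSub_eq_iff] at e
    refine ⟨inv p ≫ ofSub (X := W) (Sub.append α β) (pb_iff.2 ⟨hα, hβ, e⟩), ?_, ?_⟩
    · simp only [Category.assoc, ofSub_comp_ofSub, Sub.left_append]
      rw [IsIso.inv_comp_eq, eα]
    · simp only [Category.assoc, ofSub_comp_ofSub, Sub.right_append]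
      rw [IsIso.inv_comp_eq, eβ]
  choose l hl₁ hl₂ using hl
  refine PullbackCone.IsLimit.mk _ l hl₁ hl₂ fun s m h₁ h₂ => ?_
  rw [← hl₁] at h₁
  rw [← hl₂] at h₂
  generalize l s = k at h₁ h₂
  obtain ⟨W, p, _, -, ⟨α, hα, eα⟩, ⟨β, hβ, eβ⟩⟩ := exists_isIso_isSub₂ m k
  have h₁ := congrArg (p ≫ ·) h₁
  have h₂ := congrArg (p ≫ ·) h₂
  simp only [← Category.assoc, eα, eβ, ofSub_comp_ofSub, ofSub_eq_iff] at h₁ h₂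
  rw [← cancel_epi p, eα, eβ, ofSub_eq_iff, ← Sub.append_eta α, ← Sub.append_eta β,
    Prov.eqs_append]
  exact ⟨h₁, h₂⟩

/-- Every cospan is isomorphic to a cospan of substitutions. -/
theorem exists_isPullback_pb (f : X ⟶ Z) (g : Y ⟶ Z) : ∃ (X' Y' : SynCat T) (p : X' ⟶ X)
    (q : Y' ⟶ Y) (σ : Sub S Z.ctx X'.ctx) (h : Prov T X'.fml (Z.fml.sub σ))
    (τ : Sub S Z.ctx Y'.ctx) (h' : Prov T Y'.fml (Z.fml.sub τ)), IsIso p ∧ IsIso q ∧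
    p ≫ f = ofSub σ h ∧ q ≫ g = ofSub τ h' := by
  obtain ⟨X', p, hp, -, ⟨σ, h, e⟩⟩ := exists_isIso_isSub f
  obtain ⟨Y', q, hq, -, ⟨τ, h', e'⟩⟩ := exists_isIso_isSub g
  exact ⟨X', Y', p, q, σ, h, τ, h', hp, hq, e, e'⟩

theorem isPullback_of_isIso {C : Type u} [Category.{v} C] {P X Y Z X' Y' : C} {a : P ⟶ X'}
    {b : P ⟶ Y'} {f : X ⟶ Z} {g : Y ⟶ Z} {f' : X' ⟶ Z} {g' : Y' ⟶ Z} (h : IsPullback a b f' g')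
    {p : X' ⟶ X} {q : Y' ⟶ Y} [IsIso p] [IsIso q] (e : p ≫ f = f') (e' : q ≫ g = g') :
    IsPullback (a ≫ p) (b ≫ q) f g :=
  IsPullback.of_iso h (Iso.refl _) (asIso p) (asIso q) (Iso.refl _) (by simp) (by simp)
    (by simp [e]) (by simp [e'])

instance : HasFiniteLimits (SynCat T) := by
  have : HasTerminal (SynCat T) := isTerminalTop.hasTerminal
  have : HasPullbacks (SynCat T) := by
    have : ∀ {X Y Z : SynCat T} {f : X ⟶ Z} {g : Y ⟶ Z}, HasLimit (cospan f g) :=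
      fun {X Y Z f g} => by
        obtain ⟨X', Y', p, q, σ, h, τ, h', _, _, e, e'⟩ := exists_isPullback_pb f g
        exact (isPullback_of_isIso (isPullback_pb h h') e e').hasPullback
    exact hasPullbacks_of_hasLimit_cospan _
  exact hasFiniteLimits_of_hasTerminal_and_pullbacks

/-- An element of `Y` has an image in `Z`, which lifts locally to `X`. The resulting pair is a
morphism into `P`; one more localization by `total_force` makes it a substitution. -/
theorem IsSurj.of_isPullback {P : SynCat T} {p : P ⟶ X} {q : P ⟶ Y} {f : X ⟶ Z} {g : Y ⟶ Z}
    (h : IsPullback p q f g) (hf : IsSurj f) : IsSurj q := fun Ξ ω ψ τ h₀ H => by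
  refine total_force g h₀ fun ε ω' ζ h₁ h₂ h₃ e₁ => ?_
  refine hf ω' _ ζ h₃ fun ε' ω'' x h₄ h₅ h₆ e₂ => ?_
  have e₃ : ofSub (X := ⟨_, ω''⟩) x h₅ ≫ f =
      (ofSub (X := ⟨_, ω''⟩) (Y := ⟨_, ω'⟩) ε' h₄ ≫ ofSub _ h₂) ≫ g := by
    rw [e₂, Category.assoc, e₁, ofSub_comp_ofSub]
  refine total_force (X := ⟨_, ω''⟩) (h.lift _ _ e₃) (ω := ω'') Prov.sub_id
    fun ε'' ω₃ ρ h₇ h₈ h₉ e₄ => ?_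
  have e₅ := congrArg (· ≫ q) e₄
  simp only [Category.assoc, h.lift_snd, ofSub_comp_ofSub] at e₅
  simp only [Formula.sub_sub]
  have h₁₀ : Prov T ω₃ (ω.sub ((ε.comp ε').comp ε'')) :=
    h₇.restrict_sub (h₄.restrict_sub h₁)
  refine H _ ω₃ ρ h₁₀ h₉ (h₁₀.restrict_sub h₀) ?_
  rw [← e₅]
  simp only [Sub.comp_assoc, Sub.id_comp]

/-- After replacing the source so that both `f` and a competing cofork are substitutions, descent is
`exists_desc_ofSub`. -/
theorem IsSurj.isRegularEpi {f : X ⟶ Y} (hf : IsSurj f) : IsRegularEpi f := by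
  have hk := IsPullback.of_hasPullback f f
  have := hf.epi
  have hd : ∀ s : Cofork (pullback.fst f f) (pullback.snd f f), ∃ d, f ≫ d = s.π := fun s => by
    obtain ⟨Z, p, hp, -, ⟨τ, h, e⟩, ⟨κ, h', e'⟩⟩ := exists_isIso_isSub₂ f s.π
    obtain ⟨d, hd⟩ := exists_desc_ofSub (h := h) (h' := h')
      (by rw [← e]; exact (isSurj_of_isIso p).comp hf) (fun a b hab => by
        rw [← e, ← e', ← Category.assoc, ← Category.assoc] at *
        rw [← hk.lift_fst _ _ hab, Category.assoc, s.condition, hk.lift_snd_assoc])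
    exact ⟨d, by rw [← cancel_epi p, ← Category.assoc, e, hd, e']⟩
  choose d hd using hd
  exact ⟨⟨⟨_, _, _, hk.w, Cofork.IsColimit.mk _ d hd fun s m hm => by
    rw [← cancel_epi f, hd]; exact hm⟩⟩⟩

/-- Image factorizations in the syntactic category. -/
theorem exists_isSurj_mono (f : X ⟶ Y) :
    ∃ (I : SynCat T) (e : X ⟶ I) (m : I ⟶ Y), IsSurj e ∧ Mono m ∧ e ≫ m = f := by
  obtain ⟨Z, p, hp, -, ⟨τ, h, e⟩⟩ := exists_isIso_isSub f
  have h₁ : Prov T (imFml τ Z.fml) (Y.fml.sub (Sub.id _)) :=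
    imFml_force (Prov.sub_id (T := T)) fun ε ω' ρ h₁ h₂ h₃ => by
      rw [Formula.sub_id]; exact Prov.sub_eqs _ h₃ (h₂.restrict_sub h)
  have h₂ : Prov T Z.fml ((imFml τ Z.fml).sub τ) := imFml_of Prov.sub_id (by
    rw [Sub.comp_id]; exact Prov.eqs_refl _)
  refine ⟨⟨Y.ctx, imFml τ Z.fml⟩, inv p ≫ ofSub τ h₂, ofSub (Sub.id _) h₁,
    (isSurj_of_isIso _).comp (isSurj_ofSub.2 (Prov.refl _)), ⟨fun {V} a b hab => ?_⟩, ?_⟩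
  · obtain ⟨W, q, _, -, ⟨α, hα, eα⟩, ⟨β, hβ, eβ⟩⟩ := exists_isIso_isSub₂ a b
    have hab := congrArg (q ≫ ·) hab
    simp only [← Category.assoc, eα, eβ, ofSub_comp_ofSub, ofSub_eq_iff] at hab
    rw [← cancel_epi q, eα, eβ, ofSub_eq_iff]
    exact hab
  · rw [Category.assoc, ofSub_comp_ofSub, IsIso.inv_comp_eq, e]; rfl

/-- For the converse, the monic part of the syntactic image factorization of a regular epimorphism
is a strong epimorphism, hence invertible. Pullback stability of regular epimorphisms then reduces
to that of surjections. -/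
theorem isSurj_iff_isRegularEpi {f : X ⟶ Y} : IsSurj f ↔ IsRegularEpi f := by
  refine ⟨IsSurj.isRegularEpi, fun hf => ?_⟩
  obtain ⟨I, e, m, he, hm, rfl⟩ := exists_isSurj_mono f
  have : IsIso m := by
    have : IsRegularEpi (e ≫ m) := hf
    have : StrongEpi m := strongEpi_of_strongEpi e m
    exact isIso_of_mono_of_strongEpi m
  exact he.comp (isSurj_of_isIso m)

instance regular : Regular (SynCat T) where
  hasCoequalizer_of_isKernelPair {X Y Z f g₁ g₂} h := by
    obtain ⟨I, e, m, he, hm, rfl⟩ := exists_isSurj_mono f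
    have := he.isRegularEpi
    exact ⟨⟨_, (IsKernelPair.cancel_right_of_mono h).toCoequalizer'⟩⟩
  regularEpiIsStableUnderBaseChange := ⟨fun h hg =>
    (IsSurj.of_isPullback h (isSurj_iff_isRegularEpi.2 hg)).isRegularEpi⟩

end SynCat

/-! ### Interpretation of contexts and substitutions -/

section Contexts

variable {S : Signature.{w}} {E : Type u'} [Category.{v'} E] [HasFiniteLimits E]

/-- The first component of an element of a nonempty context. -/
noncomputable def ctxHd (M : S.Srt → E) (s : S.Srt) (Γ : List S.Srt) : ctxObj M (s :: Γ) ⟶ M s :=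
  prod.fst

/-- The remaining components of an element of a nonempty context. -/
noncomputable def ctxTl (M : S.Srt → E) (s : S.Srt) (Γ : List S.Srt) :
    ctxObj M (s :: Γ) ⟶ ctxObj M Γ :=
  prod.snd

/-- Extend an element of a context by one component. -/
noncomputable def ctxCons (M : S.Srt → E) {A : E} {s : S.Srt} {Γ : List S.Srt} (x : A ⟶ M s)
    (y : A ⟶ ctxObj M Γ) : A ⟶ ctxObj M (s :: Γ) :=
  prod.lift x y

section

variable (M : S.Srt → E) {A : E} {s : S.Srt} {Γ : List S.Srt}

@[simp]
theorem ctxCons_hd (x : A ⟶ M s) (y : A ⟶ ctxObj M Γ) : ctxCons M x y ≫ ctxHd M s Γ = x :=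
  prod.lift_fst _ _

@[simp]
theorem ctxCons_tl (x : A ⟶ M s) (y : A ⟶ ctxObj M Γ) : ctxCons M x y ≫ ctxTl M s Γ = y :=
  prod.lift_snd _ _

@[simp]
theorem ctxCons_tl_assoc (x : A ⟶ M s) (y : A ⟶ ctxObj M Γ) {B : E} (k : ctxObj M Γ ⟶ B) :
    ctxCons M x y ≫ ctxTl M s Γ ≫ k = y ≫ k := by
  rw [← Category.assoc, ctxCons_tl]

variable {M} in
theorem ctxCons_ext {a b : A ⟶ ctxObj M (s :: Γ)} (h₁ : a ≫ ctxHd M s Γ = b ≫ ctxHd M s Γ)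
    (h₂ : a ≫ ctxTl M s Γ = b ≫ ctxTl M s Γ) : a = b :=
  Limits.prod.hom_ext h₁ h₂

@[simp]
theorem ctxProj_zero : ctxProj M (.zero : Var (s :: Γ) s) = ctxHd M s Γ := rfl

@[simp]
theorem ctxProj_succ {r : S.Srt} (x : Var Γ r) :
    ctxProj M (.succ x : Var (s :: Γ) r) = ctxTl M s Γ ≫ ctxProj M x := rfl

theorem ctxLift_cons (m : ∀ r, Var (s :: Γ) r → (A ⟶ M r)) :
    ctxLift M m = ctxCons M (m _ .zero) (ctxLift M (fun r x => m r x.succ)) := rfl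

@[simp]
theorem ctxMap_hd {M N : S.Srt → E} (h : ∀ s, M s ⟶ N s) :
    ctxMap h (s :: Γ) ≫ ctxHd N s Γ = ctxHd M s Γ ≫ h s :=
  prod.map_fst _ _

@[simp]
theorem ctxMap_tl {M N : S.Srt → E} (h : ∀ s, M s ⟶ N s) :
    ctxMap h (s :: Γ) ≫ ctxTl N s Γ = ctxTl M s Γ ≫ ctxMap h Γ :=
  prod.map_snd _ _

end

@[simp]
theorem ctxLift_ctxProj (M : S.Srt → E) {A : E} {Γ : List S.Srt}
    (m : ∀ s, Var Γ s → (A ⟶ M s)) {s : S.Srt} (x : Var Γ s) :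
    ctxLift M m ≫ ctxProj M x = m s x := by
  induction x with
  | zero => rw [ctxLift_cons, ctxProj_zero, ctxCons_hd]
  | succ x ih => rw [ctxLift_cons, ctxProj_succ, ctxCons_tl_assoc, ih]

theorem ctx_hom_ext (M : S.Srt → E) {A : E} {Γ : List S.Srt} {a b : A ⟶ ctxObj M Γ}
    (h : ∀ s (x : Var Γ s), a ≫ ctxProj M x = b ≫ ctxProj M x) : a = b := by
  induction Γ with
  | nil => exact Subsingleton.elim (α := A ⟶ ⊤_ E) _ _
  | cons s Γ ih =>
    refine ctxCons_ext (h s .zero) (ih fun s x => ?_)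
    rw [Category.assoc, Category.assoc]
    exact h s x.succ

theorem comp_ctxLift (M : S.Srt → E) {A B : E} {Γ : List S.Srt} (k : B ⟶ A)
    (m : ∀ s, Var Γ s → (A ⟶ M s)) : k ≫ ctxLift M m = ctxLift M (fun s x => k ≫ m s x) :=
  ctx_hom_ext M fun s x => by simp

@[simp]
theorem ctxMap_ctxProj {M N : S.Srt → E} (h : ∀ s, M s ⟶ N s) {Γ : List S.Srt} {s : S.Srt}
    (x : Var Γ s) : ctxMap h Γ ≫ ctxProj N x = ctxProj M x ≫ h s := by
  induction x with
  | zero => exact ctxMap_hd h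
  | succ x ih => rw [ctxProj_succ, ctxProj_succ, ← Category.assoc, ctxMap_tl, Category.assoc, ih,
      Category.assoc]

variable (M : Str S E) {Γ Δ Ξ : List S.Srt}

/-- The interpretation of a substitution. -/
noncomputable def Sub.interp (σ : Sub S Γ Δ) : ctxObj M.obj Δ ⟶ ctxObj M.obj Γ :=
  ctxLift M.obj (fun s x => (σ s x).interp M)

@[simp]
theorem Sub.interp_ctxProj (σ : Sub S Γ Δ) {s : S.Srt} (x : Var Γ s) :
    σ.interp M ≫ ctxProj M.obj x = (σ s x).interp M :=
  ctxLift_ctxProj _ _ _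

theorem Term.interp_sub (σ : Sub S Γ Δ) {s : S.Srt} (t : Term S Γ s) :
    (t.sub σ).interp M = σ.interp M ≫ t.interp M := by
  induction t with
  | var x => exact (Sub.interp_ctxProj M σ x).symm
  | app f args ih =>
    simp only [Term.sub, Term.interp, ← Category.assoc, comp_ctxLift]
    congr 2
    funext s x
    exact ih s x

theorem Sub.interp_comp (σ : Sub S Γ Δ) (τ : Sub S Δ Ξ) :
    (σ.comp τ).interp M = τ.interp M ≫ σ.interp M :=
  ctx_hom_ext _ fun s x => by
    rw [Category.assoc, Sub.interp_ctxProj, Sub.interp_ctxProj]; exact Term.interp_sub M _ _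

theorem Sub.interp_id (Γ : List S.Srt) : (Sub.id (S := S) Γ).interp M = 𝟙 _ :=
  ctx_hom_ext _ fun s x => by rw [Sub.interp_ctxProj, Category.id_comp]; rfl

theorem Sub.interp_wk (s : S.Srt) :
    (Sub.wk (S := S) (Γ := Γ) s).interp M = ctxTl M.obj s Γ :=
  ctx_hom_ext _ fun r x => by rw [Sub.interp_ctxProj]; rfl

theorem Sub.interp_cons {s : S.Srt} (t : Term S Δ s) (σ : Sub S Γ Δ) :
    (Sub.cons t σ).interp M = ctxCons M.obj (t.interp M) (σ.interp M) := rfl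

theorem Sub.interp_tail {s : S.Srt} (σ : Sub S (s :: Γ) Δ) :
    (Sub.tail σ).interp M = σ.interp M ≫ ctxTl M.obj s Γ :=
  ctx_hom_ext _ fun r x => by
    rw [Sub.interp_ctxProj, Category.assoc, ← ctxProj_succ, Sub.interp_ctxProj]; rfl

theorem Sub.interp_lift (σ : Sub S Γ Δ) (s : S.Srt) : (σ.lift s).interp M =
    ctxCons M.obj (ctxHd M.obj s Δ) (ctxTl M.obj s Δ ≫ σ.interp M) := by
  rw [Sub.lift, Sub.interp_cons, Sub.interp_comp, Sub.interp_wk]; rfl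

theorem Sub.interp_left_cons (s : S.Srt) (Δ Γ : List S.Srt) :
    (Sub.left (S := S) (s :: Δ) Γ).interp M = ctxCons M.obj (ctxHd M.obj s (Δ ++ Γ))
      (ctxTl M.obj s (Δ ++ Γ) ≫ (Sub.left Δ Γ).interp M) := by
  refine ctx_hom_ext _ fun r x => ?_
  rw [Sub.interp_ctxProj]
  cases x with
  | zero => rw [ctxProj_zero, ctxCons_hd]; rfl
  | succ x => rw [ctxProj_succ, ctxCons_tl_assoc, Category.assoc, Sub.interp_ctxProj]; rfl

theorem Sub.interp_right_cons (s : S.Srt) (Δ Γ : List S.Srt) :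
    (Sub.right (S := S) (s :: Δ) Γ).interp M =
      ctxTl M.obj s (Δ ++ Γ) ≫ (Sub.right Δ Γ).interp M := by
  refine ctx_hom_ext _ fun r x => ?_
  rw [Category.assoc, Sub.interp_ctxProj, Sub.interp_ctxProj]; rfl

theorem Sub.interp_right_nil (Γ : List S.Srt) :
    (Sub.right (S := S) [] Γ).interp M = 𝟙 (ctxObj M.obj Γ) :=
  Sub.interp_id M Γ

/-- The pairing of generalised elements of two contexts. -/
noncomputable def ctxPair {A : E} : ∀ {Δ : List S.Srt}, (A ⟶ ctxObj M.obj Δ) →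
    (A ⟶ ctxObj M.obj Γ) → (A ⟶ ctxObj M.obj (Δ ++ Γ))
  | [], _, y => y
  | s :: Δ, x, y => ctxCons M.obj (x ≫ ctxHd M.obj s Δ) (ctxPair (x ≫ ctxTl M.obj s Δ) y)

theorem ctxPair_left {A : E} (x : A ⟶ ctxObj M.obj Δ) (y : A ⟶ ctxObj M.obj Γ) :
    ctxPair M x y ≫ (Sub.left Δ Γ).interp M = x := by
  induction Δ with
  | nil => exact ctx_hom_ext _ fun s x => (nomatch x)
  | cons s Δ ih =>
    refine ctxCons_ext ?_ ?_
    · rw [Sub.interp_left_cons, Category.assoc, ctxCons_hd, ctxPair]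
      exact ctxCons_hd _ _ _
    · rw [Sub.interp_left_cons, Category.assoc, ctxCons_tl, ctxPair]
      exact (ctxCons_tl_assoc _ _ _ _).trans (ih _)

theorem ctxPair_right {A : E} (x : A ⟶ ctxObj M.obj Δ) (y : A ⟶ ctxObj M.obj Γ) :
    ctxPair M x y ≫ (Sub.right Δ Γ).interp M = y := by
  induction Δ with
  | nil => rw [Sub.interp_right_nil]; exact Category.comp_id _
  | cons t Δ ih =>
    rw [Sub.interp_right_cons]
    exact (ctxCons_tl_assoc _ _ _ _).trans (ih _)

theorem ctxPair_ext {A : E} {a b : A ⟶ ctxObj M.obj (Δ ++ Γ)}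
    (h₁ : a ≫ (Sub.left Δ Γ).interp M = b ≫ (Sub.left Δ Γ).interp M)
    (h₂ : a ≫ (Sub.right Δ Γ).interp M = b ≫ (Sub.right Δ Γ).interp M) : a = b := by
  induction Δ with
  | nil =>
    rw [Sub.interp_right_nil] at h₂
    exact (Category.comp_id a).symm.trans (h₂.trans (Category.comp_id b))
  | cons t Δ ih =>
    rw [Sub.interp_left_cons] at h₁
    rw [Sub.interp_right_cons] at h₂
    refine ctxCons_ext (Γ := Δ ++ Γ) ?_ (ih ?_ ?_)
    · simpa only [Category.assoc, ctxCons_hd] using congrArg (· ≫ ctxHd M.obj t Δ) h₁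
    · simpa only [Category.assoc, ctxCons_tl] using congrArg (· ≫ ctxTl M.obj t Δ) h₁
    · rw [Category.assoc, Category.assoc]; exact h₂

theorem comp_interp_append {A : E} (a : A ⟶ ctxObj M.obj Ξ) (τ : Sub S Δ Ξ) (σ : Sub S Γ Ξ) :
    a ≫ (Sub.append τ σ).interp M = ctxPair M (a ≫ τ.interp M) (a ≫ σ.interp M) := by
  refine ctxPair_ext M ?_ ?_
  · rw [ctxPair_left, Category.assoc, ← Sub.interp_comp, Sub.left_append]
  · rw [ctxPair_right, Category.assoc, ← Sub.interp_comp, Sub.right_append]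

theorem comp_ctxPair {A B : E} (k : B ⟶ A) (x : A ⟶ ctxObj M.obj Δ) (y : A ⟶ ctxObj M.obj Γ) :
    k ≫ ctxPair M x y = ctxPair M (k ≫ x) (k ≫ y) := by
  refine ctxPair_ext M ?_ ?_
  · rw [ctxPair_left, Category.assoc, ctxPair_left]
  · rw [ctxPair_right, Category.assoc, ctxPair_right]

variable {M} {N : Str S E}

theorem StrHom.interp_term (h : M ⟶ N) {s : S.Srt} (t : Term S Γ s) :
    t.interp M ≫ h.app s = ctxMap h.app Γ ≫ t.interp N := by
  induction t with
  | var x => exact (ctxMap_ctxProj _ _).symm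
  | app f args ih =>
    simp only [Term.interp, Category.assoc, h.comm, ← Category.assoc (ctxMap _ Γ), comp_ctxLift]
    rw [← Category.assoc]
    congr 1
    refine ctx_hom_ext _ fun s x => ?_
    rw [Category.assoc, ctxMap_ctxProj, ctxLift_ctxProj, ← Category.assoc, ctxLift_ctxProj]
    exact ih s x

theorem StrHom.interp_sub (h : M ⟶ N) (σ : Sub S Γ Δ) :
    σ.interp M ≫ ctxMap h.app Γ = ctxMap h.app Δ ≫ σ.interp N :=
  ctx_hom_ext _ fun s x => by
    rw [Category.assoc, ctxMap_ctxProj, ← Category.assoc, Sub.interp_ctxProj, Category.assoc,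
      Sub.interp_ctxProj, StrHom.interp_term]

end Contexts

/-! ### Forcing in regular categories -/

section Forcing

variable {S : Signature.{w}} {E : Type u'} [Category.{v'} E] [Regular E] (M : Str S E)
  {Γ Δ Ξ : List S.Srt} {A B : E}

/-- The generalised element `a` satisfies the formula `φ`. -/
def Forces (φ : Formula S Γ) (a : A ⟶ ctxObj M.obj Γ) : Prop := (φ.interp M).Factors a

variable {M}

theorem le_iff_forall_factors {X : E} {P Q : Subobject X} :
    P ≤ Q ↔ ∀ {A : E} (a : A ⟶ X), P.Factors a → Q.Factors a :=
  ⟨fun h _ _ ha => Subobject.factors_of_le _ h ha, fun h =>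
    Subobject.le_of_comm (Q.factorThru _ (h _ P.factors_self)) (Subobject.factorThru_arrow _ _ _)⟩

theorem Forces.comp {φ : Formula S Γ} {a : A ⟶ ctxObj M.obj Γ} (h : Forces M φ a) (k : B ⟶ A) :
    Forces M φ (k ≫ a) :=
  Subobject.factors_of_factors_right k h

/-- Truth is local: a factorization through a subobject that exists after a regular epimorphism
descends along it, because the subobject is monic. -/
theorem Forces.of_isRegularEpi {φ : Formula S Γ} {a : A ⟶ ctxObj M.obj Γ} {p : B ⟶ A}
    (hp : IsRegularEpi p) (h : Forces M φ (p ≫ a)) : Forces M φ a := by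
  have h : (φ.interp M).Factors (p ≫ a) := h
  obtain ⟨d, hd⟩ := exists_desc p ((φ.interp M).factorThru _ h) (fun x y e => by
    rw [← cancel_mono (φ.interp M).arrow, Category.assoc, Category.assoc,
      Subobject.factorThru_arrow, reassoc_of% e])
  refine (Subobject.factors_iff _ _).2 ⟨d, ?_⟩
  change d ≫ (φ.interp M).arrow = a
  rw [← cancel_epi p, reassoc_of% hd, Subobject.factorThru_arrow]

theorem forces_top (a : A ⟶ ctxObj M.obj Γ) : Forces M .top a := Subobject.top_factors _

theorem forces_eq {s : S.Srt} {t t' : Term S Γ s} {a : A ⟶ ctxObj M.obj Γ} :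
    Forces M (.eq t t') a ↔ a ≫ t.interp M = a ≫ t'.interp M :=
  equalizerSubobject_factors_iff _ _ _

theorem forces_and {φ ψ : Formula S Γ} {a : A ⟶ ctxObj M.obj Γ} :
    Forces M (.and φ ψ) a ↔ Forces M φ a ∧ Forces M ψ a :=
  Subobject.inf_factors _

/-- The map onto the image is a regular epimorphism, so an element of the image lifts on a cover; in
the other direction the local lifts descend. This is the source of the Kripke-Joyal clause for
existence. -/
theorem factors_imageSubobject {X Y : E} {f : X ⟶ Y} {a : A ⟶ Y} :
    (imageSubobject f).Factors a ↔
      ∃ (B : E) (p : B ⟶ A) (x : B ⟶ X), IsRegularEpi p ∧ x ≫ f = p ≫ a := by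
  have : IsRegularEpi (factorThruImageSubobject f) := by
    have : StrongEpi (factorThruImageSubobject f) := strongEpi_comp _ _
    exact isRegularEpi_of_strongEpi _
  constructor
  · intro h
    obtain ⟨B, p, x, hp, hx⟩ := exists_lift_of_isRegularEpi (factorThruImageSubobject f)
      ((imageSubobject f).factorThru a h)
    refine ⟨B, p, x, hp, ?_⟩
    rw [← imageSubobject_arrow_comp f, ← reassoc_of% hx, Subobject.factorThru_arrow]
  · rintro ⟨B, p, x, hp, hx⟩
    obtain ⟨d, hd⟩ := exists_desc p (x ≫ factorThruImageSubobject f) (fun y z e => by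
      rw [← cancel_mono (imageSubobject f).arrow]
      simp only [Category.assoc, imageSubobject_arrow_comp, hx]
      rw [reassoc_of% e])
    refine (Subobject.factors_iff _ _).2 ⟨d, ?_⟩
    change d ≫ (imageSubobject f).arrow = a
    rw [← cancel_epi p, reassoc_of% hd, imageSubobject_arrow_comp, hx]

theorem forces_ex {s : S.Srt} {φ : Formula S (s :: Γ)} {a : A ⟶ ctxObj M.obj Γ} :
    Forces M (.ex s φ) a ↔ ∃ (B : E) (p : B ⟶ A) (z : B ⟶ ctxObj M.obj (s :: Γ)),
      IsRegularEpi p ∧ z ≫ ctxTl M.obj s Γ = p ≫ a ∧ Forces M φ z := by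
  refine factors_imageSubobject.trans ⟨?_, ?_⟩
  · rintro ⟨B, p, x, hp, e⟩
    exact ⟨B, p, x ≫ (φ.interp M).arrow, hp, by rw [← e]; exact Category.assoc _ _ _,
      Subobject.factors_comp_arrow _⟩
  · rintro ⟨B, p, z, hp, e, h⟩
    exact ⟨B, p, (φ.interp M).factorThru z h, hp, (Category.assoc _ _ _).symm.trans
      ((congrArg (· ≫ ctxTl M.obj s Γ) (Subobject.factorThru_arrow _ _ _)).trans e)⟩

/-- In the existential case a witness over `a ≫ σ` and the element `a` combine into an element of
the extended context. This is the elementwise form of the Beck-Chevalley condition. -/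
theorem forces_sub {φ : Formula S Γ} {σ : Sub S Γ Δ} {a : A ⟶ ctxObj M.obj Δ} :
    Forces M (φ.sub σ) a ↔ Forces M φ (a ≫ σ.interp M) := by
  induction φ generalizing Δ A with
  | top => exact ⟨fun _ => forces_top _, fun _ => forces_top _⟩
  | eq t t' =>
    rw [Formula.sub, forces_eq, forces_eq, Term.interp_sub, Term.interp_sub, Category.assoc,
      Category.assoc]
  | and φ ψ h h' => rw [Formula.sub, forces_and, forces_and, h, h']
  | ex s φ ih =>
    rw [Formula.sub, forces_ex, forces_ex]
    constructor
    · rintro ⟨B, p, z, hp, e, h⟩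
      refine ⟨B, p, _, hp, ?_, ih.1 h⟩
      rw [Sub.interp_lift, Category.assoc, ctxCons_tl, ← Category.assoc, e, Category.assoc]
    · rintro ⟨B, p, z, hp, e, h⟩
      refine ⟨B, p, ctxCons M.obj (z ≫ ctxHd M.obj _ _) (p ≫ a), hp, ctxCons_tl _ _ _, ih.2 ?_⟩
      rw [Sub.interp_lift]
      convert h using 1
      refine ctxCons_ext ?_ ?_
      · rw [Category.assoc, ctxCons_hd, ctxCons_hd]
      · rw [Category.assoc, ctxCons_tl, ctxCons_tl_assoc, Category.assoc]
        exact e.symm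

theorem forces_eqs {τ τ' : Sub S Δ Γ} {a : A ⟶ ctxObj M.obj Γ} :
    Forces M (Formula.eqs τ τ') a ↔ a ≫ τ.interp M = a ≫ τ'.interp M := by
  induction Δ with
  | nil => exact ⟨fun _ => ctx_hom_ext _ fun s x => (nomatch x), fun _ => forces_top _⟩
  | cons s Δ ih =>
    rw [Formula.eqs, forces_and, forces_eq, ih]
    rw [Sub.interp_tail, Sub.interp_tail]
    refine ⟨fun h => ctxCons_ext ?_ ?_, fun h => ⟨?_, ?_⟩⟩
    · rw [← ctxProj_zero, Category.assoc, Category.assoc, Sub.interp_ctxProj, Sub.interp_ctxProj]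
      exact h.1
    · rw [Category.assoc, Category.assoc]; exact h.2
    · have := congrArg (· ≫ ctxProj M.obj .zero) h
      simpa only [Category.assoc, Sub.interp_ctxProj] using this
    · rw [← Category.assoc, h, Category.assoc]

theorem forces_exs {φ : Formula S (Δ ++ Γ)} {a : A ⟶ ctxObj M.obj Γ} :
    Forces M (Formula.exs Δ φ) a ↔ ∃ (B : E) (p : B ⟶ A) (z : B ⟶ ctxObj M.obj (Δ ++ Γ)),
      IsRegularEpi p ∧ z ≫ (Sub.right Δ Γ).interp M = p ≫ a ∧ Forces M φ z := by
  induction Δ generalizing A with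
  | nil =>
    have e := Sub.interp_right_nil M Γ
    constructor
    · intro h
      refine ⟨A, 𝟙 A, a, inferInstance, ?_, h⟩
      rw [e, Category.id_comp]
      exact Category.comp_id a
    · rintro ⟨B, p, z, hp, e', h⟩
      rw [e] at e'
      have e' : z = p ≫ a := (Category.comp_id z).symm.trans e'
      exact .of_isRegularEpi hp (e' ▸ h)
  | cons s Δ ih =>
    have e := Sub.interp_right_cons M s Δ Γ
    refine ih.trans ⟨?_, ?_⟩
    · rintro ⟨B, p, z, hp, h₁, h₂⟩
      obtain ⟨B', p', z', hp', h₁', h₂'⟩ := forces_ex.1 h₂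
      refine ⟨B', p' ≫ p, z', isRegularEpi_comp hp' hp, ?_, h₂'⟩
      rw [e]
      refine (Category.assoc z' _ _).symm.trans ?_
      rw [h₁', Category.assoc, h₁, Category.assoc]
    · rintro ⟨B, p, z, hp, h₁, h₂⟩
      refine ⟨B, p, z ≫ ctxTl M.obj s _, hp, ?_,
        forces_ex.2 ⟨B, 𝟙 B, z, inferInstance, (Category.id_comp _).symm, h₂⟩⟩
      rw [← h₁, e]; exact Category.assoc _ _ _

/-- Soundness of the sequent calculus. -/
theorem Prov.forces {T : Theory S} (hM : isModel E T M) {φ ψ : Formula S Γ} (h : Prov T φ ψ)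
    {A : E} {a : A ⟶ ctxObj M.obj Γ} (ha : Forces M φ a) : Forces M ψ a := by
  induction h generalizing A with
  | ax h => exact Subobject.factors_of_le _ (hM _ _ _ h) ha
  | refl φ => exact ha
  | cut _ _ h h' => exact h' (h ha)
  | subst σ _ h => exact forces_sub.2 (h (forces_sub.1 ha))
  | eq_refl t => exact forces_eq.2 rfl
  | eq_subst t t' φ =>
    have h := forces_and.1 ha
    have h₁ := forces_eq.1 h.1
    have h₂ := forces_sub.1 h.2
    refine forces_sub.2 ?_
    rw [Sub.interp_cons] at h₂ ⊢
    convert h₂ using 1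
    refine ctxCons_ext ?_ ?_
    · rw [Category.assoc, Category.assoc, ctxCons_hd, ctxCons_hd, h₁]
    · rw [Category.assoc, Category.assoc, ctxCons_tl, ctxCons_tl]
  | top_intro φ => exact forces_top _
  | and_left φ ψ => exact (forces_and.1 ha).1
  | and_right φ ψ => exact (forces_and.1 ha).2
  | and_intro _ _ h h' => exact forces_and.2 ⟨h ha, h' ha⟩
  | ex_elim _ h =>
    obtain ⟨B, p, z, hp, e, hz⟩ := forces_ex.1 ha
    have := forces_sub.1 (h hz)
    rw [Sub.interp_wk] at this
    exact .of_isRegularEpi hp (e ▸ this)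
  | ex_intro _ h =>
    refine forces_sub.2 (h (forces_ex.2 ⟨A, 𝟙 A, a, inferInstance, ?_, ha⟩))
    rw [Category.id_comp, Sub.interp_wk]
  | frobenius φ ψ =>
    obtain ⟨B, p, z, hp, e, hz⟩ := forces_ex.1 (forces_and.1 ha).2
    refine forces_ex.2 ⟨B, p, z, hp, e, forces_and.2 ⟨forces_sub.2 ?_, hz⟩⟩
    rw [Sub.interp_wk]
    exact e ▸ (forces_and.1 ha).1.comp p

/-- Homomorphisms of structures preserve the satisfaction of regular formulas. -/
theorem Forces.map {N : Str S E} (h : M ⟶ N) {φ : Formula S Γ} {a : A ⟶ ctxObj M.obj Γ}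
    (ha : Forces M φ a) : Forces N φ (a ≫ ctxMap h.app Γ) := by
  induction φ generalizing A with
  | top => exact forces_top _
  | eq t t' =>
    refine forces_eq.2 ?_
    rw [Category.assoc, Category.assoc, ← StrHom.interp_term, ← StrHom.interp_term,
      ← Category.assoc, forces_eq.1 ha, Category.assoc]
  | and φ ψ h h' => exact forces_and.2 ⟨h (forces_and.1 ha).1, h' (forces_and.1 ha).2⟩
  | ex s φ ih =>
    obtain ⟨B, p, z, hp, e, hz⟩ := forces_ex.1 ha
    refine forces_ex.2 ⟨B, p, _, hp, ?_, ih hz⟩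
    rw [Category.assoc, ctxMap_tl, ← Category.assoc, e, Category.assoc]

end Forcing

/-! ### The regular functor given by a model -/

section ModelFunctor

variable {S : Signature.{w}} {T : Theory S} {E : Type u'} [Category.{v'} E] [Regular E]

section Extent

variable (M : Str S E) {A : E} {X Y Z : SynCat T}

/-- The interpretation of a formula in context, as an object. -/
noncomputable def extent (X : SynCat T) : E := (X.fml.interp M : E)

/-- The inclusion of the interpretation of a formula. -/
noncomputable def extentι (X : SynCat T) : extent M X ⟶ ctxObj M.obj X.ctx :=
  (X.fml.interp M).arrow

instance (X : SynCat T) : Mono (extentι M X) := inferInstanceAs (Mono (X.fml.interp M).arrow)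

theorem forces_comp_extentι (k : A ⟶ extent M X) : Forces M X.fml (k ≫ extentι M X) :=
  Subobject.factors_comp_arrow _

theorem forces_extentι (X : SynCat T) : Forces M X.fml (extentι M X) := Subobject.factors_self _

variable {M}

theorem Forces.exists_lift {a : A ⟶ ctxObj M.obj X.ctx} (h : Forces M X.fml a) :
    ∃ k : A ⟶ extent M X, k ≫ extentι M X = a :=
  ⟨(X.fml.interp M).factorThru a h, Subobject.factorThru_arrow _ _ _⟩

theorem forces_sub_append {Γ Δ Ξ : List S.Srt} {θ : Formula S (Δ ++ Γ)} {τ : Sub S Δ Ξ}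
    {σ : Sub S Γ Ξ} {a : A ⟶ ctxObj M.obj Ξ} : Forces M (θ.sub (Sub.append τ σ)) a ↔
      Forces M θ (ctxPair M (a ≫ τ.interp M) (a ≫ σ.interp M)) := by
  rw [forces_sub, comp_interp_append]

end Extent

variable {M : Str S E} {A : E} {X Y Z : SynCat T}

theorem SynCat.IsFunctional.forces_target (hM : isModel E T M) {θ : Formula S (Y.ctx ++ X.ctx)}
    (h : SynCat.IsFunctional X Y θ) {y : A ⟶ ctxObj M.obj Y.ctx} {x : A ⟶ ctxObj M.obj X.ctx}
    (h₁ : Forces M θ (ctxPair M y x)) : Forces M Y.fml y := by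
  have := forces_sub.1 (forces_and.1 (h.typed.forces hM h₁)).2
  rwa [ctxPair_left] at this

theorem SynCat.IsFunctional.forces_unique (hM : isModel E T M) {θ : Formula S (Y.ctx ++ X.ctx)}
    (h : SynCat.IsFunctional X Y θ) {y y' : A ⟶ ctxObj M.obj Y.ctx} {x : A ⟶ ctxObj M.obj X.ctx}
    (h₁ : Forces M θ (ctxPair M y x)) (h₂ : Forces M θ (ctxPair M y' x)) : y = y' := by
  have := forces_eqs.1 (h.unique.forces hM (a := ctxPair M y' (ctxPair M y x))
    (forces_and.2 ⟨forces_sub.2 ?_, forces_sub_append.2 ?_⟩))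
  · rwa [Sub.interp_comp, ← Category.assoc, ctxPair_right, ctxPair_left, ctxPair_left] at this
  · rwa [ctxPair_right]
  · rwa [Sub.interp_comp, ← Category.assoc, ctxPair_right, ctxPair_right, ctxPair_left]

theorem SynCat.IsFunctional.forces_total (hM : isModel E T M) {θ : Formula S (Y.ctx ++ X.ctx)}
    (h : SynCat.IsFunctional X Y θ) {x : A ⟶ ctxObj M.obj X.ctx} (h₁ : Forces M X.fml x) :
    ∃ (B : E) (p : B ⟶ A) (y : B ⟶ ctxObj M.obj Y.ctx), IsRegularEpi p ∧
      Forces M θ (ctxPair M y (p ≫ x)) := by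
  obtain ⟨B, p, z, hp, e, hz⟩ := forces_exs.1 (h.total.forces hM h₁)
  refine ⟨B, p, z ≫ (Sub.left _ _).interp M, hp, ?_⟩
  rw [← e, ← comp_interp_append, Sub.append_left_right, Sub.interp_id, Category.comp_id]
  exact hz

variable (M) in
/-- The morphism `g` represents the interpretation of `f`. -/
def Represents (f : X ⟶ Y) (g : extent M X ⟶ extent M Y) : Prop :=
  ∃ θ h, f = SynCat.homMk θ h ∧ Forces M θ (ctxPair M (g ≫ extentι M Y) (extentι M X))

/-- Totality provides values only on a cover of the extent of `X`; uniqueness makes them agree on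
overlaps, so they descend. -/
theorem exists_represents (hM : isModel E T M) (f : X ⟶ Y) : ∃ g, Represents M f g := by
  obtain ⟨θ, hθ, rfl⟩ := SynCat.exists_homMk f
  obtain ⟨B, p, y, hp, h⟩ := hθ.forces_total hM (forces_extentι M X)
  obtain ⟨k, hk⟩ := (hθ.forces_target hM h).exists_lift
  obtain ⟨g, hg⟩ := exists_desc p k (fun a b e => by
    rw [← cancel_mono (extentι M Y), Category.assoc, Category.assoc, hk]
    have h₁ := h.comp a
    have h₂ := h.comp b
    rw [comp_ctxPair] at h₁ h₂
    rw [← reassoc_of% e] at h₂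
    exact hθ.forces_unique hM h₁ h₂)
  refine ⟨g, θ, hθ, rfl, .of_isRegularEpi hp ?_⟩
  rwa [comp_ctxPair, reassoc_of% hg, hk]

theorem Represents.unique (hM : isModel E T M) {f : X ⟶ Y} {g g' : extent M X ⟶ extent M Y}
    (h : Represents M f g) (h' : Represents M f g') : g = g' := by
  obtain ⟨θ, hθ, e, h⟩ := h
  obtain ⟨η, hη, e', h'⟩ := h'
  rw [← cancel_mono (extentι M Y)]
  exact hη.forces_unique hM ((SynCat.homMk_eq_iff.1 (e.symm.trans e')).1.forces hM h) h'

theorem represents_ofSub {σ : Sub S Y.ctx X.ctx} {h : Prov T X.fml (Y.fml.sub σ)}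
    {g : extent M X ⟶ extent M Y} (e : g ≫ extentι M Y = extentι M X ≫ σ.interp M) :
    Represents M (SynCat.ofSub σ h) g := by
  refine ⟨_, _, rfl, forces_and.2 ⟨forces_sub.2 ?_, forces_eqs.2 ?_⟩⟩
  · rw [ctxPair_right]; exact forces_extentι M X
  · rw [Sub.interp_comp, ← Category.assoc, ctxPair_right, ctxPair_left, e]

theorem Represents.comp {f : X ⟶ Y} {f' : Y ⟶ Z} {g : extent M X ⟶ extent M Y}
    {g' : extent M Y ⟶ extent M Z} (h : Represents M f g) (h' : Represents M f' g') :
    Represents M (f ≫ f') (g ≫ g') := by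
  obtain ⟨θ, hθ, rfl, h⟩ := h
  obtain ⟨η, hη, rfl, h'⟩ := h'
  refine ⟨_, SynCat.isFunctional_comp hθ hη, rfl, forces_exs.2 ⟨_, 𝟙 _,
    ctxPair M (g ≫ extentι M Y) (ctxPair M ((g ≫ g') ≫ extentι M Z) (extentι M X)),
    inferInstance, ?_, forces_and.2 ⟨forces_sub_append.2 ?_, forces_sub_append.2 ?_⟩⟩⟩
  · rw [ctxPair_right, Category.id_comp]
  · rwa [ctxPair_left, Sub.interp_comp, ← Category.assoc, ctxPair_right, ctxPair_right]
  · rw [ctxPair_left, Sub.interp_comp, ← Category.assoc, ctxPair_right, ctxPair_left,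
      Category.assoc, ← comp_ctxPair]
    exact h'.comp g

/-- The functor from the syntactic category given by a model. -/
noncomputable def modelFunctor (hM : isModel E T M) : SynCat T ⥤ E where
  obj X := extent M X
  map f := (exists_represents hM f).choose
  map_id X := (exists_represents hM (𝟙 X)).choose_spec.unique hM
    (represents_ofSub (σ := Sub.id X.ctx) (h := Prov.sub_id) (by
      rw [Sub.interp_id, Category.id_comp, Category.comp_id]))
  map_comp f g := (exists_represents hM (f ≫ g)).choose_spec.unique hM
    ((exists_represents hM f).choose_spec.comp (exists_represents hM g).choose_spec)

/-- The inclusion of the interpretation of a formula. -/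
noncomputable def modelι (hM : isModel E T M) (X : SynCat T) :
    (modelFunctor hM).obj X ⟶ ctxObj M.obj X.ctx :=
  extentι M X

instance (hM : isModel E T M) (X : SynCat T) : Mono (modelι hM X) :=
  inferInstanceAs (Mono (extentι M X))

theorem forces_comp_modelι (hM : isModel E T M) (k : A ⟶ (modelFunctor hM).obj X) :
    Forces M X.fml (k ≫ modelι hM X) :=
  forces_comp_extentι M k

theorem Forces.exists_lift_modelFunctor (hM : isModel E T M) {a : A ⟶ ctxObj M.obj X.ctx}
    (h : Forces M X.fml a) : ∃ k : A ⟶ (modelFunctor hM).obj X, k ≫ modelι hM X = a :=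
  h.exists_lift

theorem modelFunctor_map_ofSub (hM : isModel E T M) (σ : Sub S Y.ctx X.ctx)
    (h : Prov T X.fml (Y.fml.sub σ)) : (modelFunctor hM).map (SynCat.ofSub σ h) ≫ modelι hM Y =
      modelι hM X ≫ σ.interp M := by
  obtain ⟨k, hk⟩ := (forces_sub.1 (h.forces hM (forces_extentι M X))).exists_lift
  have e : (modelFunctor hM).map (SynCat.ofSub σ h) = k :=
    (exists_represents hM (SynCat.ofSub σ h)).choose_spec.unique hM (represents_ofSub hk)
  exact (congrArg (· ≫ modelι hM Y) e).trans hk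

theorem isPullback_modelFunctor_pb (hM : isModel E T M) {σ : Sub S Z.ctx X.ctx}
    {τ : Sub S Z.ctx Y.ctx} (h : Prov T X.fml (Z.fml.sub σ)) (h' : Prov T Y.fml (Z.fml.sub τ)) :
    IsPullback ((modelFunctor hM).map (SynCat.ofSub (X := SynCat.pb σ τ) (Y := X)
        (Sub.left X.ctx Y.ctx) (Prov.and_left _ _)))
      ((modelFunctor hM).map (SynCat.ofSub (X := SynCat.pb σ τ) (Y := Y)
        (Sub.right X.ctx Y.ctx) ((Prov.and_right _ _).cut (Prov.and_left _ _))))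
      ((modelFunctor hM).map (SynCat.ofSub σ h)) ((modelFunctor hM).map (SynCat.ofSub τ h')) := by
  refine ⟨⟨?_⟩, ⟨?_⟩⟩
  · rw [← Functor.map_comp, (SynCat.isPullback_pb h h').w, Functor.map_comp]
  have hl : ∀ s : PullbackCone ((modelFunctor hM).map (SynCat.ofSub σ h))
      ((modelFunctor hM).map (SynCat.ofSub τ h')),
      ∃ l : s.pt ⟶ (modelFunctor hM).obj (SynCat.pb σ τ),
        l ≫ modelι hM (SynCat.pb σ τ) = ctxPair M (s.fst ≫ modelι hM X) (s.snd ≫ modelι hM Y) :=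
    fun s => by
      refine Forces.exists_lift_modelFunctor (X := SynCat.pb σ τ) hM (forces_and.2 ⟨forces_sub.2 ?_,
        forces_and.2 ⟨forces_sub.2 ?_, forces_eqs.2 ?_⟩⟩)
      · rw [ctxPair_left]; exact forces_comp_modelι hM _
      · rw [ctxPair_right]; exact forces_comp_modelι hM _
      · rw [Sub.interp_comp, Sub.interp_comp, ← Category.assoc, ← Category.assoc, ctxPair_left,
          ctxPair_right, Category.assoc, Category.assoc, ← modelFunctor_map_ofSub hM σ h,
          ← modelFunctor_map_ofSub hM τ h', ← Category.assoc, ← Category.assoc, s.condition]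
  choose l hl using hl
  refine PullbackCone.IsLimit.mk _ l (fun s => (cancel_mono (modelι hM _)).1 ?_)
    (fun s => (cancel_mono (modelι hM _)).1 ?_) fun s m h₁ h₂ => (cancel_mono (modelι hM _)).1 ?_
  · rw [Category.assoc, modelFunctor_map_ofSub, ← Category.assoc, hl]
    exact ctxPair_left _ _ _
  · rw [Category.assoc, modelFunctor_map_ofSub, ← Category.assoc, hl]
    exact ctxPair_right _ _ _
  · rw [hl, ← h₁, ← h₂]
    refine ctxPair_ext M ?_ ?_
    · rw [ctxPair_left, Category.assoc, Category.assoc, modelFunctor_map_ofSub]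
    · rw [ctxPair_right, Category.assoc, Category.assoc, modelFunctor_map_ofSub]

/-- Up to isomorphism cospans and morphisms are given by substitutions, where pullbacks are solution
sets of equations and can be checked on elements. -/
theorem isRegularFunctor_modelFunctor (hM : isModel E T M) :
    isRegularFunctor (SynCat T) E (modelFunctor hM) := by
  refine ⟨preservesFiniteLimits_of_isPullback _ SynCat.isTerminalTop ⟨?_⟩ fun X Y Z f g => ?_,
    fun {X Y} f hf => ?_⟩
  · have h : ∀ A : E, Nonempty (A ⟶ (modelFunctor hM).obj (⟨[], .top⟩ : SynCat T)) := fun A =>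
      ⟨(Forces.exists_lift_modelFunctor (X := (⟨[], .top⟩ : SynCat T)) hM
        (forces_top (Γ := []) (terminal.from A))).choose⟩
    exact .ofUniqueHom (fun A => (h A).some) fun A m =>
      (cancel_mono (modelι hM _)).1 (ctx_hom_ext _ fun s x => (nomatch x))
  · obtain ⟨X', Y', p, q, σ, h, τ, h', _, _, e, e'⟩ := SynCat.exists_isPullback_pb f g
    refine ⟨_, _, _, SynCat.isPullback_of_isIso (SynCat.isPullback_pb h h') e e', ?_⟩
    rw [Functor.map_comp, Functor.map_comp]
    refine SynCat.isPullback_of_isIso (isPullback_modelFunctor_pb hM h h') ?_ ?_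
    · rw [← Functor.map_comp, e]
    · rw [← Functor.map_comp, e']
  · obtain ⟨Z, p, _, -, ⟨τ, h, e⟩⟩ := SynCat.exists_isIso_isSub f
    refine isRegularEpi_of_fac (f := (modelFunctor hM).map p) ?_
      (((modelFunctor hM).map_comp p f).symm.trans (congrArg _ e))
    -- A syntactic regular epimorphism is a provable sequent stating surjectivity; soundness turns
    -- it into local preimages in `E`.
    have hs := SynCat.isSurj_ofSub.1 (e ▸ (SynCat.isSurj_of_isIso p).comp
      (SynCat.isSurj_iff_isRegularEpi.2 hf))
    obtain ⟨B, r, z, hr, h₁, h₂⟩ := forces_exs.1 (hs.forces hM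
      (Category.id_comp (modelι hM Y) ▸ forces_comp_modelι hM (𝟙 _)))
    obtain ⟨h₃, h₄⟩ := forces_and.1 h₂
    obtain ⟨k, hk⟩ := (forces_sub.1 h₃).exists_lift_modelFunctor hM
    have h₄ := forces_eqs.1 h₄
    refine isRegularEpi_of_exists_lift (x := k) hr ((cancel_mono (modelι hM _)).1 ?_)
    rw [Category.assoc, modelFunctor_map_ofSub, ← Category.assoc, hk, Category.assoc,
      ← Sub.interp_comp, h₄, h₁]

end ModelFunctor

/-! ### The generic structure in the syntactic category -/

namespace SynCat

variable {S : Signature.{w}} {T : Theory S} {Γ Δ Ξ : List S.Srt} {X Y V : SynCat T}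

variable (T) in
/-- A context, as an object of the syntactic category. -/
abbrev ctxt (Γ : List S.Srt) : SynCat T := ⟨Γ, .top⟩

variable (T) in
/-- The morphism of contexts given by a substitution. -/
def ctxHom (σ : Sub S Γ Δ) : ctxt T Δ ⟶ ctxt T Γ := ofSub σ (Prov.top_intro _)

/-- The inclusion of an object into its context. -/
def incl (X : SynCat T) : X ⟶ ctxt T X.ctx := ofSub (Sub.id _) (Prov.top_intro _)

theorem ctxHom_comp (σ : Sub S Γ Δ) (τ : Sub S Δ Ξ) :
    ctxHom T τ ≫ ctxHom T σ = ctxHom T (σ.comp τ) :=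
  ofSub_comp_ofSub (X := ctxt T Ξ) (Y := ctxt T Δ) (Z := ctxt T Γ) τ _ σ _

theorem ctxHom_id (Γ : List S.Srt) : ctxHom T (Sub.id Γ) = 𝟙 _ := rfl

theorem ofSub_comp_incl (σ : Sub S Y.ctx X.ctx) (h : Prov T X.fml (Y.fml.sub σ)) :
    ofSub σ h ≫ incl Y = incl X ≫ ctxHom T σ :=
  (ofSub_comp_ofSub (Z := ctxt T Y.ctx) σ h (Sub.id _) (Prov.top_intro _)).trans
    (((ofSub_eq_iff (Y := ctxt T Y.ctx) (σ := (Sub.id _).comp σ) (τ := σ.comp (Sub.id _))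
      (h' := Prov.top_intro _)).2 (by
      rw [Sub.id_comp, Sub.comp_id]; exact Prov.eqs_refl _)).trans
    (ofSub_comp_ofSub (X := X) (Y := ctxt T X.ctx) (Z := ctxt T Y.ctx) (Sub.id _) (Prov.top_intro _) σ
      (Prov.top_intro _)).symm)

theorem eq_comp_incl_of_isSub {v : V ⟶ ctxt T X.ctx} (h : IsSub v) :
    ∃ σ : Sub S X.ctx V.ctx, v = incl V ≫ ctxHom T σ := by
  obtain ⟨σ, h, rfl⟩ := h
  exact ⟨σ, ((ofSub_comp_incl (Y := ctxt T X.ctx) σ h).symm.trans (Category.comp_id _)).symm⟩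

theorem incl_comp_ctxHom_eq_iff {σ τ : Sub S Γ X.ctx} :
    incl X ≫ ctxHom T σ = incl X ≫ ctxHom T τ ↔ Prov T X.fml (Formula.eqs σ τ) := by
  have h (σ : Sub S Γ X.ctx) : incl X ≫ ctxHom T σ =
      ofSub (Y := ctxt T Γ) σ (Prov.top_intro _) :=
    (ofSub_comp_incl (Y := ctxt T Γ) σ (Prov.top_intro _)).symm.trans (Category.comp_id _)
  rw [h, h]
  exact ofSub_eq_iff

instance (X : SynCat T) : Mono (incl X) := ⟨fun {V} a b h => by
  obtain ⟨W, p, _, -, ⟨α, hα, e⟩, ⟨β, hβ, e'⟩⟩ := exists_isIso_isSub₂ a b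
  have h := congrArg (p ≫ ·) h
  simp only [← Category.assoc, e, e', ofSub_comp_incl, incl_comp_ctxHom_eq_iff] at h
  rw [← cancel_epi p, e, e']
  exact ofSub_eq_iff.2 h⟩

/-- The substitution of one term. -/
def single {s : S.Srt} (t : Term S Γ s) : Sub S [s] Γ := Sub.cons t Sub.nil

theorem single_comp {s : S.Srt} (t : Term S Γ s) (σ : Sub S Γ Δ) :
    (single t).comp σ = single (t.sub σ) := by
  rw [single, Sub.cons_comp, single]
  congr 1
  funext s x
  nomatch x

theorem eq_single {s : S.Srt} (σ : Sub S [s] Γ) : σ = single (σ _ .zero) := by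
  funext r x
  cases x with
  | zero => rfl
  | succ x => nomatch x

variable (T) in
/-- The morphism given by a term. -/
def ofTerm {s : S.Srt} (t : Term S Γ s) : ctxt T Γ ⟶ ctxt T [s] := ctxHom T (single t)

theorem ctxHom_comp_ofTerm (σ : Sub S Γ Δ) {s : S.Srt} (t : Term S Γ s) :
    ctxHom T σ ≫ ofTerm T t = ofTerm T (t.sub σ) := by
  rw [ofTerm, ctxHom_comp, single_comp, ofTerm]

theorem ofTerm_var_zero (s : S.Srt) : ofTerm T (.var (.zero : Var [s] s)) = 𝟙 _ := by
  rw [ofTerm, ← ctxHom_id, eq_single (Sub.id [s])]; rfl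

theorem _root_.RegLogic.Prov.eqs_of_forall {T : Theory S} {ω : Formula S Ξ} {σ τ : Sub S Γ Ξ}
    (h : ∀ s (x : Var Γ s), Prov T ω (.eq (σ s x) (τ s x))) : Prov T ω (Formula.eqs σ τ) := by
  induction Γ with
  | nil => exact Prov.top_intro _
  | cons s Γ ih => exact Prov.and_intro (h _ _) (ih fun s x => h _ _)

theorem ctxt_hom_ext {a b : V ⟶ ctxt T Γ}
    (h : ∀ s (x : Var Γ s), a ≫ ofTerm T (.var x) = b ≫ ofTerm T (.var x)) : a = b := by
  obtain ⟨W, p, _, -, e, e'⟩ := exists_isIso_isSub₂ a b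
  obtain ⟨σ, e⟩ := eq_comp_incl_of_isSub (X := ctxt T Γ) e
  obtain ⟨τ, e'⟩ := eq_comp_incl_of_isSub (X := ctxt T Γ) e'
  rw [← cancel_epi p, e, e']
  refine incl_comp_ctxHom_eq_iff.2 (Prov.eqs_of_forall fun s x => ?_)
  have h := congrArg (p ≫ ·) (h s x)
  simp only [← Category.assoc] at h
  rw [e, e', Category.assoc, Category.assoc] at h
  simp only [ofTerm, ctxHom_comp, incl_comp_ctxHom_eq_iff] at h
  exact h.and_fst

theorem exists_ctxt_lift (m : ∀ s, Var Γ s → (V ⟶ ctxt T [s])) :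
    ∃ k : V ⟶ ctxt T Γ, ∀ s (x : Var Γ s), k ≫ ofTerm T (.var x) = m s x := by
  induction Γ with
  | nil => exact ⟨incl V ≫ ctxHom T Sub.nil, fun s x => nomatch x⟩
  | cons s Γ ih =>
    obtain ⟨k, hk⟩ := ih fun s x => m s x.succ
    obtain ⟨W, p, _, -, e, e'⟩ := exists_isIso_isSub₂ k (m s .zero)
    obtain ⟨σ, e⟩ := eq_comp_incl_of_isSub (X := ctxt T Γ) e
    obtain ⟨τ, e'⟩ := eq_comp_incl_of_isSub (X := ctxt T [s]) e'
    refine ⟨inv p ≫ incl W ≫ ctxHom T (Sub.cons (τ _ .zero) σ), fun r x => ?_⟩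
    rw [Category.assoc, IsIso.inv_comp_eq, Category.assoc, ctxHom_comp_ofTerm]
    cases x with
    | zero => rw [e', eq_single τ]; rfl
    | succ x =>
      rw [← hk, ← Category.assoc, e, Category.assoc, ctxHom_comp_ofTerm]; rfl

variable (T) in
/-- A context is the product of its sorts. -/
noncomputable def ctxtComparison (Γ : List S.Srt) :
    ctxt T Γ ⟶ ctxObj (fun s => ctxt T [s]) Γ :=
  ctxLift _ (fun _ x => ofTerm T (.var x))

instance (Γ : List S.Srt) : IsIso (ctxtComparison T Γ) := by
  obtain ⟨k, hk⟩ := exists_ctxt_lift (T := T) (Γ := Γ) (V := ctxObj (fun s => ctxt T [s]) Γ)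
    (fun s x => ctxProj _ x)
  refine ⟨k, ctxt_hom_ext fun s x => ?_, ctx_hom_ext _ fun s x => ?_⟩
  · rw [Category.assoc, hk, Category.id_comp, ctxtComparison, ctxLift_ctxProj]
  · rw [Category.assoc, ctxtComparison, ctxLift_ctxProj, hk, Category.id_comp]

variable (T) in
/-- The generic structure. -/
noncomputable def genericStr : Str S (SynCat T) where
  obj s := ctxt T [s]
  op f := inv (ctxtComparison T (S.dom f)) ≫ ofTerm T (.app f fun _ x => .var x)

end SynCat

/-! ### Comparison of contexts under functors, checked on variables. -/

section CtxIso

variable {S : Signature.{w}} {A : Type u} [Category.{v} A] [HasFiniteLimits A] {E : Type u'}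
  [Category.{v'} E] [HasFiniteLimits E]

theorem ctxIso_hom_ctxProj (F : A ⥤ E) [PreservesFiniteLimits F] (M : S.Srt → A) {Γ : List S.Srt} {s : S.Srt}
    (x : Var Γ s) :
    (ctxIso F M Γ).hom ≫ ctxProj (fun s => F.obj (M s)) x = F.map (ctxProj M x) := by
  induction x with
  | @zero Γ s =>
    refine (Category.assoc _ _ _).trans ?_
    refine (congrArg (_ ≫ ·) (prod.map_fst _ _)).trans ?_
    refine (congrArg (_ ≫ ·) (Category.comp_id _)).trans ?_
    exact prodComparison_fst F (M s) (ctxObj M Γ)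
  | @succ Γ r t x ih =>
    refine (Category.assoc _ _ _).trans ?_
    refine (congrArg (_ ≫ ·) (prod.map_snd_assoc _ _ _)).trans ?_
    refine (congrArg (_ ≫ _ ≫ ·) ih).trans ?_
    refine (Category.assoc _ _ _).symm.trans ?_
    refine (congrArg (· ≫ _) (prodComparison_snd F (M t) (ctxObj M Γ))).trans ?_
    exact (F.map_comp _ _).symm

theorem isIso_ctxMap {M N : S.Srt → E} (h : ∀ s, M s ⟶ N s) [∀ s, IsIso (h s)]
    (Γ : List S.Srt) : IsIso (ctxMap h Γ) :=
  ⟨ctxMap (fun s => inv (h s)) Γ, by simp [← ctxMap_comp, ctxMap_id],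
    by simp [← ctxMap_comp, ctxMap_id]⟩

end CtxIso

/-! ### Structures realized by regular functors -/

section Realization

variable {S : Signature.{w}} {T : Theory S} {E : Type u'} [Category.{v'} E] [Regular E]

open SynCat

/-- An identification of a structure `N` with the image of the generic structure under `G`. -/
structure Realization (G : SynCat T ⥤ E) (N : Str S E) where
  /-- the components -/
  iso : ∀ s, G.obj (ctxt T [s]) ≅ N.obj s
  /-- compatibility with the function symbols -/
  comm : ∀ f : S.Fn, ctxLift N.obj (fun s x => G.map (ofTerm T (.var x)) ≫ (iso s).hom) ≫ N.op f =
    G.map (ofTerm T (.app f fun _ x => .var x)) ≫ (iso (S.cod f)).hom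

namespace Realization

variable {G : SynCat T ⥤ E} {N : Str S E} (R : Realization G N) {Γ Δ : List S.Srt} {X Y : SynCat T}

/-- The comparison of the two interpretations of a context. -/
noncomputable def ctx (Γ : List S.Srt) : G.obj (ctxt T Γ) ⟶ ctxObj N.obj Γ :=
  ctxLift N.obj (fun s x => G.map (ofTerm T (.var x)) ≫ (R.iso s).hom)

theorem ctx_ctxProj {s : S.Srt} (x : Var Γ s) :
    R.ctx Γ ≫ ctxProj N.obj x = G.map (ofTerm T (.var x)) ≫ (R.iso s).hom :=
  ctxLift_ctxProj _ _ _

/-- The comparison is exhibited as a composite of isomorphisms: a context is the product of its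
sorts, `G` preserves this product, and the sorts are identified by `R.iso`. -/
theorem ctx_eq [PreservesFiniteLimits G] (Γ : List S.Srt) : R.ctx Γ = G.map (ctxtComparison T Γ) ≫
    (ctxIso G (fun s => ctxt T [s]) Γ).hom ≫ ctxMap (fun s => (R.iso s).hom) Γ := by
  refine ctx_hom_ext _ fun s x => ?_
  rw [ctx_ctxProj, Category.assoc, Category.assoc, ctxMap_ctxProj,
    ← Category.assoc (ctxIso _ _ _).hom, ctxIso_hom_ctxProj, ← Category.assoc, ← G.map_comp,
    ctxtComparison, ctxLift_ctxProj]

theorem isIso_ctx [PreservesFiniteLimits G] (Γ : List S.Srt) : IsIso (R.ctx Γ) := by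
  have := isIso_ctxMap (fun s => (R.iso s).hom) Γ
  rw [ctx_eq]
  infer_instance

/-- Induction on terms extends the compatibility from function symbols to all terms: the arguments
of a symbol together form a substitution, and `R.comm` handles the symbol itself. -/
theorem ctx_interp_term {s : S.Srt} (t : Term S Γ s) :
    R.ctx Γ ≫ t.interp N = G.map (ofTerm T t) ≫ (R.iso s).hom := by
  induction t with
  | var x => exact R.ctx_ctxProj x
  | app f args ih =>
    have h : R.ctx Γ ≫ ctxLift N.obj (fun s x => (args s x).interp N) =
        G.map (ctxHom T args) ≫ R.ctx (S.dom f) := ctx_hom_ext _ fun s x => by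
      rw [Category.assoc, ctxLift_ctxProj, ih, Category.assoc, ctx_ctxProj, ← Category.assoc,
        ← G.map_comp, ctxHom_comp_ofTerm]; rfl
    rw [Term.interp, ← Category.assoc, h, Category.assoc]
    refine (congrArg (_ ≫ ·) (R.comm f)).trans ?_
    rw [← Category.assoc, ← G.map_comp, ctxHom_comp_ofTerm]; rfl

theorem ctx_interp_sub (σ : Sub S Γ Δ) :
    R.ctx Δ ≫ σ.interp N = G.map (ctxHom T σ) ≫ R.ctx Γ :=
  ctx_hom_ext _ fun s x => by
    rw [Category.assoc, Sub.interp_ctxProj, ctx_interp_term, Category.assoc, ctx_ctxProj,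
      ← Category.assoc, ← G.map_comp, ctxHom_comp_ofTerm]; rfl

/-- The inclusion of the value of `G` at a formula. -/
noncomputable def emb (X : SynCat T) : G.obj X ⟶ ctxObj N.obj X.ctx :=
  G.map (incl X) ≫ R.ctx X.ctx

theorem emb_interp_sub (σ : Sub S Y.ctx X.ctx) (h : Prov T X.fml (Y.fml.sub σ)) :
    R.emb X ≫ σ.interp N = G.map (ofSub σ h) ≫ R.emb Y := by
  rw [emb, Category.assoc, ctx_interp_sub, emb, ← Category.assoc, ← Category.assoc, ← G.map_comp,
    ← G.map_comp, ofSub_comp_incl]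

theorem mono_emb [PreservesFiniteLimits G] (X : SynCat T) : Mono (R.emb X) := by
  have := R.isIso_ctx X.ctx
  exact mono_comp _ _

end Realization

end Realization

/-! ### Regular functors on the syntactic category are models -/

section Realization

variable {S : Signature.{w}} {T : Theory S} {E : Type u'} [Category.{v'} E] [Regular E]

open SynCat

theorem exists_lift_of_local {A B X Y : E} {p : B ⟶ A} (hp : IsRegularEpi p) {m : X ⟶ Y} [Mono m]
    {a : A ⟶ Y} {k : B ⟶ X} (h : k ≫ m = p ≫ a) : ∃ d : A ⟶ X, d ≫ m = a := by
  obtain ⟨d, hd⟩ := exists_desc p k fun s t e => by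
    rw [← cancel_mono m, Category.assoc, Category.assoc, h, reassoc_of% e]
  exact ⟨d, by rw [← cancel_epi p, ← Category.assoc, hd, h]⟩

/-! ### Logical connectives as limits and images in the syntactic category. -/

namespace SynCat

variable {Γ : List S.Srt}

/-- Membership in `X` may be tested after any morphism on which `v` becomes a substitution; the
graph construction supplies an isomorphism with this property. -/
theorem exists_lift_incl {V X : SynCat T} {v : V ⟶ ctxt T X.ctx}
    (H : ∀ {W : SynCat T} (p : W ⟶ V) (σ : Sub S X.ctx W.ctx), p ≫ v = incl W ≫ ctxHom T σ →
      Prov T W.fml (X.fml.sub σ)) : ∃ k : V ⟶ X, k ≫ incl X = v := by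
  obtain ⟨W, p, _, -, e⟩ := exists_isIso_isSub v
  obtain ⟨σ, e⟩ := eq_comp_incl_of_isSub e
  exact ⟨inv p ≫ ofSub σ (H p σ e), by
    rw [Category.assoc, ofSub_comp_incl, IsIso.inv_comp_eq, e]⟩

theorem incl_eq {s : S.Srt} (t t' : Term S Γ s) : incl (T := T) ⟨Γ, .eq t t'⟩ ≫ ofTerm T t =
    incl (T := T) ⟨Γ, .eq t t'⟩ ≫ ofTerm T t' :=
  incl_comp_ctxHom_eq_iff.2 (Prov.and_intro (Prov.refl _) (Prov.top_intro _))

theorem nonempty_isLimit_incl_eq {s : S.Srt} (t t' : Term S Γ s) :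
    Nonempty (IsLimit (Fork.ofι (incl (T := T) ⟨Γ, .eq t t'⟩) (incl_eq t t'))) := by
  have h (c : Fork (ofTerm T t) (ofTerm T t')) :
      ∃ k, k ≫ incl (T := T) ⟨Γ, .eq t t'⟩ = c.ι := by
    refine exists_lift_incl (X := ⟨Γ, .eq t t'⟩) fun p σ e => ?_
    have e' := c.condition
    have e' := congrArg (p ≫ ·) e'
    simp only [← Category.assoc] at e'
    rw [e, Category.assoc, Category.assoc, ctxHom_comp_ofTerm, ctxHom_comp_ofTerm] at e'
    exact (incl_comp_ctxHom_eq_iff.1 e').and_fst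
  choose k hk using h
  exact ⟨Fork.IsLimit.mk _ k hk fun c m hm => (cancel_mono (incl _)).1 (hm.trans (hk c).symm)⟩

/-- The inclusion given by a sequent. -/
def ofProv {φ ψ : Formula S Γ} (h : Prov T φ ψ) : (⟨Γ, φ⟩ : SynCat T) ⟶ ⟨Γ, ψ⟩ :=
  ofSub (Sub.id Γ) (h.cut Prov.sub_id)

theorem ofProv_comp_incl {φ ψ : Formula S Γ} (h : Prov T φ ψ) :
    ofProv h ≫ incl ⟨Γ, ψ⟩ = incl ⟨Γ, φ⟩ :=
  (ofSub_comp_incl (X := ⟨Γ, φ⟩) (Y := ⟨Γ, ψ⟩) _ _).trans (Category.comp_id _)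

theorem isPullback_incl_and (φ ψ : Formula S Γ) : IsPullback
    (ofProv (Prov.and_left (T := T) φ ψ)) (ofProv (Prov.and_right (T := T) φ ψ))
    (incl ⟨Γ, φ⟩) (incl ⟨Γ, ψ⟩) := by
  refine ⟨⟨by rw [ofProv_comp_incl, ofProv_comp_incl]⟩, ⟨?_⟩⟩
  have h (c : PullbackCone (incl (T := T) ⟨Γ, φ⟩) (incl ⟨Γ, ψ⟩)) :
      ∃ k, k ≫ incl (T := T) ⟨Γ, .and φ ψ⟩ = c.fst ≫ incl _ := by
    obtain ⟨W, p, _, -, ⟨σ, hσ, e⟩, ⟨τ, hτ, e'⟩⟩ := exists_isIso_isSub₂ c.fst c.snd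
    have e₁ := congrArg (p ≫ ·) c.condition
    simp only [← Category.assoc, e, e', ofSub_comp_incl] at e₁
    obtain ⟨l, hl⟩ : ∃ l : W ⟶ ⟨Γ, .and φ ψ⟩, l ≫ incl _ = incl W ≫ ctxHom T σ :=
      ⟨_, ofSub_comp_incl (Y := ⟨Γ, .and φ ψ⟩) σ (Prov.and_intro hσ
        (Prov.sub_eqs ψ (Prov.eqs_symm (incl_comp_ctxHom_eq_iff.1 e₁)) hτ))⟩
    refine ⟨inv p ≫ l, ?_⟩
    rw [Category.assoc, hl, IsIso.inv_comp_eq, ← Category.assoc, e, ofSub_comp_incl]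
  choose k hk using h
  refine PullbackCone.IsLimit.mk _ k (fun c => ?_) (fun c => ?_) fun c m h₁ h₂ => ?_
  · rw [← cancel_mono (incl _), Category.assoc, ofProv_comp_incl, hk]
  · rw [← cancel_mono (incl _), Category.assoc, ofProv_comp_incl, hk, c.condition]
  · rw [← cancel_mono (incl _), hk, ← h₁, Category.assoc, ofProv_comp_incl]

variable (T) in
/-- The projection onto an existentially quantified formula. -/
def ofEx {s : S.Srt} (φ : Formula S (s :: Γ)) : (⟨s :: Γ, φ⟩ : SynCat T) ⟶ ⟨Γ, .ex s φ⟩ :=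
  ofSub (Sub.wk s) (Prov.ex_intro (Prov.refl _))

theorem isRegularEpi_ofEx {s : S.Srt} (φ : Formula S (s :: Γ)) : IsRegularEpi (ofEx T φ) := by
  refine (isSurj_ofSub.2 (Prov.ex_elim (imFml_of (ρ := Sub.id _) Prov.sub_id ?_))).isRegularEpi
  rw [Sub.comp_id]
  exact Prov.eqs_refl _

end SynCat

namespace Realization

variable {G : SynCat T ⥤ E} {N : Str S E} (R : Realization G N) {Γ Δ : List S.Srt} {X Y : SynCat T}

/-- The value of `G` at a formula is the interpretation of the formula in `N`. -/
theorem forces_iff (hG : isRegularFunctor _ _ G) (φ : Formula S Γ) {A : E}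
    {a : A ⟶ ctxObj N.obj Γ} :
    Forces N φ a ↔ ∃ b : A ⟶ G.obj ⟨Γ, φ⟩, b ≫ R.emb ⟨Γ, φ⟩ = a := by
  have := hG.1
  have hm := R.mono_emb
  -- Each connective corresponds to a construction that `G` preserves: truth to a whole context,
  -- equality to an equalizer, conjunction to a pullback, existence to a regular epimorphism
  -- followed by an inclusion.
  induction φ generalizing A with
  | @top Γ =>
    have := R.isIso_ctx Γ
    refine ⟨fun _ => ⟨a ≫ inv (R.ctx Γ), ?_⟩, fun _ => forces_top _⟩
    have e : R.emb (ctxt T Γ) = R.ctx Γ :=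
      (congrArg (· ≫ R.ctx Γ) (G.map_id (ctxt T Γ))).trans (Category.id_comp _)
    rw [Category.assoc]
    refine (congrArg (fun k => a ≫ inv (R.ctx Γ) ≫ k) e).trans ?_
    rw [IsIso.inv_hom_id, Category.comp_id]
  | @eq Γ s t t' =>
    have := R.isIso_ctx Γ
    rw [forces_eq]
    obtain ⟨hl⟩ := nonempty_isLimit_incl_eq (T := T) t t'
    have hl := isLimitForkMapOfIsLimit G _ hl
    constructor
    · intro e
      obtain ⟨b, hb⟩ := Fork.IsLimit.lift' hl (a ≫ inv (R.ctx Γ)) (by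
        rw [← cancel_mono (R.iso s).hom]
        simp only [Category.assoc, ← ctx_interp_term, IsIso.inv_hom_id_assoc, e])
      refine ⟨b, ?_⟩
      rw [emb, ← Category.assoc]
      refine (congrArg (· ≫ R.ctx Γ) hb).trans ?_
      simp
    · rintro ⟨b, rfl⟩
      simp only [emb, Category.assoc, ctx_interp_term]
      rw [← Category.assoc (G.map _), ← Category.assoc (G.map _), ← G.map_comp, ← G.map_comp,
        incl_eq]
  | @and Γ φ ψ h h' =>
    refine forces_and.trans ((and_congr h h').trans ?_)
    have hp := (isPullback_incl_and (T := T) φ ψ).map G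
    have e : ∀ {φ ψ : Formula S Γ} (h : Prov T φ ψ),
        G.map (ofProv h) ≫ R.emb ⟨Γ, ψ⟩ = R.emb ⟨Γ, φ⟩ := fun h => by
      rw [emb, ← Category.assoc, ← G.map_comp, ofProv_comp_incl]; rfl
    constructor
    · rintro ⟨⟨b, hb⟩, ⟨c, hc⟩⟩
      have := R.isIso_ctx Γ
      have hbc : b ≫ G.map (incl ⟨Γ, φ⟩) = c ≫ G.map (incl ⟨Γ, ψ⟩) := by
        rw [← cancel_mono (R.ctx Γ), Category.assoc, Category.assoc]
        exact hb.trans hc.symm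
      refine ⟨hp.lift b c hbc, ?_⟩
      rw [← e (Prov.and_left φ ψ), ← Category.assoc, hp.lift_fst, hb]
    · rintro ⟨b, hb⟩
      exact ⟨⟨b ≫ G.map (ofProv (Prov.and_left φ ψ)), by rw [Category.assoc, e, hb]⟩,
        ⟨b ≫ G.map (ofProv (Prov.and_right φ ψ)), by rw [Category.assoc, e, hb]⟩⟩
  | @ex Γ s φ ih =>
    have e : R.emb ⟨s :: Γ, φ⟩ ≫ ctxTl N.obj s Γ = G.map (ofEx T φ) ≫ R.emb ⟨Γ, .ex s φ⟩ := by
      rw [← Sub.interp_wk]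
      exact R.emb_interp_sub (X := ⟨s :: Γ, φ⟩) (Y := ⟨Γ, .ex s φ⟩) (Sub.wk s) _
    have hr := hG.2 _ (isRegularEpi_ofEx (T := T) φ)
    rw [forces_ex]
    constructor
    · rintro ⟨B, p, z, hp, h₁, h₂⟩
      obtain ⟨b, hb⟩ := ih.1 h₂
      refine exists_lift_of_local hp (k := b ≫ G.map (ofEx T φ)) ?_
      rw [Category.assoc, ← e, ← Category.assoc, hb, h₁]
    · rintro ⟨b, hb⟩
      obtain ⟨B, p, x, hp, hx⟩ := exists_lift_of_isRegularEpi (G.map (ofEx T φ)) b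
      exact ⟨B, p, x ≫ R.emb _, hp, by
        rw [Category.assoc, e, ← Category.assoc, ← hx, Category.assoc, hb], ih.2 ⟨x, rfl⟩⟩

theorem isModel_of_isRegularFunctor (R : Realization G N) (hG : isRegularFunctor _ _ G) :
    isModel E T N := fun Γ φ ψ h =>
  le_iff_forall_factors.2 fun a ha => by
    obtain ⟨b, hb⟩ := (R.forces_iff hG φ).1 ha
    refine (R.forces_iff hG ψ).2 ⟨b ≫ G.map (ofProv (.ax h)), ?_⟩
    rw [← hb, Category.assoc]
    congr 1
    rw [emb, ← Category.assoc, ← G.map_comp, ofProv_comp_incl]; rfl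

/-! ### Natural transformations and homomorphisms of structures. -/

section Hom

variable {G' : SynCat T ⥤ E} {N' : Str S E} (R' : Realization G' N')

theorem app_comp_emb (α : G ⟶ G') (X : SynCat T) {h : ∀ s, N.obj s ⟶ N'.obj s}
    (e : ∀ s, α.app (ctxt T [s]) ≫ (R'.iso s).hom = (R.iso s).hom ≫ h s) :
    α.app X ≫ R'.emb X = R.emb X ≫ ctxMap h X.ctx := by
  refine ctx_hom_ext _ fun s x => ?_
  simp only [emb, Category.assoc, ctx_ctxProj, ctxMap_ctxProj]
  rw [← Category.assoc (R.ctx _), ctx_ctxProj, Category.assoc, ← e, ← Category.assoc (α.app X),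
    ← α.naturality, Category.assoc, ← Category.assoc (α.app _), ← α.naturality, Category.assoc]

/-- Every value of `G'` embeds in a product of sorts, so the components at single sorts determine
all the others. -/
theorem natTrans_ext (R : Realization G N) (R' : Realization G' N') (hG' : isRegularFunctor _ _ G') {α β : G ⟶ G'}
    (e : ∀ s, α.app (ctxt T [s]) = β.app (ctxt T [s])) : α = β := by
  have := hG'.1
  have hm := R'.mono_emb
  ext X
  let h s := (R.iso s).inv ≫ β.app _ ≫ (R'.iso s).hom
  rw [← cancel_mono (R'.emb X), R.app_comp_emb R' α X (h := h) (fun s => by simp [h, e]),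
    R.app_comp_emb R' β X (h := h) (fun s => by simp [h])]

/-- Homomorphisms of structures extend to natural transformations. -/
theorem exists_natTrans (hG : isRegularFunctor _ _ G) (hG' : isRegularFunctor _ _ G')
    (h : N ⟶ N') :
    ∃ α : G ⟶ G', ∀ s, α.app (ctxt T [s]) ≫ (R'.iso s).hom = (R.iso s).hom ≫ h.app s := by
  have := hG'.1
  have hm := R'.mono_emb
  -- Homomorphisms preserve regular formulas, so the map on contexts restricts to the values of the
  -- functors.
  have H (X : SynCat T) : ∃ k : G.obj X ⟶ G'.obj X, k ≫ R'.emb X = R.emb X ≫ ctxMap h.app X.ctx :=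
    (R'.forces_iff hG' X.fml).1 (((R.forces_iff hG X.fml).2 ⟨𝟙 _, Category.id_comp _⟩).map h)
  choose k hk using H
  -- Naturality is immediate for substitutions; a general morphism is reduced to them through its
  -- graph.
  have hn : ∀ {X Y : SynCat T} (f : X ⟶ Y), IsSub f → G.map f ≫ k Y = k X ≫ G'.map f := by
    rintro X Y f ⟨σ, hσ, rfl⟩
    rw [← cancel_mono (R'.emb Y), Category.assoc, Category.assoc, hk, ← emb_interp_sub,
      ← Category.assoc, ← Category.assoc, hk, ← emb_interp_sub, Category.assoc, Category.assoc,
      StrHom.interp_sub]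
  refine ⟨⟨k, fun X Y f => ?_⟩, fun s => ?_⟩
  · obtain ⟨Z, p, _, hp, hf⟩ := exists_isIso_isSub f
    have h₁ := hn _ hf
    rw [← cancel_epi (G.map p), ← Category.assoc, ← G.map_comp, h₁, G'.map_comp, ← Category.assoc,
      ← Category.assoc, hn _ hp]
  · have e {G : SynCat T ⥤ E} {N : Str S E} (R : Realization G N) :
        R.emb (ctxt T [s]) ≫ ctxProj N.obj .zero = (R.iso s).hom := by
      rw [emb, Category.assoc, ctx_ctxProj, ofTerm_var_zero, G.map_id, Category.id_comp]
      exact (congrArg (· ≫ _) (G.map_id (ctxt T [s]))).trans (Category.id_comp _)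
    have := congrArg (· ≫ ctxProj N'.obj .zero) (hk (ctxt T [s]))
    simp only [Category.assoc, e, ctxMap_ctxProj] at this
    rw [← Category.assoc, e] at this
    exact this

end Hom

end Realization

end Realization

/-! ### The classifying property of the syntactic category -/

section Structures

variable {S : Signature.{w}} {E : Type u'} [Category.{v'} E] [HasFiniteLimits E]

theorem StrHom.isIso {M N : Str S E} (h : M ⟶ N) [∀ s, IsIso (h.app s)] : IsIso h := by
  have hi : ∀ Γ, ctxMap h.app Γ ≫ ctxMap (fun s => inv (h.app s)) Γ = 𝟙 _ := fun Γ => by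
    simp [← ctxMap_comp, ctxMap_id]
  have hi' : ∀ Γ, ctxMap (fun s => inv (h.app s)) Γ ≫ ctxMap h.app Γ = 𝟙 _ := fun Γ => by
    simp [← ctxMap_comp, ctxMap_id]
  refine ⟨⟨fun s => inv (h.app s), fun f => ?_⟩, StrHom.ext (funext fun s => ?_),
    StrHom.ext (funext fun s => ?_)⟩
  · rw [IsIso.comp_inv_eq, Category.assoc, h.comm, ← Category.assoc, hi', Category.id_comp]
  · exact IsIso.hom_inv_id (h.app s)
  · exact IsIso.inv_hom_id (h.app s)

variable {A : Type u} [Category.{v} A] [HasFiniteLimits A]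

theorem ctxIso_comp {D : Type*} [Category D] [HasFiniteLimits D] (ι : D ⥤ A) (F : A ⥤ E)
    [PreservesFiniteLimits ι] [PreservesFiniteLimits F] [PreservesFiniteLimits (ι ⋙ F)]
    (M : S.Srt → D) (Γ : List S.Srt) : (ctxIso (ι ⋙ F) M Γ).hom =
      F.map (ctxIso ι M Γ).hom ≫ (ctxIso F (fun s => ι.obj (M s)) Γ).hom := by
  refine ctx_hom_ext (fun s => F.obj (ι.obj (M s))) fun s x => ?_
  refine (ctxIso_hom_ctxProj (ι ⋙ F) M x).trans ?_
  rw [Category.assoc, ctxIso_hom_ctxProj F, ← F.map_comp, ctxIso_hom_ctxProj ι]; rfl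

/-- The image of a structure under a composition of functors. -/
noncomputable def Str.mapCompHom {D : Type*} [Category D] [HasFiniteLimits D] (U : Str S D)
    (ι : D ⥤ A) (F : A ⥤ E) [PreservesFiniteLimits ι] [PreservesFiniteLimits F]
    [PreservesFiniteLimits (ι ⋙ F)] : U.map (ι ⋙ F) ⟶ (U.map ι).map F where
  app s := 𝟙 _
  comm f := by
    have h : ctxIso (ι ⋙ F) U.obj (S.dom f) =
        F.mapIso (ctxIso ι U.obj _) ≪≫ ctxIso F (fun s => ι.obj (U.obj s)) _ :=
      Iso.ext (ctxIso_comp ι F U.obj _)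
    refine (Category.comp_id _).trans (Eq.trans ?_ (Eq.trans (Category.id_comp _).symm
      (congrArg (· ≫ _) (ctxMap_id (fun s => F.obj (ι.obj (U.obj s))) _).symm)))
    refine (congrArg (·.inv ≫ F.map (ι.map (U.op f))) h).trans ?_
    refine (Category.assoc _ _ _).trans (congrArg (_ ≫ ·) ?_)
    exact (F.map_comp _ _).symm

end Structures

section Classifying

variable {S : Signature.{w}} {T : Theory S} {E : Type u'} [Category.{v'} E] [Regular E]

open SynCat

namespace Realization

/-- A regular functor realizes the image of the generic structure. -/
noncomputable def ofMap (G : SynCat T ⥤ E) [PreservesFiniteLimits G] :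
    Realization G ((genericStr T).map G) where
  iso s := Iso.refl _
  comm f := by
    have h : ctxLift (fun s => G.obj (ctxt T [s])) (Γ := S.dom f)
        (fun s x => G.map (ofTerm T (.var x)) ≫ 𝟙 _) =
        G.map (ctxtComparison T _) ≫ (ctxIso G (fun s => ctxt T [s]) _).hom := by
      refine ctx_hom_ext _ fun s x => ?_
      rw [ctxLift_ctxProj, Category.assoc, ctxIso_hom_ctxProj, ← G.map_comp, ctxtComparison,
        ctxLift_ctxProj, Category.comp_id]
    refine (congrArg (· ≫ _) h).trans ?_
    refine (Category.assoc _ _ _).trans ?_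
    refine (congrArg (_ ≫ ·) (Iso.hom_inv_id_assoc _ _)).trans ?_
    refine (G.map_comp _ _).symm.trans ?_
    refine (congrArg G.map (IsIso.hom_inv_id_assoc _ _)).trans ?_
    exact (Category.comp_id _).symm

/-- Two structures that are realized by `G` are isomorphic. -/
theorem exists_isIso {G : SynCat T ⥤ E} [PreservesFiniteLimits G] {N N' : Str S E}
    (R : Realization G N) (R' : Realization G N') : ∃ h : N ⟶ N', IsIso h := by
  let k (s : S.Srt) : N.obj s ⟶ N'.obj s := (R.iso s).inv ≫ (R'.iso s).hom
  have hc (Γ : List S.Srt) : R'.ctx Γ = R.ctx Γ ≫ ctxMap k Γ := by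
    refine ctx_hom_ext _ fun s x => ?_
    rw [Category.assoc, ctxMap_ctxProj, ← Category.assoc, ctx_ctxProj, ctx_ctxProj]
    simp [k]
  let h : N ⟶ N' := ⟨k, fun f => by
    have := R.isIso_ctx (S.dom f)
    rw [← cancel_epi (R.ctx (S.dom f)), ← Category.assoc _ (ctxMap k _), ← hc]
    refine (Category.assoc _ _ _).symm.trans ((congrArg (· ≫ _) (R.comm f)).trans
      (Eq.trans ?_ (R'.comm f).symm))
    simp [k]⟩
  have : ∀ s, IsIso (h.app s) := fun s => inferInstanceAs (IsIso (k s))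
  exact ⟨h, StrHom.isIso h⟩

/-- A model is realized by its functor. -/
theorem nonempty_modelFunctor {M : Str S E} (hM : isModel E T M) :
    Nonempty (Realization (modelFunctor hM) M) := by
  -- A context of one sort is interpreted as a product with the terminal object, so its projection
  -- is invertible.
  have hi (s : S.Srt) : IsIso (modelι hM (ctxt T [s]) ≫ ctxProj M.obj .zero) := by
    obtain ⟨k, hk⟩ := Forces.exists_lift_modelFunctor (X := ctxt T [s]) hM
      (forces_top (ctxLift M.obj (Γ := [s]) (fun | _, .zero => 𝟙 (M.obj s))))
    have h₁ : k ≫ modelι hM (ctxt T [s]) ≫ ctxProj M.obj .zero = 𝟙 _ := by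
      rw [← Category.assoc, hk]; exact ctxLift_ctxProj _ _ _
    refine ⟨k, ?_, h₁⟩
    rw [← cancel_mono (modelι hM (ctxt T [s]))]
    refine ctx_hom_ext _ fun r x => ?_
    cases x with
    | zero => rw [Category.assoc, Category.assoc, Category.assoc, h₁, Category.comp_id,
        Category.id_comp]
    | succ x => nomatch x
  have hc {Γ : List S.Srt} {s : S.Srt} (t : Term S Γ s) :
      (modelFunctor hM).map (ofTerm T t) ≫ modelι hM (ctxt T [s]) ≫ ctxProj M.obj .zero =
        modelι hM (ctxt T Γ) ≫ t.interp M := by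
    rw [← Category.assoc, ofTerm, ctxHom]
    refine (congrArg (· ≫ _) (modelFunctor_map_ofSub (X := ctxt T Γ) (Y := ctxt T [s]) hM
      (single t) _)).trans ?_
    rw [Category.assoc, Sub.interp_ctxProj]; rfl
  refine ⟨⟨fun s => have := hi s; asIso (modelι hM (ctxt T [s]) ≫ ctxProj M.obj .zero),
    fun f => ?_⟩⟩
  refine Eq.trans ?_ (hc (.app f fun _ x => .var x)).symm
  rw [Term.interp, ← Category.assoc]
  congr 1
  refine ctx_hom_ext _ fun s x => ?_
  rw [ctxLift_ctxProj, Category.assoc, ctxLift_ctxProj]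
  exact hc (.var x)

end Realization

variable (T E) in
/-- The functor from regular functors to models. -/
noncomputable def evalGeneric : Ex (SynCat T) E ⥤ Mod E T :=
  (isModel E T).lift (evalAt (genericStr T)) fun F =>
    have := F.property.1
    (Realization.ofMap F.obj).isModel_of_isRegularFunctor F.property

instance : (evalGeneric T E).Faithful where
  map_injective {F G} α β h := by
    have := F.property.1
    have := G.property.1
    refine ObjectProperty.hom_ext _ ((Realization.ofMap F.obj).natTrans_ext
      (Realization.ofMap G.obj) G.property fun s => ?_)
    exact congrFun (congrArg (fun k => StrHom.app k.hom) h) s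

instance : (evalGeneric T E).Full where
  map_surjective {F G} h := by
    have := F.property.1
    have := G.property.1
    obtain ⟨α, hα⟩ := (Realization.ofMap F.obj).exists_natTrans (Realization.ofMap G.obj)
      F.property G.property h.hom
    refine ⟨ObjectProperty.homMk α, ObjectProperty.hom_ext _ (StrHom.ext (funext fun s => ?_))⟩
    exact (Category.comp_id _).symm.trans ((hα s).trans (Category.id_comp _))

/-- A model and the image of the generic structure under its functor are both realized by that
functor, and such structures are isomorphic. -/
instance : (evalGeneric T E).EssSurj where
  mem_essImage M := by
    have hF := isRegularFunctor_modelFunctor M.property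
    have := hF.1
    obtain ⟨R⟩ := Realization.nonempty_modelFunctor M.property
    obtain ⟨h, hh⟩ := (Realization.ofMap (modelFunctor M.property)).exists_isIso R
    exact ⟨⟨modelFunctor M.property, hF⟩, ⟨ObjectProperty.isoMk _ (@asIso _ _ _ _ h hh)⟩⟩

instance : (evalGeneric T E).IsEquivalence where

end Classifying

/-! ### The universal model in the exact completion. -/

section Completion

variable {S : Signature.{w}} {T : Theory S} {A : Type u} [Category.{v} A] [BarrExact A]
  {ι : SynCat T ⥤ A}

variable (ι) in
/-- The image of the generic structure under a regular functor is a model. -/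
noncomputable def genericModel (hι : isRegularFunctor (SynCat T) A ι) : Mod A T :=
  (evalGeneric T A).obj ⟨ι, hι⟩

/-- The universal property of the generic model in a Barr exact completion. -/
theorem exists_equivalence_mod (hι : isRegularFunctor (SynCat T) A ι) (E : Type u')
    [Category.{v'} E] [BarrExact E] [ι.Full] [ι.Faithful] (hc : ∀ a, IsCovered ι a) :
    ∃ e : Ex A E ≌ Mod E T,
      Nonempty (e.functor ⋙ (isModel E T).ι ≅ evalAt (genericModel ι hι).obj) := by
  have := isEquivalence_restrictEx hι hc E
  -- Restriction to the syntactic category followed by evaluation at the generic structure.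
  -- Evaluation at the image of that structure differs only by the canonical comparison of contexts,
  -- so the identities on sorts form the isomorphism.
  refine ⟨(restrictEx hι E).asEquivalence.trans (evalGeneric T E).asEquivalence,
    ⟨NatIso.ofComponents (fun F => ?_) ?_⟩⟩
  · have := hι.1
    have := F.property.1
    have := (hι.comp F.property).1
    have : ∀ s, IsIso (((SynCat.genericStr T).mapCompHom ι F.obj).app s) := fun s =>
      inferInstanceAs (IsIso (𝟙 _))
    exact @asIso _ _ _ _ _ (StrHom.isIso ((SynCat.genericStr T).mapCompHom ι F.obj))
  · intro F G α
    exact StrHom.ext (funext fun s => (Category.comp_id _).trans (Category.id_comp _).symm)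

end Completion

/-! ### Completions of preadditive categories are preadditive -/

section Preadditive

variable {D : Type u} [Category.{v} D] [Regular D] [Preadditive D]
  {A : Type u'} [Category.{v'} A] [Regular A] {ι : D ⥤ A} [ι.Full] [ι.Faithful]

theorem exists_cover_comp_eq (hc : ∀ a, IsCovered ι a) {X Y : D} {a : A} (p : ι.obj Y ⟶ a)
    (q : ι.obj X ⟶ a) [IsRegularEpi q] : ∃ (V : D) (v : V ⟶ Y) (x : V ⟶ X),
      IsRegularEpi (ι.map v) ∧ ι.map x ≫ q = ι.map v ≫ p := by
  obtain ⟨V, k, hk⟩ := hc (pullback p q)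
  obtain ⟨v, hv⟩ := ι.map_surjective (k ≫ pullback.fst p q)
  obtain ⟨x, hx⟩ := ι.map_surjective (k ≫ pullback.snd p q)
  exact ⟨V, v, x, hv ▸ isRegularEpi_comp hk inferInstance, by
    rw [hv, hx, Category.assoc, Category.assoc, pullback.condition]⟩

theorem exists_cover_lift (hc : ∀ a, IsCovered ι a) {X X' V : D} {a : A} {q : ι.obj X ⟶ a}
    {q' : ι.obj X' ⟶ a} {W : D} {w : W ⟶ X} {w' : W ⟶ X'} {k : ι.obj W ⟶ pullback q q'}
    (hk : IsRegularEpi k) (h : k ≫ pullback.fst q q' = ι.map w)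
    (h' : k ≫ pullback.snd q q' = ι.map w') {x : V ⟶ X} {x' : V ⟶ X'}
    (e : ι.map x ≫ q = ι.map x' ≫ q') : ∃ (U : D) (u : U ⟶ V) (l : U ⟶ W),
      IsRegularEpi (ι.map u) ∧ l ≫ w = u ≫ x ∧ l ≫ w' = u ≫ x' := by
  obtain ⟨U, u, l, hu, hl⟩ := exists_cover_comp_eq hc (pullback.lift _ _ e) k
  refine ⟨U, u, l, hu, ι.map_injective ?_, ι.map_injective ?_⟩
  · rw [ι.map_comp, ι.map_comp, ← h, reassoc_of% hl, pullback.lift_fst]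
  · rw [ι.map_comp, ι.map_comp, ← h', reassoc_of% hl, pullback.lift_snd]

/-- The relation of having equal images in `a` is closed under linear combinations. It is covered by
some `W` in `D`, and on a common cover both pairs lift to `W`; the lifts may be combined there
because composition in `D` is bilinear. -/
theorem map_lin_comp_eq (hc : ∀ a, IsCovered ι a) (c d : ℤ) {X X' V : D} {a : A} {q : ι.obj X ⟶ a}
    {q' : ι.obj X' ⟶ a} {x y : V ⟶ X} {x' y' : V ⟶ X'} (hx : ι.map x ≫ q = ι.map x' ≫ q')
    (hy : ι.map y ≫ q = ι.map y' ≫ q') :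
    ι.map (c • x + d • y) ≫ q = ι.map (c • x' + d • y') ≫ q' := by
  obtain ⟨W, k, hk⟩ := hc (pullback q q')
  obtain ⟨w, hw⟩ := ι.map_surjective (k ≫ pullback.fst q q')
  obtain ⟨w', hw'⟩ := ι.map_surjective (k ≫ pullback.snd q q')
  obtain ⟨U, u, l, hu, h₁, h₂⟩ := exists_cover_lift hc hk hw.symm hw'.symm hx
  obtain ⟨U', u', l', hu', h₃, h₄⟩ := exists_cover_lift hc hk hw.symm hw'.symm
    (x := u ≫ y) (x' := u ≫ y') (by simp [hy])
  rw [← cancel_epi (ι.map u), ← cancel_epi (ι.map u')]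
  simp only [← ι.map_comp_assoc, Preadditive.comp_add, Preadditive.comp_zsmul, ← h₁, ← h₂, ← h₃,
    ← h₄]
  simp only [← Category.assoc, ← Preadditive.zsmul_comp, ← Preadditive.add_comp]
  rw [ι.map_comp, ι.map_comp, hw, hw']
  simp only [Category.assoc, pullback.condition]

/-- Three morphisms have representatives on a common cover. -/
theorem exists_representatives (hc : ∀ a, IsCovered ι a) {a b : A} (f g h : b ⟶ a) :
    ∃ (X Y : D) (p : ι.obj Y ⟶ b) (q : ι.obj X ⟶ a) (x y z : Y ⟶ X), IsRegularEpi p ∧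
      IsRegularEpi q ∧ ι.map x ≫ q = p ≫ f ∧ ι.map y ≫ q = p ≫ g ∧ ι.map z ≫ q = p ≫ h := by
  obtain ⟨X, q, hq⟩ := hc a
  obtain ⟨Y, p, hp⟩ := hc b
  obtain ⟨V, v, x, hv, hx⟩ := exists_cover_comp_eq hc (p ≫ f) q
  obtain ⟨V', v', y, hv', hy⟩ := exists_cover_comp_eq hc (ι.map v ≫ p ≫ g) q
  obtain ⟨V'', v'', z, hv'', hz⟩ := exists_cover_comp_eq hc (ι.map v' ≫ ι.map v ≫ p ≫ h) q
  refine ⟨X, V'', ι.map v'' ≫ ι.map v' ≫ ι.map v ≫ p, q, v'' ≫ v' ≫ x, v'' ≫ y, z,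
    isRegularEpi_comp hv'' (isRegularEpi_comp hv' (isRegularEpi_comp hv hp)), hq, ?_, ?_, ?_⟩
  · simp [hx]
  · simp [hy]
  · simp [hz]

/-- Representatives over a cover are combined in `D`, and the result descends since it does not
depend on the representatives. The coefficients `(1, 1)`, `(0, 0)` and `(-1, 0)` give sum, zero and
negative, so that well-definedness is proved once. -/
theorem exists_lin (hc : ∀ a, IsCovered ι a) (c d : ℤ) {a b : A} (f g : b ⟶ a) :
    ∃ s : b ⟶ a, ∀ {X Y : D} (p : ι.obj Y ⟶ b) (q : ι.obj X ⟶ a) (x y : Y ⟶ X),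
      ι.map x ≫ q = p ≫ f → ι.map y ≫ q = p ≫ g → ι.map (c • x + d • y) ≫ q = p ≫ s := by
  obtain ⟨X, Y, p, q, x, y, -, hp, -, hx, hy, -⟩ := exists_representatives hc f g g
  have key : ∀ {X' Y' V : D} (p' : ι.obj Y' ⟶ b) (q' : ι.obj X' ⟶ a) (x' y' : Y' ⟶ X'),
      ι.map x' ≫ q' = p' ≫ f → ι.map y' ≫ q' = p' ≫ g → ∀ (v : V ⟶ Y) (v' : V ⟶ Y'),
        ι.map v ≫ p = ι.map v' ≫ p' →
        ι.map v ≫ ι.map (c • x + d • y) ≫ q = ι.map v' ≫ ι.map (c • x' + d • y') ≫ q' := by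
    intro X' Y' V p' q' x' y' hx' hy' v v' hv
    simp only [← ι.map_comp_assoc, Preadditive.comp_add, Preadditive.comp_zsmul]
    refine map_lin_comp_eq hc c d ?_ ?_
    · simp only [ι.map_comp, Category.assoc, hx, hx', reassoc_of% hv]
    · simp only [ι.map_comp, Category.assoc, hy, hy', reassoc_of% hv]
  obtain ⟨s, hs⟩ := exists_desc p (ι.map (c • x + d • y) ≫ q) (fun {T} t t' ht => by
    obtain ⟨V, k, hk⟩ := hc T
    obtain ⟨v, hv⟩ := ι.map_surjective (k ≫ t)
    obtain ⟨v', hv'⟩ := ι.map_surjective (k ≫ t')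
    have := key p q x y hx hy v v' (by rw [hv, hv', Category.assoc, Category.assoc, ht])
    rw [← cancel_epi k, ← Category.assoc, ← Category.assoc k t', ← hv, ← hv', this])
  refine ⟨s, fun p' q' x' y' hx' hy' => ?_⟩
  obtain ⟨V, v', v, hv', hv⟩ := exists_cover_comp_eq hc p' p
  rw [← cancel_epi (ι.map v'), ← key p' q' x' y' hx' hy' v v' hv, ← hs, reassoc_of% hv]

/-- Integral linear combinations of two morphisms. -/
noncomputable def lin (hc : ∀ a, IsCovered ι a) (c d : ℤ) {a b : A} (f g : b ⟶ a) : b ⟶ a :=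
  (exists_lin hc c d f g).choose

theorem map_comp_lin (hc : ∀ a, IsCovered ι a) {c d : ℤ} {a b : A} {f g : b ⟶ a} {X Y : D}
    {p : ι.obj Y ⟶ b} {q : ι.obj X ⟶ a} {x y : Y ⟶ X} (hx : ι.map x ≫ q = p ≫ f)
    (hy : ι.map y ≫ q = p ≫ g) : ι.map (c • x + d • y) ≫ q = p ≫ lin hc c d f g :=
  (exists_lin hc c d f g).choose_spec p q x y hx hy

/-- The combination with coefficients zero still needs morphisms as arguments. One is obtained
through the terminal object and a zero morphism of `D`. -/
theorem nonempty_hom (hι : isRegularFunctor D A ι) (hc : ∀ a, IsCovered ι a) (b a : A) :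
    Nonempty (b ⟶ a) := by
  have := hι.1
  obtain ⟨X, q, -⟩ := hc a
  exact ⟨(IsTerminal.isTerminalObj ι _ terminalIsTerminal).from b ≫ ι.map (0 : ⊤_ D ⟶ X) ≫ q⟩

/-- The zero morphism as a linear combination. -/
noncomputable def linZero (hι : isRegularFunctor D A ι) (hc : ∀ a, IsCovered ι a) (b a : A) :
    b ⟶ a :=
  lin hc 0 0 (nonempty_hom hι hc b a).some (nonempty_hom hι hc b a).some

theorem map_comp_linZero (hι : isRegularFunctor D A ι) (hc : ∀ a, IsCovered ι a) {b a : A}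
    {X Y : D} (p : ι.obj Y ⟶ b) (q : ι.obj X ⟶ a) [IsRegularEpi q] :
    ι.map (0 : Y ⟶ X) ≫ q = p ≫ linZero hι hc b a := by
  obtain ⟨V, v, x, _, hx⟩ := exists_cover_comp_eq hc (p ≫ (nonempty_hom hι hc b a).some) q
  have h := map_comp_lin hc (c := 0) (d := 0) (p := ι.map v ≫ p) (q := q)
    (hx.trans (Category.assoc _ _ _).symm) (hx.trans (Category.assoc _ _ _).symm)
  rw [← cancel_epi (ι.map v), ← ι.map_comp_assoc, comp_zero, linZero, ← Category.assoc _ p, ← h]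
  simp

/-- If all objects of `A` are quotients of objects of the preadditive category `D`, then `A` is
preadditive. -/
noncomputable abbrev preadditiveOfIsCovered (hι : isRegularFunctor D A ι)
    (hc : ∀ a, IsCovered ι a) : Preadditive A where
  homGroup b a :=
    { add f g := lin hc 1 1 f g
      zero := linZero hι hc b a
      neg f := lin hc (-1) 0 f f
      nsmul := @nsmulRec _ ⟨linZero hι hc b a⟩ ⟨lin hc 1 1⟩
      zsmul := @zsmulRec _ ⟨linZero hι hc b a⟩ ⟨lin hc 1 1⟩ ⟨fun f => lin hc (-1) 0 f f⟩
        (@nsmulRec _ ⟨linZero hι hc b a⟩ ⟨lin hc 1 1⟩)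
      add_assoc f g h := by
        -- After composition with the epimorphism `p` the law becomes one about the representatives,
        -- which holds in the preadditive category `D`. The other laws are proved in the same way.
        obtain ⟨X, Y, p, q, x, y, z, hp, -, hx, hy, hz⟩ := exists_representatives hc f g h
        change lin hc 1 1 (lin hc 1 1 f g) h = lin hc 1 1 f (lin hc 1 1 g h)
        rw [← cancel_epi p, ← map_comp_lin hc (map_comp_lin hc hx hy) hz,
          ← map_comp_lin hc hx (map_comp_lin hc hy hz)]
        simp [add_assoc]
      zero_add f := by
        obtain ⟨X, Y, p, q, x, -, -, hp, hq, hx, -, -⟩ := exists_representatives hc f f f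
        change lin hc 1 1 (linZero hι hc b a) f = f
        rw [← cancel_epi p, ← map_comp_lin hc (map_comp_linZero hι hc p q) hx, ← hx]
        simp
      add_zero f := by
        obtain ⟨X, Y, p, q, x, -, -, hp, hq, hx, -, -⟩ := exists_representatives hc f f f
        change lin hc 1 1 f (linZero hι hc b a) = f
        rw [← cancel_epi p, ← map_comp_lin hc hx (map_comp_linZero hι hc p q), ← hx]
        simp
      neg_add_cancel f := by
        obtain ⟨X, Y, p, q, x, -, -, hp, hq, hx, -, -⟩ := exists_representatives hc f f f
        change lin hc 1 1 (lin hc (-1) 0 f f) f = linZero hι hc b a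
        rw [← cancel_epi p, ← map_comp_lin hc (map_comp_lin hc hx hx) hx,
          ← map_comp_linZero hι hc p q]
        simp
      add_comm f g := by
        obtain ⟨X, Y, p, q, x, y, -, hp, -, hx, hy, -⟩ := exists_representatives hc f g g
        change lin hc 1 1 f g = lin hc 1 1 g f
        rw [← cancel_epi p, ← map_comp_lin hc hx hy, ← map_comp_lin hc hy hx, add_comm] }
  add_comp c b a f g k := by
    obtain ⟨X, Y, p, q, x, y, -, hp, -, hx, hy, -⟩ := exists_representatives hc f g g
    change lin hc 1 1 f g ≫ k = lin hc 1 1 (f ≫ k) (g ≫ k)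
    rw [← cancel_epi p, ← map_comp_lin hc (q := q ≫ k) (x := x) (y := y)
      (by rw [reassoc_of% hx]) (by rw [reassoc_of% hy]), ← Category.assoc, ← Category.assoc,
      map_comp_lin hc hx hy]
  comp_add c b a k f g := by
    obtain ⟨X, Y, p, q, x, y, -, hp, -, hx, hy, -⟩ :=
      exists_representatives hc (k ≫ f) (k ≫ g) (k ≫ g)
    change k ≫ lin hc 1 1 f g = lin hc 1 1 (k ≫ f) (k ≫ g)
    rw [← cancel_epi p, ← map_comp_lin hc hx hy, ← Category.assoc,
      map_comp_lin hc (f := f) (g := g) (p := p ≫ k) (by rw [hx, Category.assoc])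
        (by rw [hy, Category.assoc])]

end Preadditive

/-! ### Preadditive Barr exact categories are abelian -/

section Abelian

variable {A : Type u'} [Category.{v'} A] [BarrExact A] [Preadditive A]

/-- A monomorphism in a preadditive Barr exact category is the kernel of its cokernel. -/
theorem exists_cokernel_of_mono {I G : A} (m : I ⟶ G) [Mono m] : ∃ (Q : A) (q : G ⟶ Q),
    IsRegularEpi q ∧ m ≫ q = 0 ∧ (∀ {W : A} (t : W ⟶ G), t ≫ q = 0 → ∃ l, l ≫ m = t) ∧
      ∀ {W : A} (k : G ⟶ W), m ≫ k = 0 → ∃ d, q ≫ d = k := by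
  have ht {W : A} (x y : W ⟶ I ⨯ G) (h : x ≫ prod.snd = y ≫ (prod.fst ≫ m + prod.snd)) :
      prod.lift (x ≫ prod.fst + y ≫ prod.fst) (y ≫ prod.snd) ≫ (prod.fst ≫ m + prod.snd) =
        x ≫ (prod.fst ≫ m + prod.snd) := by
    rw [Preadditive.comp_add] at h
    rw [Preadditive.comp_add, prod.lift_fst_assoc, prod.lift_snd, Preadditive.comp_add, h,
      Preadditive.add_comp, add_assoc, Category.assoc, Category.assoc]
  -- Over `I ⨯ G` the pair `(i, g)` relates `m i + g` to `g`. Reflexivity takes `i = 0`, symmetry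
  -- replaces `i` by `-i`, and transitivity adds the components in `I` (`ht`); joint monicity uses
  -- that `m` is monic.
  have e : EquivalenceRelation (prod.fst ≫ m + prod.snd : I ⨯ G ⟶ G) prod.snd :=
    { right_cancellation := fun W a b h₁ h₂ => by
        have h₃ : (a ≫ prod.fst) ≫ m = (b ≫ prod.fst) ≫ m := by
          simpa only [Preadditive.comp_add, h₂, add_left_inj, Category.assoc] using h₁
        exact Limits.prod.hom_ext ((cancel_mono m).1 h₃) h₂
      r := prod.lift 0 (𝟙 G)
      reflexivity₁ := by
        rw [Preadditive.comp_add, prod.lift_fst_assoc, prod.lift_snd, zero_comp, zero_add]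
      reflexivity₂ := prod.lift_snd _ _
      s := prod.lift (-prod.fst) (prod.fst ≫ m + prod.snd)
      symmetry₁ := by
        rw [Preadditive.comp_add, prod.lift_fst_assoc, prod.lift_snd, Preadditive.neg_comp,
          neg_add_cancel_left]
      symmetry₂ := prod.lift_snd _ _
      c := _
      isLimit := pullbackIsPullback _ _
      t := prod.lift (pullback.fst _ _ ≫ prod.fst + pullback.snd _ _ ≫ prod.fst)
        (pullback.snd _ _ ≫ prod.snd)
      transitivity₁ := ht _ _ pullback.condition
      transitivity₂ := prod.lift_snd _ _ }
  have := e.isEquivalenceRelation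
  obtain ⟨Q, q, hq, h⟩ := exists_quotient (prod.fst ≫ m + prod.snd : I ⨯ G ⟶ G) prod.snd
  refine ⟨Q, q, hq, ?_, fun t ht => ?_, fun k hk => exists_desc_of_isKernelPair h k ?_⟩
  · have h₁ := congrArg (prod.lift (𝟙 I) (0 : I ⟶ G) ≫ ·) h.w
    simpa only [Preadditive.add_comp, Preadditive.comp_add, Category.assoc, prod.lift_fst_assoc,
      prod.lift_snd_assoc, Category.id_comp, zero_comp, add_zero] using h₁
  -- If `t` is killed by `q` then `(t, 0)` belongs to the relation, that is, `t = m i + 0`.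
  · have h₁ := h.lift_fst t 0 (by rw [ht, zero_comp])
    have h₂ := h.lift_snd t 0 (by rw [ht, zero_comp])
    refine ⟨h.lift t 0 (by rw [ht, zero_comp]) ≫ prod.fst, ?_⟩
    rw [Preadditive.comp_add, h₂, add_zero] at h₁
    rw [Category.assoc, h₁]
  · rw [Preadditive.add_comp, Category.assoc, hk, comp_zero, zero_add]

/-- With `f = e ≫ m` and `e` epi, a cokernel of the monomorphism `m` is a cokernel of `f`. -/
theorem hasCokernels_of_barrExact : HasCokernels A where
  has_colimit {X Y} f := by
    obtain ⟨I, e, m, he, hm, rfl⟩ := exists_image f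
    obtain ⟨Q, q, hq, hmq, -, hd⟩ := exists_cokernel_of_mono m
    choose d hd using fun W (k : Y ⟶ W) => hd k
    exact ⟨⟨⟨CokernelCofork.ofπ q (by rw [Category.assoc, hmq, comp_zero]),
      CokernelCofork.IsColimit.ofπ _ _ (fun {W} k hk => d W k (by
          rw [← cancel_epi e, comp_zero, ← hk, Category.assoc]))
        (fun {W} k hk => hd W k _)
        (fun k hk l hl => by rw [← cancel_epi q, hl, hd])⟩⟩⟩

theorem isNormalMonoCategory_of_barrExact : IsNormalMonoCategory A where
  normalMonoOfMono m := by
    intro hm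
    obtain ⟨Q, q, hq, hmq, hl, -⟩ := exists_cokernel_of_mono m
    choose l hl using fun W (t : W ⟶ _) => hl t
    exact ⟨⟨Q, q, hmq, KernelFork.IsLimit.ofι _ _ (fun {W} t ht => l W t ht)
      (fun {W} t ht => hl W t ht) (fun t ht b hb => by rw [← cancel_mono m, hb, hl])⟩⟩

/-- The cokernel projection of the image of an epimorphism vanishes. The image inclusion is the
kernel of this zero morphism, hence invertible. -/
theorem isRegularEpi_of_epi_of_barrExact {X Y : A} (f : X ⟶ Y) [Epi f] : IsRegularEpi f := by
  obtain ⟨I, e, m, he, hm, rfl⟩ := exists_image f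
  obtain ⟨Q, q, hq, hmq, hl, -⟩ := exists_cokernel_of_mono m
  have hq₀ : q = 0 := by rw [← cancel_epi (e ≫ m), Category.assoc, hmq, comp_zero, comp_zero]
  obtain ⟨l, hl⟩ := hl (𝟙 Y) (by rw [hq₀, comp_zero])
  have : IsIso m := ⟨l, by rw [← cancel_mono m, Category.assoc, hl, Category.comp_id,
    Category.id_comp], hl⟩
  exact isRegularEpi_comp he (isRegularEpi_of_isIso m)

/-- Elements identified by `f` differ by an element of the kernel. So a morphism that kills the
kernel descends along the regular epimorphism `f`. -/
theorem isNormalEpiCategory_of_barrExact : IsNormalEpiCategory A where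
  normalEpiOfEpi {X Y} f := by
    intro hf
    have := isRegularEpi_of_epi_of_barrExact f
    have hd : ∀ (W : A) (k : X ⟶ W), kernel.ι f ≫ k = 0 → ∃ d, f ≫ d = k := fun W k hk =>
      exists_desc f k fun a b h => by
        rw [← sub_eq_zero, ← Preadditive.sub_comp, ← kernel.lift_ι f (a - b) (by
          rw [Preadditive.sub_comp, h, sub_self]), Category.assoc, hk, comp_zero]
    choose d hd using hd
    exact ⟨⟨_, kernel.ι f, kernel.condition f, CokernelCofork.IsColimit.ofπ _ _
      (fun {W} k hk => d W k hk) (fun {W} k hk => hd W k hk)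
      (fun k hk b hb => by rw [← cancel_epi f, hb, hd])⟩⟩

variable (A) in
/-- Preadditive Barr exact categories are abelian. -/
theorem nonempty_abelian_of_barrExact : Nonempty (Abelian A) :=
  have := hasCokernels_of_barrExact (A := A)
  have := isNormalMonoCategory_of_barrExact (A := A)
  have := isNormalEpiCategory_of_barrExact (A := A)
  ⟨{ has_kernels := inferInstance
     has_finite_products := inferInstance }⟩

end Abelian

/-! ### Equational reasoning in regular logic -/

namespace Prov

variable {S : Signature.{w}} {T : Theory S} {Γ Δ Ξ : List S.Srt} {ω : Formula S Ξ} {s : S.Srt}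
  {t t' t'' : Term S Ξ s}

theorem eqs_single (h : Prov T ω (.eq t t')) :
    Prov T ω (Formula.eqs (SynCat.single t) (SynCat.single t')) :=
  and_intro h (top_intro _)

theorem eq_symm (h : Prov T ω (.eq t t')) : Prov T ω (.eq t' t) :=
  (eqs_symm (eqs_single h)).and_fst

theorem eq_trans (h : Prov T ω (.eq t t')) (h' : Prov T ω (.eq t' t'')) :
    Prov T ω (.eq t t'') :=
  (eqs_trans (eqs_single h) (eqs_single h')).and_fst

theorem eq_of_eq (h : t = t') : Prov T ω (.eq t t') := by
  subst h; exact (top_intro _).cut (eq_refl _)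

theorem eq_app (f : S.Fn) {ρ ρ' : Sub S (S.dom f) Ξ}
    (h : ∀ s (x : Var (S.dom f) s), Prov T ω (.eq (ρ s x) (ρ' s x))) :
    Prov T ω (.eq (.app f ρ) (.app f ρ')) :=
  (eqs_comp (SynCat.single (.app f fun _ x => .var x)) (eqs_of_forall h)).and_fst

theorem eq_of_eqs {σ τ : Sub S Γ Ξ} (h : Prov T ω (Formula.eqs σ τ)) {s : S.Srt} (x : Var Γ s) :
    Prov T ω (.eq (σ s x) (τ s x)) :=
  (eqs_comp (SynCat.single (.var x)) h).and_fst

theorem eq_sub (t : Term S Γ s) {σ τ : Sub S Γ Ξ}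
    (h : ∀ s (x : Var Γ s), Prov T ω (.eq (σ s x) (τ s x))) :
    Prov T ω (.eq (t.sub σ) (t.sub τ)) :=
  (eqs_comp (SynCat.single t) (eqs_of_forall h)).and_fst

theorem ax_sub {φ ψ : Formula S Γ} (h : T Γ φ ψ) (σ : Sub S Γ Ξ) (h' : Prov T ω (φ.sub σ)) :
    Prov T ω (ψ.sub σ) :=
  force (.ax h) h'

theorem ex_force {Γ : List S.Srt} {φ : Formula S (s :: Γ)} {ψ : Formula S Ξ} {σ : Sub S Γ Ξ}
    (h : Prov T ω ((Formula.ex s φ).sub σ))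
    (H : ∀ {Θ : List S.Srt} (ε : Sub S Ξ Θ) (t : Term S Θ s) (ω' : Formula S Θ),
      Prov T ω' (ω.sub ε) → Prov T ω' (φ.sub (Sub.cons t (σ.comp ε))) → Prov T ω' (ψ.sub ε)) :
    Prov T ω ψ :=
  exs_force (Δ := [s]) h fun ε τ ω' h₁ h₂ => H ε (τ _ .zero) ω' h₁ h₂

theorem ex_of_sub {Γ : List S.Srt} {φ : Formula S (s :: Γ)} {σ : Sub S Γ Ξ} (t : Term S Ξ s)
    (h : Prov T ω (φ.sub (Sub.cons t σ))) : Prov T ω ((Formula.ex s φ).sub σ) :=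
  exs_of (Δ := [s]) (SynCat.single t) σ h

end Prov

/-! ### Theories whose sorts are abelian groups -/

/-- Terms that make each sort of a theory an abelian group. -/
structure GroupOps {S : Signature.{w}} (T : Theory S) where
  zero {Γ : List S.Srt} (s : S.Srt) : Term S Γ s
  neg {Γ : List S.Srt} {s : S.Srt} (a : Term S Γ s) : Term S Γ s
  add {Γ : List S.Srt} {s : S.Srt} (a b : Term S Γ s) : Term S Γ s
  zero_sub {Γ Δ : List S.Srt} (s : S.Srt) (σ : Sub S Γ Δ) : (zero s).sub σ = zero s
  neg_sub {Γ Δ : List S.Srt} {s : S.Srt} (σ : Sub S Γ Δ) (a : Term S Γ s) :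
    (neg a).sub σ = neg (a.sub σ)
  add_sub {Γ Δ : List S.Srt} {s : S.Srt} (σ : Sub S Γ Δ) (a b : Term S Γ s) :
    (add a b).sub σ = add (a.sub σ) (b.sub σ)
  neg_congr {Γ : List S.Srt} {s : S.Srt} {ω : Formula S Γ} {a a' : Term S Γ s} :
    Prov T ω (.eq a a') → Prov T ω (.eq (neg a) (neg a'))
  add_congr {Γ : List S.Srt} {s : S.Srt} {ω : Formula S Γ} {a a' b b' : Term S Γ s} :
    Prov T ω (.eq a a') → Prov T ω (.eq b b') → Prov T ω (.eq (add a b) (add a' b'))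
  add_assoc {Γ : List S.Srt} {s : S.Srt} (ω : Formula S Γ) (a b c : Term S Γ s) :
    Prov T ω (.eq (add (add a b) c) (add a (add b c)))
  add_zero {Γ : List S.Srt} {s : S.Srt} (ω : Formula S Γ) (a : Term S Γ s) :
    Prov T ω (.eq (add a (zero s)) a)
  neg_add {Γ : List S.Srt} {s : S.Srt} (ω : Formula S Γ) (a : Term S Γ s) :
    Prov T ω (.eq (add (neg a) a) (zero s))
  add_comm {Γ : List S.Srt} {s : S.Srt} (ω : Formula S Γ) (a b : Term S Γ s) :
    Prov T ω (.eq (add a b) (add b a))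

namespace GroupOps

variable {S : Signature.{w}} {T : Theory S} (G : GroupOps T) {Γ Δ Ξ : List S.Srt}
  (ω : Formula S Ξ) {s : S.Srt}

/-- Terms up to provable equality. -/
structure TmQ (_ : GroupOps T) (ω : Formula S Ξ) (s : S.Srt) : Type w where
  /-- the underlying class -/
  out : Quot fun t t' : Term S Ξ s => Prov T ω (.eq t t')

/-- The class of a term. -/
def cls (t : Term S Ξ s) : G.TmQ ω s := ⟨Quot.mk _ t⟩

variable {ω}

theorem cls_eq_iff {t t' : Term S Ξ s} : G.cls ω t = G.cls ω t' ↔ Prov T ω (.eq t t') := by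
  refine ⟨fun h => ?_, fun h => congrArg TmQ.mk (Quot.sound h)⟩
  have e : Equivalence fun t t' : Term S Ξ s => Prov T ω (.eq t t') :=
    ⟨fun _ => Prov.eq_of_eq rfl, Prov.eq_symm, Prov.eq_trans⟩
  exact Quotient.exact (s := ⟨_, e⟩) (congrArg TmQ.out h)

theorem cls_surjective (a : G.TmQ ω s) : ∃ t, G.cls ω t = a := by
  obtain ⟨⟨t⟩⟩ := a
  exact ⟨t, rfl⟩

instance : Zero (G.TmQ ω s) := ⟨G.cls ω (G.zero s)⟩

instance : Neg (G.TmQ ω s) :=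
  ⟨fun a => ⟨Quot.map G.neg (fun _ _ h => G.neg_congr h) a.out⟩⟩

instance : Add (G.TmQ ω s) :=
  ⟨fun a b => ⟨Quot.map₂ G.add (fun _ _ _ h => G.add_congr (Prov.eq_of_eq rfl) h)
    (fun _ _ _ h => G.add_congr h (Prov.eq_of_eq rfl)) a.out b.out⟩⟩

@[simp]
theorem cls_zero : G.cls ω (G.zero s) = 0 := rfl

@[simp]
theorem cls_neg (t : Term S Ξ s) : G.cls ω (G.neg t) = -G.cls ω t := rfl

@[simp]
theorem cls_add (t t' : Term S Ξ s) : G.cls ω (G.add t t') = G.cls ω t + G.cls ω t' := rfl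

/-- Provable equations at the stage `ω` become equations in an honest abelian group, so consequences
of the group axioms can be taken from algebra instead of being derived in the calculus. -/
instance : AddCommGroup (G.TmQ ω s) where
  nsmul := nsmulRec
  zsmul := zsmulRec
  add_assoc a b c := by
    obtain ⟨a, rfl⟩ := G.cls_surjective a
    obtain ⟨b, rfl⟩ := G.cls_surjective b
    obtain ⟨c, rfl⟩ := G.cls_surjective c
    exact G.cls_eq_iff.2 (G.add_assoc ω a b c)
  zero_add a := by
    obtain ⟨a, rfl⟩ := G.cls_surjective a
    exact G.cls_eq_iff.2 ((G.add_comm ω _ a).eq_trans (G.add_zero ω a))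
  add_zero a := by
    obtain ⟨a, rfl⟩ := G.cls_surjective a
    exact G.cls_eq_iff.2 (G.add_zero ω a)
  neg_add_cancel a := by
    obtain ⟨a, rfl⟩ := G.cls_surjective a
    exact G.cls_eq_iff.2 (G.neg_add ω a)
  add_comm a b := by
    obtain ⟨a, rfl⟩ := G.cls_surjective a
    obtain ⟨b, rfl⟩ := G.cls_surjective b
    exact G.cls_eq_iff.2 (G.add_comm ω a b)

theorem prov_zero_eq (ω : Formula S Ξ) (s : S.Srt) :
    Prov T ω (.eq (G.zero s) (G.add (G.zero s) (G.zero s))) :=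
  (G.add_zero _ _).eq_symm

theorem prov_neg_add_eq (ω : Formula S Ξ) (a b : Term S Ξ s) :
    Prov T ω (.eq (G.neg (G.add a b)) (G.add (G.neg a) (G.neg b))) :=
  G.cls_eq_iff.1 (by simp only [cls_neg, cls_add, _root_.neg_add])

theorem prov_add_add_add_comm (ω : Formula S Ξ) (a b c d : Term S Ξ s) :
    Prov T ω (.eq (G.add (G.add a b) (G.add c d)) (G.add (G.add a c) (G.add b d))) :=
  G.cls_eq_iff.1 (by simp only [cls_add, _root_.add_add_add_comm])

/-- The zero substitution. -/
def zeroSub (Γ Ξ : List S.Srt) : Sub S Γ Ξ := fun s _ => G.zero s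

/-- The negative of a substitution. -/
def negSub (α : Sub S Γ Ξ) : Sub S Γ Ξ := fun s x => G.neg (α s x)

/-- The sum of two substitutions. -/
def addSub (α β : Sub S Γ Ξ) : Sub S Γ Ξ := fun s x => G.add (α s x) (β s x)

theorem zeroSub_comp (ε : Sub S Ξ Δ) : (G.zeroSub Γ Ξ).comp ε = G.zeroSub Γ Δ := by
  funext s x; exact G.zero_sub s ε

theorem negSub_comp (α : Sub S Γ Ξ) (ε : Sub S Ξ Δ) :
    (G.negSub α).comp ε = G.negSub (α.comp ε) := by
  funext s x; exact G.neg_sub ε _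

theorem addSub_comp (α β : Sub S Γ Ξ) (ε : Sub S Ξ Δ) :
    (G.addSub α β).comp ε = G.addSub (α.comp ε) (β.comp ε) := by
  funext s x; exact G.add_sub ε _ _

theorem cons_zeroSub : Sub.cons (G.zero s) (G.zeroSub Γ Ξ) = G.zeroSub (s :: Γ) Ξ := by
  funext r x; cases x <;> rfl

theorem cons_negSub (t : Term S Ξ s) (α : Sub S Γ Ξ) :
    Sub.cons (G.neg t) (G.negSub α) = G.negSub (Sub.cons t α) := by
  funext r x; cases x <;> rfl

theorem cons_addSub (t t' : Term S Ξ s) (α β : Sub S Γ Ξ) :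
    Sub.cons (G.add t t') (G.addSub α β) = G.addSub (Sub.cons t α) (Sub.cons t' β) := by
  funext r x; cases x <;> rfl

theorem cls_sub_congr {α β : Sub S Γ Ξ} (h : ∀ s x, G.cls ω (α s x) = G.cls ω (β s x))
    (t : Term S Γ s) : G.cls ω (t.sub α) = G.cls ω (t.sub β) :=
  G.cls_eq_iff.2 (Prov.eq_sub t fun s x => G.cls_eq_iff.1 (h s x))

theorem eqs_iff {α β : Sub S Γ Ξ} :
    Prov T ω (Formula.eqs α β) ↔ ∀ s x, G.cls ω (α s x) = G.cls ω (β s x) :=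
  ⟨fun h _ x => G.cls_eq_iff.2 (Prov.eq_of_eqs h x),
    fun h => Prov.eqs_of_forall fun s x => G.cls_eq_iff.1 (h s x)⟩

/-- All terms define additive functions. -/
def IsAdditive : Prop := ∀ ⦃Γ Ξ : List S.Srt⦄ (ω : Formula S Ξ) (α β : Sub S Γ Ξ) ⦃s : S.Srt⦄
  (t : Term S Γ s), G.cls ω (t.sub (G.addSub α β)) = G.cls ω (t.sub α) + G.cls ω (t.sub β)

namespace IsAdditive

variable {G}

/-- The usual cancellation from `t(0) = t(0 + 0) = t(0) + t(0)`. -/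
theorem cls_sub_zeroSub (hG : G.IsAdditive) (t : Term S Γ s) : G.cls ω (t.sub (G.zeroSub Γ Ξ)) = 0 := by
  have h := hG ω (G.zeroSub Γ Ξ) (G.zeroSub Γ Ξ) t
  rw [G.cls_sub_congr (β := G.zeroSub Γ Ξ) fun s x => by simp [addSub, zeroSub]] at h
  exact left_eq_add.1 h

theorem cls_sub_negSub (hG : G.IsAdditive) (α : Sub S Γ Ξ) (t : Term S Γ s) :
    G.cls ω (t.sub (G.negSub α)) = -G.cls ω (t.sub α) := by
  have h := hG ω (G.negSub α) α t
  rw [G.cls_sub_congr (β := G.zeroSub Γ Ξ) fun s x => by simp [addSub, negSub, zeroSub],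
    hG.cls_sub_zeroSub] at h
  exact eq_neg_of_add_eq_zero_left h.symm

/-! The solutions of a regular formula form a group. -/

theorem prov_zeroSub (hG : G.IsAdditive) (φ : Formula S Γ) (ω : Formula S Ξ) :
    Prov T ω (φ.sub (G.zeroSub Γ Ξ)) := by
  induction φ with
  | top => exact Prov.top_intro _
  | eq t t' => exact G.cls_eq_iff.1 (by rw [hG.cls_sub_zeroSub, hG.cls_sub_zeroSub])
  | and φ ψ h h' => exact Prov.and_intro h h'
  | ex s φ h =>
    refine Prov.ex_of_sub (G.zero s) ?_
    rw [cons_zeroSub]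
    exact h

theorem prov_negSub (hG : G.IsAdditive) {φ : Formula S Γ} {ω : Formula S Ξ} {α : Sub S Γ Ξ}
    (h : Prov T ω (φ.sub α)) : Prov T ω (φ.sub (G.negSub α)) := by
  induction φ generalizing Ξ with
  | top => exact Prov.top_intro _
  | eq t t' =>
    exact G.cls_eq_iff.1 (by
      rw [hG.cls_sub_negSub, hG.cls_sub_negSub, G.cls_eq_iff.2 h])
  | and φ ψ ih ih' => exact Prov.and_intro (ih h.and_fst) (ih' h.and_snd)
  | ex s φ ih =>
    refine Prov.ex_force h fun ε t ω₁ h₁ h₂ => ?_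
    rw [Formula.sub_sub, negSub_comp]
    refine Prov.ex_of_sub (G.neg t) ?_
    rw [cons_negSub]
    exact ih h₂

theorem prov_addSub (hG : G.IsAdditive) {φ : Formula S Γ} {ω : Formula S Ξ} {α β : Sub S Γ Ξ}
    (h : Prov T ω (φ.sub α)) (h' : Prov T ω (φ.sub β)) : Prov T ω (φ.sub (G.addSub α β)) := by
  induction φ generalizing Ξ with
  | top => exact Prov.top_intro _
  | eq t t' =>
    exact G.cls_eq_iff.1 (by rw [hG, hG, G.cls_eq_iff.2 h, G.cls_eq_iff.2 h'])
  | and φ ψ ih ih' =>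
    exact Prov.and_intro (ih h.and_fst h'.and_fst) (ih' h.and_snd h'.and_snd)
  -- The sum of a witness for `α` and a witness for `β` is a witness for the sum. The second one
  -- exists only at a later stage, to which the first must be restricted.
  | ex s φ ih =>
    refine Prov.ex_force h fun ε t ω₁ h₁ h₂ => ?_
    rw [Formula.sub_sub, addSub_comp]
    refine Prov.ex_force (Prov.restrict_sub h₁ h') fun δ t' ω₂ h₃ h₄ => ?_
    rw [Formula.sub_sub, addSub_comp]
    refine Prov.ex_of_sub (G.add (t.sub δ) t') ?_
    rw [cons_addSub]
    have h₅ := Prov.restrict_sub h₃ h₂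
    rw [Sub.cons_comp] at h₅
    exact ih h₅ h₄

end IsAdditive

end GroupOps

end RegLogic

namespace Homology

open RegLogic

variable {C : Type u} [Category.{v} C] {M : MorphismProperty C} [IsSubcategory M]
  {Γ Δ Ξ : List (HSrt M)}

/-! ### Terms of the homology theory are additive -/

section Terms

variable {s : HSrt M} (σ : Sub (sig M) Γ Ξ)

theorem tZero_sub : (tZero s : Tm Γ s).sub σ = tZero s := by
  simp only [tZero, Term.sub]; congr 1; funext r x; nomatch x

theorem cons_nil_sub {r : (sig M).Srt} (t : Term (sig M) Γ r) :
    (fun s x => ((Sub.cons t Sub.nil : Sub (sig M) [r] Γ) s x).sub σ) =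
      (Sub.cons (t.sub σ) Sub.nil : Sub (sig M) [r] Ξ) := by
  funext r x
  cases x with
  | zero => rfl
  | succ x => nomatch x

theorem tNeg_sub (t : Tm Γ s) : (tNeg t).sub σ = tNeg (t.sub σ) :=
  congrArg (Term.app (S := sig M) (.neg s)) (cons_nil_sub (r := s) σ t)

theorem tMap_sub {n : ℤ} {P Q : Pairs M} (q : P ⟶ Q) (t : Tm Γ (n, P)) :
    (tMap q t).sub σ = tMap q (t.sub σ) :=
  congrArg (Term.app (S := sig M) (.map n q)) (cons_nil_sub (r := (n, P)) σ t)

theorem tBd_sub {n : ℤ} {Z Y X : C} (f : Z ⟶ Y) (g : Y ⟶ X) (hf : M f) (hg : M g)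
    (t : Tm Γ (n, pair g hg)) : (tBd f g hf hg t).sub σ = tBd f g hf hg (t.sub σ) :=
  congrArg (Term.app (S := sig M) (.bd n f g hf hg)) (cons_nil_sub (r := (n, pair g hg)) σ t)

theorem tAdd_sub (t t' : Tm Γ s) : (tAdd t t').sub σ = tAdd (t.sub σ) (t'.sub σ) := by
  refine congrArg (Term.app (S := sig M) (.add s)) ?_
  funext r x
  cases x with
  | zero => rfl
  | succ x =>
    cases x with
    | zero => rfl
    | succ x => nomatch x

end Terms

section Group

variable {s : HSrt M} {ω : Formula (sig M) Ξ}

theorem prov_eqn_of_ax {Γ : List (HSrt M)} {t t' : Tm Γ s} (σ : Sub (sig M) Γ Ξ) {a b : Tm Ξ s}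
    (h : homologyTheory M Γ .top (eqn t t')) (ha : t.sub σ = a) (hb : t'.sub σ = b) :
    Prov (homologyTheory M) ω (eqn a b) := by
  subst ha hb
  exact Prov.ax_sub h σ (Prov.top_intro ω)

theorem prov_and_of_ax {Γ : List (HSrt M)} {t t' r r' : Tm Γ s} (σ : Sub (sig M) Γ Ξ)
    {a b c d : Tm Ξ s} (h : homologyTheory M Γ .top (.and (eqn t t') (eqn r r')))
    (ha : t.sub σ = a) (hb : t'.sub σ = b) (hc : r.sub σ = c) (hd : r'.sub σ = d) :
    Prov (homologyTheory M) ω (eqn a b) ∧ Prov (homologyTheory M) ω (eqn c d) := by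
  subst ha hb hc hd
  have := Prov.ax_sub h σ (Prov.top_intro ω)
  exact ⟨this.and_fst, this.and_snd⟩

variable (M) in
/-- The group structure on the sorts of the homology theory. -/
def groupOps : GroupOps (homologyTheory M) where
  zero s := tZero s
  neg a := tNeg a
  add a b := tAdd a b
  zero_sub _ σ := tZero_sub σ
  neg_sub σ a := tNeg_sub σ a
  add_sub σ a b := tAdd_sub σ a b
  neg_congr h := Prov.eq_app (S := sig M) (.neg _) fun r x => by
    cases x with
    | zero => exact h
    | succ x => nomatch x
  add_congr h h' := Prov.eq_app (S := sig M) (.add _) fun r x => by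
    cases x with
    | zero => exact h
    | succ x =>
      cases x with
      | zero => exact h'
      | succ x => nomatch x
  add_assoc ω a b c := prov_eqn_of_ax
    (Sub.cons a (Sub.cons b (Sub.cons c Sub.nil))) (homologyTheory.add_assoc _)
    ((tAdd_sub _ _ _).trans (congrArg (fun x => tAdd x c) (tAdd_sub _ _ _)))
    ((tAdd_sub _ _ _).trans (congrArg (fun x => tAdd a x) (tAdd_sub _ _ _)))
  add_zero ω a := (prov_and_of_ax (Sub.cons a Sub.nil)
    (homologyTheory.zero_add _) rfl rfl
    ((tAdd_sub _ _ _).trans (congrArg (fun x => tAdd a x) (tZero_sub _))) rfl).2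
  neg_add ω a := (prov_and_of_ax (Sub.cons a Sub.nil)
    (homologyTheory.add_neg _) rfl rfl
    ((tAdd_sub _ _ _).trans (congrArg (fun x => tAdd x a) (tNeg_sub _ _))) (tZero_sub _)).2
  add_comm ω a b := prov_eqn_of_ax (Sub.cons a (Sub.cons b Sub.nil))
    (homologyTheory.add_comm _) (tAdd_sub _ _ _) (tAdd_sub _ _ _)

theorem prov_tMap_congr {n : ℤ} {P Q : Pairs M} (q : P ⟶ Q) {a b : Tm Ξ (n, P)}
    (h : Prov (homologyTheory M) ω (eqn a b)) :
    Prov (homologyTheory M) ω (eqn (tMap q a) (tMap q b)) :=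
  Prov.eq_app (S := sig M) (.map n q) fun r x => by
    cases x with
    | zero => exact h
    | succ x => nomatch x

theorem prov_tBd_congr {n : ℤ} {Z Y X : C} (f : Z ⟶ Y) (g : Y ⟶ X) (hf : M f) (hg : M g)
    {a b : Tm Ξ (n, pair g hg)} (h : Prov (homologyTheory M) ω (eqn a b)) :
    Prov (homologyTheory M) ω (eqn (tBd f g hf hg a) (tBd f g hf hg b)) :=
  Prov.eq_app (S := sig M) (.bd n f g hf hg) fun r x => by
    cases x with
    | zero => exact h
    | succ x => nomatch x

theorem prov_tMap_tAdd {n : ℤ} {P Q : Pairs M} (q : P ⟶ Q) (a b : Tm Ξ (n, P)) :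
    Prov (homologyTheory M) ω (eqn (tMap q (tAdd a b)) (tAdd (tMap q a) (tMap q b))) :=
  prov_eqn_of_ax (Sub.cons a (Sub.cons b Sub.nil)) (homologyTheory.map_add n q)
    ((tMap_sub _ _ _).trans (congrArg (tMap q) (tAdd_sub _ _ _)))
    ((tAdd_sub _ _ _).trans (congrArg₂ tAdd (tMap_sub _ _ _) (tMap_sub _ _ _)))

theorem prov_tBd_tAdd {n : ℤ} {Z Y X : C} (f : Z ⟶ Y) (g : Y ⟶ X) (hf : M f) (hg : M g)
    (a b : Tm Ξ (n, pair g hg)) : Prov (homologyTheory M) ω (eqn (tBd f g hf hg (tAdd a b))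
      (tAdd (tBd f g hf hg a) (tBd f g hf hg b))) :=
  prov_eqn_of_ax (Sub.cons a (Sub.cons b Sub.nil))
    (homologyTheory.bd_add n f g hf hg)
    ((tBd_sub _ _ _ _ _ _).trans (congrArg (tBd f g hf hg) (tAdd_sub _ _ _)))
    ((tAdd_sub _ _ _).trans (congrArg₂ tAdd (tBd_sub _ _ _ _ _ _) (tBd_sub _ _ _ _ _ _)))

theorem eq_cons_cons {r r' : HSrt M} (args : Sub (sig M) [r, r'] Γ) :
    args = Sub.cons (S := sig M) (args _ .zero) (Sub.cons (args _ (.succ .zero)) Sub.nil) := by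
  funext q x
  cases x with
  | zero => rfl
  | succ x =>
    cases x with
    | zero => rfl
    | succ x => nomatch x

/-- An induction principle for the terms of the homology theory. -/
theorem term_induction {P : ∀ s : HSrt M, Tm Γ s → Prop}
    (var : ∀ (s : HSrt M) (x : Var Γ s), P s (Term.var (S := sig M) x))
    (zero : ∀ s, P s (tZero s)) (neg : ∀ s t, P s t → P s (tNeg t))
    (add : ∀ s t t', P s t → P s t' → P s (tAdd t t'))
    (map : ∀ (n : ℤ) (X Y : Pairs M) (q : X ⟶ Y) t, P (n, X) t → P (n, Y) (tMap q t))
    (bd : ∀ (n : ℤ) (Z Y X : C) (f : Z ⟶ Y) (g : Y ⟶ X) (hf : M f) (hg : M g)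
      (t : Tm Γ (n, pair g hg)), P _ t → P _ (tBd f g hf hg t))
    {s : (sig M).Srt} (t : Term (sig M) Γ s) : P s t := by
  induction t with
  | var x => exact var _ x
  | app f args ih =>
    cases f with
    | zero s =>
      obtain rfl : args = Sub.nil := by funext r x; nomatch x
      exact zero s
    | neg s =>
      exact (congrArg (fun a => P s (.app (S := sig M) (.neg s) a)) (SynCat.eq_single args)).mpr
        (neg s _ (ih _ .zero))
    | add s =>
      exact (congrArg (fun a => P s (.app (S := sig M) (.add s) a)) (eq_cons_cons args)).mpr
        (add s _ _ (ih _ .zero) (ih _ (.succ .zero)))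
    | map n q =>
      exact (congrArg (fun a => P _ (.app (S := sig M) (.map n q) a))
        (SynCat.eq_single args)).mpr (map n _ _ q _ (ih _ .zero))
    | bd n f g hf hg =>
      exact (congrArg (fun a => P _ (.app (S := sig M) (.bd n f g hf hg) a))
        (SynCat.eq_single args)).mpr (bd n _ _ _ f g hf hg _ (ih _ .zero))

/-- Terms of the homology theory define additive functions. -/
theorem prov_sub_addSub (ω : Formula (sig M) Ξ) (α β : Sub (sig M) Γ Ξ) (t : Tm Γ s) :
    Prov (homologyTheory M) ω
      (eqn (t.sub ((groupOps M).addSub α β)) (tAdd (t.sub α) (t.sub β))) := by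
  have eq {s : HSrt M} {a a' b b' c c' : Tm Ξ s} (ha : a' = a) (hb : b' = b) (hc : c' = c)
      (h : Prov (homologyTheory M) ω (eqn a (tAdd b c))) :
      Prov (homologyTheory M) ω (eqn a' (tAdd b' c')) := by
    subst ha hb hc; exact h
  -- For the group operations the claim is an identity of abelian groups. For `□_n` and `∂_n` it is
  -- congruence followed by the homomorphism axiom.
  refine term_induction (P := fun s t => Prov (homologyTheory M) ω
    (eqn (s := s) (t.sub ((groupOps M).addSub α β)) (tAdd (t.sub α) (t.sub β)))) ?_ ?_ ?_ ?_ ?_ ?_ t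
  · exact fun s x => Prov.eq_of_eq rfl
  · exact fun s => eq (tZero_sub _) (tZero_sub _) (tZero_sub _) ((groupOps M).prov_zero_eq ω s)
  · exact fun s t h => eq (tNeg_sub _ _) (tNeg_sub _ _) (tNeg_sub _ _)
      (((groupOps M).neg_congr h).eq_trans ((groupOps M).prov_neg_add_eq ω _ _))
  · exact fun s t t' h h' => eq (tAdd_sub _ _ _) (tAdd_sub _ _ _) (tAdd_sub _ _ _)
      (((groupOps M).add_congr h h').eq_trans ((groupOps M).prov_add_add_add_comm ω _ _ _ _))
  · exact fun n X Y q t h => eq (tMap_sub _ _ _) (tMap_sub _ _ _) (tMap_sub _ _ _)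
      ((prov_tMap_congr q h).eq_trans (prov_tMap_tAdd q _ _))
  · exact fun n Z Y X f g hf hg t h => eq (tBd_sub _ _ _ _ _ _) (tBd_sub _ _ _ _ _ _)
      (tBd_sub _ _ _ _ _ _) ((prov_tBd_congr f g hf hg h).eq_trans (prov_tBd_tAdd f g hf hg _ _))

theorem isAdditive_groupOps : (groupOps M).IsAdditive := fun _ _ ω α β _ t =>
  (groupOps M).cls_eq_iff.2 (prov_sub_addSub ω α β t)

end Group

end Homology

namespace RegLogic

/-! ### The syntactic category of an additive theory is preadditive -/

namespace GroupOps

open SynCat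

variable {S : Signature.{w}} {T : Theory S} {G : GroupOps T} (hG : G.IsAdditive)
  {W X Y : SynCat T}

/-- The product of two objects of the syntactic category. -/
abbrev prodObj (X Y : SynCat T) : SynCat T :=
  pb (X := X) (Y := Y) (Z := ⟨[], .top⟩) Sub.nil Sub.nil

/-- The product is a pullback over the terminal object, so the explicit construction by concatenated
contexts applies. -/
theorem isPullback_prodObj (X Y : SynCat T) :
    IsPullback (ofSub (X := prodObj X Y) (Y := X) (Sub.left X.ctx Y.ctx) (Prov.and_left _ _))
      (ofSub (X := prodObj X Y) (Y := Y) (Sub.right X.ctx Y.ctx)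
        ((Prov.and_right _ _).cut (Prov.and_left _ _)))
      (ofSub (Y := (⟨[], .top⟩ : SynCat T)) Sub.nil (Prov.top_intro _))
      (ofSub (Y := (⟨[], .top⟩ : SynCat T)) Sub.nil (Prov.top_intro _)) :=
  isPullback_pb _ _

namespace IsAdditive

/-- The addition of an object of the syntactic category. -/
def addHom (X : SynCat T) : prodObj X X ⟶ X :=
  ofSub (G.addSub (Sub.left X.ctx X.ctx) (Sub.right X.ctx X.ctx))
    (hG.prov_addSub (Prov.and_left _ _) ((Prov.and_right _ _).cut (Prov.and_left _ _)))

/-- The sum of two morphisms in the syntactic category. -/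
noncomputable def sum (f g : W ⟶ X) : W ⟶ X :=
  (isPullback_prodObj X X).lift f g (isTerminalTop.hom_ext _ _) ≫ hG.addHom X

/-- The zero morphism in the syntactic category. -/
def zeroHom (W X : SynCat T) : W ⟶ X := ofSub (G.zeroSub _ _) (hG.prov_zeroSub _ _)

/-- The negative of a morphism in the syntactic category. -/
def negHom (f : W ⟶ X) : W ⟶ X :=
  f ≫ ofSub (G.negSub (Sub.id _)) (hG.prov_negSub Prov.sub_id)

theorem comp_sum {V : SynCat T} (q : V ⟶ W) (f g : W ⟶ X) :
    q ≫ hG.sum f g = hG.sum (q ≫ f) (q ≫ g) := by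
  rw [sum, ← Category.assoc, sum]
  congr 1
  apply (isPullback_prodObj X X).hom_ext <;> simp

theorem sum_ofSub {α β : Sub S X.ctx W.ctx} (h : Prov T W.fml (X.fml.sub α))
    (h' : Prov T W.fml (X.fml.sub β)) :
    hG.sum (ofSub α h) (ofSub β h') = ofSub (G.addSub α β) (hG.prov_addSub h h') := by
  have e : (isPullback_prodObj X X).lift (ofSub α h) (ofSub β h') (isTerminalTop.hom_ext _ _) =
      ofSub (Y := prodObj X X) (Sub.append α β) (pb_iff.2 ⟨h, h', Prov.top_intro _⟩) := by
    apply (isPullback_prodObj X X).hom_ext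
    · simp only [IsPullback.lift_fst, ofSub_comp_ofSub, Sub.left_append]
    · simp only [IsPullback.lift_snd, ofSub_comp_ofSub, Sub.right_append]
  rw [sum, e, addHom, ofSub_comp_ofSub]
  simp only [addSub_comp, Sub.left_append, Sub.right_append]

theorem negHom_ofSub {α : Sub S X.ctx W.ctx} (h : Prov T W.fml (X.fml.sub α)) :
    hG.negHom (ofSub α h) = ofSub (G.negSub α) (hG.prov_negSub h) := by
  rw [negHom, ofSub_comp_ofSub]
  simp only [negSub_comp, Sub.id_comp]

theorem comp_negHom {V : SynCat T} (q : V ⟶ W) (f : W ⟶ X) :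
    q ≫ hG.negHom f = hG.negHom (q ≫ f) :=
  (Category.assoc _ _ _).symm

theorem comp_zeroHom {V : SynCat T} (q : V ⟶ W) :
    q ≫ hG.zeroHom W X = hG.zeroHom V X := by
  have h₀ {U U' : SynCat T} {σ : Sub S U.ctx U'.ctx} (h : Prov T U'.fml (U.fml.sub σ)) :
      ofSub σ h ≫ hG.zeroHom U X = hG.zeroHom U' X := by
    rw [zeroHom, ofSub_comp_ofSub]
    simp only [zeroSub_comp]
    rfl
  obtain ⟨V', p, _, ⟨σ, hσ, rfl⟩, ⟨α, hα, e⟩⟩ := exists_isIso_isSub q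
  rw [← cancel_epi (ofSub σ hσ), ← Category.assoc, e, h₀, h₀]

/-- Both sides are substitutions, and their equality is the additivity of the terms of `τ`. -/
theorem sum_comp_ofSub {α β : Sub S X.ctx W.ctx} (h : Prov T W.fml (X.fml.sub α))
    (h' : Prov T W.fml (X.fml.sub β)) {τ : Sub S Y.ctx X.ctx} (hτ : Prov T X.fml (Y.fml.sub τ)) :
    hG.sum (ofSub α h) (ofSub β h') ≫ ofSub τ hτ =
      hG.sum (ofSub α h ≫ ofSub τ hτ) (ofSub β h' ≫ ofSub τ hτ) := by
  rw [hG.sum_ofSub, ofSub_comp_ofSub, ofSub_comp_ofSub, ofSub_comp_ofSub, hG.sum_ofSub,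
    ofSub_eq_iff]
  exact G.eqs_iff.2 fun s x => hG _ _ _ (τ s x)

/-- Write `k` as the inverse of an invertible substitution followed by a substitution, and move `f`
and `g` across the inverse. On a common copy of the source everything is a substitution, and
additivity of terms applies to both factors. -/
theorem sum_comp (f g : W ⟶ X) (k : X ⟶ Y) : hG.sum f g ≫ k = hG.sum (f ≫ k) (g ≫ k) := by
  obtain ⟨X', p, _, ⟨σ, hσ, rfl⟩, ⟨τ, hτ, e⟩⟩ := exists_isIso_isSub k
  obtain ⟨W', r, _, -, ⟨α, h, eα⟩, ⟨β, h', eβ⟩⟩ :=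
    exists_isIso_isSub₂ (f ≫ inv (ofSub σ hσ)) (g ≫ inv (ofSub σ hσ))
  have eα' : r ≫ f = ofSub α h ≫ ofSub σ hσ := by simp [← eα]
  have eβ' : r ≫ g = ofSub β h' ≫ ofSub σ hσ := by simp [← eβ]
  rw [← cancel_epi r, ← Category.assoc, hG.comp_sum, hG.comp_sum, ← Category.assoc,
    ← Category.assoc, eα', eβ', ← hG.sum_comp_ofSub, Category.assoc, Category.assoc,
    Category.assoc, e, hG.sum_comp_ofSub]

theorem exists_ofSub₃ (f g k : W ⟶ X) : ∃ (V : SynCat T) (p : V ⟶ W), IsIso p ∧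
    IsSub (p ≫ f) ∧ IsSub (p ≫ g) ∧ IsSub (p ≫ k) := by
  obtain ⟨V, p, _, hp, hf, hg⟩ := exists_isIso_isSub₂ f g
  obtain ⟨V', p', _, hp', hk⟩ := exists_isIso_isSub (p ≫ k)
  exact ⟨V', p' ≫ p, inferInstance, by simpa using hp'.comp hf, by simpa using hp'.comp hg,
    by simpa using hk⟩

/-- The syntactic category of an additive theory is preadditive. -/
noncomputable abbrev preadditive : Preadditive (SynCat T) where
  homGroup W X :=
    { add f g := hG.sum f g
      zero := hG.zeroHom W X
      neg f := hG.negHom f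
      nsmul := @nsmulRec _ ⟨hG.zeroHom W X⟩ ⟨hG.sum⟩
      zsmul := @zsmulRec _ ⟨hG.zeroHom W X⟩ ⟨hG.sum⟩ ⟨hG.negHom⟩
        (@nsmulRec _ ⟨hG.zeroHom W X⟩ ⟨hG.sum⟩)
      add_assoc a b c := by
        -- On an isomorphic copy of `W` the morphisms are substitutions. The law then holds variable
        -- by variable in the group of classes of terms; the other laws follow the same pattern.
        obtain ⟨V, p, _, ⟨α, hα, ha⟩, ⟨β, hβ, hb⟩, ⟨γ, hγ, hc⟩⟩ := exists_ofSub₃ a b c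
        change hG.sum (hG.sum a b) c = hG.sum a (hG.sum b c)
        rw [← cancel_epi p]
        simp only [comp_sum, ha, hb, hc, sum_ofSub]
        exact ofSub_eq_iff.2 (G.eqs_iff.2 fun s x => _root_.add_assoc (G.cls _ (α s x))
          (G.cls _ (β s x)) (G.cls _ (γ s x)))
      zero_add a := by
        obtain ⟨V, p, _, -, ⟨α, hα, ha⟩⟩ := exists_isIso_isSub a
        change hG.sum (hG.zeroHom W X) a = a
        rw [← cancel_epi p]
        simp only [comp_sum, comp_zeroHom, ha]
        exact (hG.sum_ofSub _ _).trans (ofSub_eq_iff.2 (G.eqs_iff.2 fun s x =>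
          zero_add (G.cls _ (α s x))))
      add_zero a := by
        obtain ⟨V, p, _, -, ⟨α, hα, ha⟩⟩ := exists_isIso_isSub a
        change hG.sum a (hG.zeroHom W X) = a
        rw [← cancel_epi p]
        simp only [comp_sum, comp_zeroHom, ha]
        exact (hG.sum_ofSub _ _).trans (ofSub_eq_iff.2 (G.eqs_iff.2 fun s x =>
          _root_.add_zero (G.cls _ (α s x))))
      neg_add_cancel a := by
        obtain ⟨V, p, _, -, ⟨α, hα, ha⟩⟩ := exists_isIso_isSub a
        change hG.sum (hG.negHom a) a = hG.zeroHom W X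
        rw [← cancel_epi p]
        simp only [comp_sum, comp_negHom, comp_zeroHom, ha, negHom_ofSub, sum_ofSub]
        exact ofSub_eq_iff.2 (G.eqs_iff.2 fun s x => neg_add_cancel (G.cls _ (α s x)))
      add_comm a b := by
        obtain ⟨V, p, _, -, ⟨α, hα, ha⟩, ⟨β, hβ, hb⟩⟩ := exists_isIso_isSub₂ a b
        change hG.sum a b = hG.sum b a
        rw [← cancel_epi p]
        simp only [comp_sum, ha, hb, sum_ofSub]
        exact ofSub_eq_iff.2 (G.eqs_iff.2 fun s x => _root_.add_comm (G.cls _ (α s x))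
          (G.cls _ (β s x))) }
  add_comp := fun _ _ _ f g k => hG.sum_comp f g k
  comp_add := fun _ _ _ q f g => hG.comp_sum q f g

end IsAdditive

end GroupOps

end RegLogic

/-! ### The exact completion for the homology theory. -/

theorem mainTheorem1 {C : Type u} [Category.{v} C] (M : MorphismProperty C)
    [Homology.IsSubcategory M] :
    RegLogic.IsBarrExactCompletion.{_, _, u', v'}
      (RegLogic.toExactCompletion (RegLogic.SynCat (Homology.homologyTheory M))) ∧
    Nonempty (Abelian (Homology.Motives M)) ∧
    ∃ (_ : RegLogic.BarrExact (Homology.Motives M))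
      (H : RegLogic.Mod (Homology.Motives M) (Homology.homologyTheory M)),
      ∀ (E : Type u') [Category.{v'} E] [RegLogic.BarrExact E],
        ∃ e : RegLogic.Ex (Homology.Motives M) E ≌ RegLogic.Mod E (Homology.homologyTheory M),
          Nonempty (e.functor ⋙ (RegLogic.isModel E (Homology.homologyTheory M)).ι ≅
            RegLogic.evalAt H.obj) := by
  have hι := RegLogic.isRegularFunctor_toExactCompletion
    (RegLogic.SynCat (Homology.homologyTheory M))
  have hc := RegLogic.isCovered_toExactCompletion (RegLogic.SynCat (Homology.homologyTheory M))
  refine ⟨RegLogic.isBarrExactCompletion_toExactCompletion _, ?_,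
    RegLogic.barrExact_exactCompletion _, RegLogic.genericModel _ hι, fun E _ _ => RegLogic.exists_equivalence_mod hι E hc⟩
  -- Additivity passes from the terms of the theory to the syntactic category and from there to its
  -- completion, which is Barr exact and hence abelian.
  let _ := (Homology.isAdditive_groupOps (M := M)).preadditive
  let _ := RegLogic.preadditiveOfIsCovered hι hc
  exact RegLogic.nonempty_abelian_of_barrExact _
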